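/- Let $m,n\ge 0$ be integers with $m+n>0$. **Alphabet, weights, crystals.** Let $\mathbf B=\{\overline m<\cdots<\overline 1<1<\cdots<n\}$, with $|b|=0$ for barred and $|b|=1$ for unbarred letters. Let $P=\bigoplus_{b\in\mathbf B}\mathbb Z\epsilon_b$ with the symmetric form $(\epsilon_b,\epsilon_{b'})=(-1)^{|b|}\delta_{bb'}$. Let $I=\{\overline{m-1},\dots,\overline 1,0,1,\dots,n-1\}$, where the index $0$ is present only if $m,n\ge 1$. Put $\alpha_{\overline k}=\epsilon_{\overline{k+1}}-\epsilon_{\overline k}$, $\alpha_0=\epsilon_{\overline 1}-\epsilon_1$, $\alpha_l=\epsilon_l-\epsilon_{l+1}$, and $\langle h_i,\lambda\rangle=(\alpha_i,\lambda)$ for $i=\overline{m-1},\dots,\overline 1,0$, $\langle h_i,\lambda\rangle=-(\alpha_i,\lambda)$ for $i=1,\dots,n-1$. A $\mathfrak{gl}_{m|n}$-crystal is a set $B$ with maps $\mathrm{wt}:B\to P$, $\varepsilon_i,\varphi_i:B\to\mathbb Z_{\ge0}$, $e_i,f_i:B\to B\sqcup\{0\}$ $(i\in I)$ such that - (a) $\varphi_i(b)-\varepsilon_i(b)=\langle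 h_i,\mathrm{wt}(b)\rangle$ for $i\ne0$; $\langle h_0,\mathrm{wt}(b)\rangle\ge0$, and $\varphi_0(b)+\varepsilon_0(b)$ is $0$ if $\langle h_0,\mathrm{wt}(b)\rangle=0$ and $1$ otherwise; - (b) if $e_ib\in B$, then $\varepsilon_i(e_ib)=\varepsilon_i(b)-1$, $\varphi_i(e_ib)=\varphi_i(b)+1$, $\mathrm{wt}(e_ib)=\mathrm{wt}(b)+\alpha_i$; - (c) if $f_ib\in B$, then $\varepsilon_i(f_ib)=\varepsilon_i(b)+1$, $\varphi_i(f_ib)=\varphi_i(b)-1$, $\mathrm{wt}(f_ib)=\mathrm{wt}(b)-\alpha_i$; - (d) for $b,b'\in B$, $f_ib=b'$ if and only if $e_ib'=b$. An isomorphism of crystals is a bijection that is an isomorphism of $I$-coloured oriented graphs (with arrows $b\xrightarrow{i}f_ib$) and preserves $\mathrm{wt},\varepsilon_i,\varphi_i$. A direct sum is a disjoint union. **Tensor products and words.** The set $B_1\otimes B_2=B_1\times B_2$ has $\mathrm{wt}(b_1\otimes b_2)=\mathrm{wt}(b_1)+\mathrm{wt}(b_2)$ and the following structure (with $0\otimes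 b_2=b_1\otimes0=0$). - For $i=\overline{m-1},\dots,\overline1$: $\varepsilon_i(b_1\otimes b_2)=\max(\varepsilon_i(b_1),\varepsilon_i(b_2)-\langle h_i,\mathrm{wt}(b_1)\rangle)$ and $\varphi_i(b_1\otimes b_2)=\max(\varphi_i(b_1)+\langle h_i,\mathrm{wt}(b_2)\rangle,\varphi_i(b_2))$; $e_i$ acts on $b_1$ if $\varphi_i(b_1)\ge\varepsilon_i(b_2)$ and on $b_2$ otherwise; $f_i$ acts on $b_1$ if $\varphi_i(b_1)>\varepsilon_i(b_2)$ and on $b_2$ otherwise. - For $i=1,\dots,n-1$: $\varepsilon_i(b_1\otimes b_2)=\max(\varepsilon_i(b_1)-\langle h_i,\mathrm{wt}(b_2)\rangle,\varepsilon_i(b_2))$ and $\varphi_i(b_1\otimes b_2)=\max(\varphi_i(b_1),\varphi_i(b_2)+\langle h_i,\mathrm{wt}(b_1)\rangle)$; $e_i$ acts on $b_1$ if $\varphi_i(b_2)<\varepsilon_i(b_1)$ and on $b_2$ otherwise; $f_i$ acts on $b_1$ if $\varphi_i(b_2)\le\varepsilon_i(b_1)$ and on $b_2$ otherwise. - For $i=0$: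 if $\langle h_0,\mathrm{wt}(b_1)\rangle>0$, then $\varepsilon_0,\varphi_0$ of $b_1\otimes b_2$ are those of $b_1$ and $e_0,f_0$ act on $b_1$; otherwise the same holds with $b_2$. The letters form a crystal with $\mathrm{wt}(b)=\epsilon_b$ and arrows $\overline m\xrightarrow{\overline{m-1}}\cdots\xrightarrow{\overline1}\overline1\xrightarrow{0}1\xrightarrow{1}\cdots\xrightarrow{n-1}n$, where $\varepsilon_i(b)$, $\varphi_i(b)$ count the $i$-arrows into and out of $b$. The set $\mathcal W$ of finite words becomes a crystal by identifying $w_1\cdots w_r$ with $w_1\otimes\cdots\otimes w_r$; the empty word has weight $0$, $\varepsilon_i=\varphi_i=0$ and $e_i=f_i=0$. **Tableaux.** Let $\mathcal P_{m|n}$ be the set of partitions $\lambda$ with $\lambda_{m+1}\le n$. For $\lambda\in\mathcal P_{m|n}$ let $\mathbf B_{m|n}(\lambda)$ be the set of fillings of the Young diagram of $\lambda$ by letters that weakly increase along rows (left to right) and columns (top to bottom), such that barred letters strictly increase in each column and unbarred letters strictly increase in each row. View it as a subset of $\mathcal W$ by reading the columns from right to left, each from top to bottom. **Matrices.** Let $\mathbf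 M$ be the set of matrices $A=(a_{bb'})_{b,b'\in\mathbf B}$ of non-negative integers with $a_{bb'}\le1$ if $|b|\ne|b'|$. Order pairs of letters by: $(b,b')<(c,c')$ if $b'<c'$, or $b'=c'$, $|b'|=0$ and $b>c$, or $b'=c'$, $|b'|=1$ and $b<c$. For words of equal length, let $A(\mathbf i,\mathbf j)$ be the matrix whose $(b,b')$ entry is the number of $k$ with $(i_k,j_k)=(b,b')$. Each $A\in\mathbf M$ is $A(\mathbf i,\mathbf j)$ for a unique pair whose sequence $(i_k,j_k)$ is weakly increasing, and is $A(\mathbf k,\mathbf l)$ for a unique pair whose sequence $(l_k,k_k)$ is weakly increasing. For $x=e,f$ and $i\in I$, put $x_iA=A(x_i\mathbf i,\mathbf j)$ and $x_i^*A=A(\mathbf k,x_i\mathbf l)$ (which is $0$ if $x_i\mathbf i=0$, respectively $x_i\mathbf l=0$). Let $\mathfrak M=\{A\in\mathbf M: A=A^t\}$. For $A\in\mathfrak M$ put $\mathbf e_iA=e_ie_i^*A$, $\mathbf f_iA=f_if_i^*A$ (with $x_i0=x_i^*0=0$), $\mathrm{wt}(A)=\sum_b\big(\sum_{b'}a_{bb'}\big)\epsilon_b$,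 $\varepsilon_i(A)=\max\{k:\mathbf e_i^kA\ne0\}$ and $\varphi_i(A)=\max\{k:\mathbf f_i^kA\ne0\}$. **Proposition.** For all $i\in I$ and $A\in\mathfrak M$ one has $e_ie_i^*A=e_i^*e_iA$ and $f_if_i^*A=f_i^*f_iA$, and the maxima defining $\varepsilon_i(A)$ and $\varphi_i(A)$ exist. With $\mathrm{wt},\varepsilon_i,\varphi_i,\mathbf e_i,\mathbf f_i$ $(i\in I)$, the set $\mathfrak M$ is a $\mathfrak{gl}_{m|n}$-crystal (in particular $\mathbf e_i,\mathbf f_i$ map $\mathfrak M$ to $\mathfrak M\sqcup\{0\}$). Each $\mathbf B_{m|n}(\lambda)$, $\lambda\in\mathcal P_{m|n}$, with the maps of $\mathcal W$, is a $\mathfrak{gl}_{m|n}$-crystal, and there is an isomorphism of $\mathfrak{gl}_{m|n}$-crystals $$\mathfrak M\;\simeq\;\bigoplus_{\lambda\in\mathcal P_{m|n}}\mathbf B_{m|n}(\lambda).$$ -/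

import Mathlib

namespace HookCrystal

/-! ### The ordered alphabet, weights and roots -/

/-- The linearly ordered alphabet `m̄ < ⋯ < 1̄ < 1 < ⋯ < n`: the element `k` of `Fin (m + n)` stands
for the letter `(m - k)‾` if `k < m`, and for the letter `k - m + 1` if `m ≤ k`. -/
abbrev Letter (m n : ℕ) : Type := Fin (m + n)

/-- The degree `|b|`: it is `0` on the barred letters and `1` on the unbarred ones. -/
def degree {m n : ℕ} (b : Letter m n) : ℕ := if b.val < m then 0 else 1

/-- The index set `(m-1)‾, …, 1̄, 0, 1, …, n-1` of the simple roots, listed in this order: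
`i` stands for `(m - 1 - i)‾` if `i + 1 < m`, for `0` if `i + 1 = m`, and for `i + 1 - m` if
`m < i + 1`. The index `0` is present exactly if `m` and `n` are both positive. -/
abbrev Index (m n : ℕ) : Type := Fin (m + n - 1)

/-- The letter `b` at the tail of the only `i`-coloured arrow `b → b'` between letters. -/
def Index.lo {m n : ℕ} (i : Index m n) : Letter m n := ⟨i.val, by omega⟩

/-- The letter `b'` at the head of the only `i`-coloured arrow `b → b'` between letters. -/
def Index.hi {m n : ℕ} (i : Index m n) : Letter m n := ⟨i.val + 1, by omega⟩

/-- The weight lattice, free on the `ε_b`; a weight is given by its coordinates. -/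
abbrev Weight (m n : ℕ) : Type := Letter m n → ℤ

/-- The bilinear form with `(ε_b, ε_b') = (-1)^|b| δ_{bb'}`. -/
def form {m n : ℕ} (x y : Weight m n) : ℤ := ∑ b, (-1) ^ degree b * (x b * y b)

/-- The simple root `α_i`. -/
def simpleRoot {m n : ℕ} (i : Index m n) : Weight m n := Pi.single i.lo 1 - Pi.single i.hi 1

/-- The value `⟨h_i, x⟩` of the simple coroot: `(α_i, x)` for `i = (m-1)‾, …, 1̄, 0`, and
`-(α_i, x)` for `i = 1, …, n - 1`. -/
def coroot {m n : ℕ} (i : Index m n) (x : Weight m n) : ℤ :=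
  if i.val + 1 ≤ m then form (simpleRoot i) x else -form (simpleRoot i) x

/-! ### Crystals -/

/-- The maps that make up a crystal, without the axioms; `none` is the formal symbol `0`. -/
structure CrystalMaps (m n : ℕ) (B : Type) where
  wt : B → Weight m n
  eps : Index m n → B → ℕ
  phi : Index m n → B → ℕ
  e : Index m n → B → Option B
  f : Index m n → B → Option B

/-- The set `S`, with the restrictions to `S` of the given maps, is a crystal for `gl(m|n)`. The
first two fields say that `e_i` and `f_i` are maps from `S` to `S ∪ {0}`. -/
structure IsCrystalOn {m n : ℕ} {B : Type} (C : CrystalMaps m n B) (S : Set B) : Prop where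
  e_mem : ∀ i, ∀ b ∈ S, ∀ b', C.e i b = some b' → b' ∈ S
  f_mem : ∀ i, ∀ b ∈ S, ∀ b', C.f i b = some b' → b' ∈ S
  phi_sub_eps : ∀ i : Index m n, i.val + 1 ≠ m → ∀ b ∈ S,
    (C.phi i b : ℤ) - C.eps i b = coroot i (C.wt b)
  coroot_zero_nonneg : ∀ i : Index m n, i.val + 1 = m → ∀ b ∈ S, 0 ≤ coroot i (C.wt b)
  phi_add_eps : ∀ i : Index m n, i.val + 1 = m → ∀ b ∈ S,
    C.phi i b + C.eps i b = if coroot i (C.wt b) = 0 then 0 else 1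
  of_e : ∀ i, ∀ b ∈ S, ∀ b', C.e i b = some b' →
    (C.eps i b' : ℤ) = C.eps i b - 1 ∧ C.phi i b' = C.phi i b + 1 ∧
      C.wt b' = C.wt b + simpleRoot i
  of_f : ∀ i, ∀ b ∈ S, ∀ b', C.f i b = some b' →
    C.eps i b' = C.eps i b + 1 ∧ (C.phi i b' : ℤ) = C.phi i b - 1 ∧
      C.wt b' = C.wt b - simpleRoot i
  f_iff_e : ∀ i, ∀ b ∈ S, ∀ b' ∈ S, C.f i b = some b' ↔ C.e i b' = some b

/-- The crystals carried by `S` and `T` are isomorphic: there is an isomorphism of coloured oriented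
graphs (with an arrow `b → b'` of colour `i` if `f_i b = b'`) that preserves `wt`, `ε_i`, `φ_i`. -/
def Isomorphic {m n : ℕ} {B B' : Type} (C : CrystalMaps m n B) (S : Set B)
    (D : CrystalMaps m n B') (T : Set B') : Prop :=
  ∃ ψ : S ≃ T,
    (∀ b : S, D.wt (ψ b).val = C.wt b.val) ∧
    (∀ (i : Index m n) (b : S), D.eps i (ψ b).val = C.eps i b.val) ∧
    (∀ (i : Index m n) (b : S), D.phi i (ψ b).val = C.phi i b.val) ∧
    (∀ (i : Index m n) (b b' : S), C.f i b.val = some b'.val ↔ D.f i (ψ b).val = some (ψ b').val)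

/-- The maps of a direct sum (disjoint union) of copies of `B`, indexed by `ι`. -/
def CrystalMaps.copies {m n : ℕ} {B : Type} (C : CrystalMaps m n B) (ι : Type) :
    CrystalMaps m n (ι × B) where
  wt x := C.wt x.2
  eps i x := C.eps i x.2
  phi i x := C.phi i x.2
  e i x := (C.e i x.2).map fun b => (x.1, b)
  f i x := (C.f i x.2).map fun b => (x.1, b)

/-! ### The crystal of words -/

/-- The crystal of letters, `m̄ → ⋯ → 1̄ → 1 → ⋯ → n`. -/
def letterMaps (m n : ℕ) : CrystalMaps m n (Letter m n) where
  wt b := Pi.single b 1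
  eps i b := if b = i.hi then 1 else 0
  phi i b := if b = i.lo then 1 else 0
  e i b := if b = i.hi then some i.lo else none
  f i b := if b = i.lo then some i.hi else none

/-- The value `ε_i(b₁ ⊗ b₂)`, where `ε_i(b_k) = a_k` and `wt(b_k) = x_k`. The maxima here and in
`tensorPhi` are non-negative, so `Int.toNat` does not change them. -/
def tensorEps {m n : ℕ} (i : Index m n) (a₁ a₂ : ℕ) (x₁ x₂ : Weight m n) : ℕ :=
  if i.val + 1 < m then (max (a₁ : ℤ) (a₂ - coroot i x₁)).toNat
  else if i.val + 1 = m then (if 0 < coroot i x₁ then a₁ else a₂)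
  else (max ((a₁ : ℤ) - coroot i x₂) (a₂ : ℤ)).toNat

/-- The value `φ_i(b₁ ⊗ b₂)`, where `φ_i(b_k) = a_k` and `wt(b_k) = x_k`. -/
def tensorPhi {m n : ℕ} (i : Index m n) (a₁ a₂ : ℕ) (x₁ x₂ : Weight m n) : ℕ :=
  if i.val + 1 < m then (max ((a₁ : ℤ) + coroot i x₂) (a₂ : ℤ)).toNat
  else if i.val + 1 = m then (if 0 < coroot i x₁ then a₁ else a₂)
  else (max (a₁ : ℤ) (a₂ + coroot i x₁)).toNat

/-- The condition for `e_i (b₁ ⊗ b₂) = e_i b₁ ⊗ b₂`; otherwise `e_i (b₁ ⊗ b₂) = b₁ ⊗ e_i b₂`. Here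
`eps₁ = ε_i(b₁)`, `phi₁ = φ_i(b₁)`, `x₁ = wt(b₁)`, `eps₂ = ε_i(b₂)`, `phi₂ = φ_i(b₂)`. -/
abbrev TensorELeft {m n : ℕ} (i : Index m n) (eps₁ phi₁ : ℕ) (x₁ : Weight m n)
    (eps₂ phi₂ : ℕ) : Prop :=
  (i.val + 1 < m ∧ eps₂ ≤ phi₁) ∨ (i.val + 1 = m ∧ 0 < coroot i x₁) ∨
    (m < i.val + 1 ∧ phi₂ < eps₁)

/-- The condition for `f_i (b₁ ⊗ b₂) = f_i b₁ ⊗ b₂`; otherwise `f_i (b₁ ⊗ b₂) = b₁ ⊗ f_i b₂`. -/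
abbrev TensorFLeft {m n : ℕ} (i : Index m n) (eps₁ phi₁ : ℕ) (x₁ : Weight m n)
    (eps₂ phi₂ : ℕ) : Prop :=
  (i.val + 1 < m ∧ eps₂ < phi₁) ∨ (i.val + 1 = m ∧ 0 < coroot i x₁) ∨
    (m < i.val + 1 ∧ phi₂ ≤ eps₁)

/-- Finite words in the alphabet; `w₁ ⋯ w_r` stands for `w₁ ⊗ (w₂ ⊗ ( ⋯ ⊗ w_r))`. -/
abbrev Word (m n : ℕ) : Type := List (Letter m n)

/-- The weight of a word. -/
def wordWt {m n : ℕ} : Word m n → Weight m n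
  | [] => 0
  | b :: w => (letterMaps m n).wt b + wordWt w

/-- `ε_i` of a word; the empty word forms the trivial crystal. -/
def wordEps {m n : ℕ} (i : Index m n) : Word m n → ℕ
  | [] => 0
  | b :: w => tensorEps i ((letterMaps m n).eps i b) (wordEps i w) ((letterMaps m n).wt b) (wordWt w)

/-- `φ_i` of a word. -/
def wordPhi {m n : ℕ} (i : Index m n) : Word m n → ℕ
  | [] => 0
  | b :: w => tensorPhi i ((letterMaps m n).phi i b) (wordPhi i w) ((letterMaps m n).wt b) (wordWt w)

/-- The Kashiwara operator `e_i` on words. -/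
def wordE {m n : ℕ} (i : Index m n) : Word m n → Option (Word m n)
  | [] => none
  | b :: w =>
    if TensorELeft i ((letterMaps m n).eps i b) ((letterMaps m n).phi i b)
        ((letterMaps m n).wt b) (wordEps i w) (wordPhi i w)
    then ((letterMaps m n).e i b).map fun b' => b' :: w
    else (wordE i w).map fun w' => b :: w'

/-- The Kashiwara operator `f_i` on words. -/
def wordF {m n : ℕ} (i : Index m n) : Word m n → Option (Word m n)
  | [] => none
  | b :: w =>
    if TensorFLeft i ((letterMaps m n).eps i b) ((letterMaps m n).phi i b)
        ((letterMaps m n).wt b) (wordEps i w) (wordPhi i w)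
    then ((letterMaps m n).f i b).map fun b' => b' :: w
    else (wordF i w).map fun w' => b :: w'

/-- The crystal of words. -/
def wordMaps (m n : ℕ) : CrystalMaps m n (Word m n) where
  wt := wordWt
  eps := wordEps
  phi := wordPhi
  e := wordE
  f := wordF

/-! ### Hook semistandard tableaux -/

/-- `(m, n)`-hook partitions: the part `λ_{m+1}` (the row of index `m`) is at most `n`. -/
abbrev HookPartition (m n : ℕ) : Type := {μ : YoungDiagram // μ.rowLen m ≤ n}

/-- `(m, n)`-hook semistandard fillings of the Young diagram `μ`. A cell is a pair
`(row, column)`. -/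
structure IsHookSemistandard {m n : ℕ} (μ : YoungDiagram) (T : {c // c ∈ μ} → Letter m n) :
    Prop where
  row_weak : ∀ c d, c.val.1 = d.val.1 → c.val.2 < d.val.2 → T c ≤ T d
  col_weak : ∀ c d, c.val.2 = d.val.2 → c.val.1 < d.val.1 → T c ≤ T d
  col_strict : ∀ c d, c.val.2 = d.val.2 → c.val.1 < d.val.1 →
    degree (T c) = 0 → degree (T d) = 0 → T c < T d
  row_strict : ∀ c d, c.val.1 = d.val.1 → c.val.2 < d.val.2 →
    degree (T c) = 1 → degree (T d) = 1 → T c < T d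

/-- The column reading: the columns are read from right to left, each from top to bottom. -/
def columnReading {m n : ℕ} (μ : YoungDiagram) (T : {c // c ∈ μ} → Letter m n) : Word m n :=
  (List.range (μ.rowLen 0)).reverse.flatMap fun j =>
    List.ofFn fun k : Fin (μ.colLen j) => T ⟨(k.val, j), μ.mem_iff_lt_colLen.2 k.isLt⟩

/-- The set of `(m, n)`-hook semistandard tableaux of shape `μ`, viewed as a set of words by column
reading (which is injective on the fillings of a given shape). -/
def tableauWords (m n : ℕ) (μ : YoungDiagram) : Set (Word m n) :=
  {w | ∃ T : {c // c ∈ μ} → Letter m n, IsHookSemistandard μ T ∧ columnReading μ T = w}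

/-! ### Matrices -/

/-- Square matrices of non-negative integers with rows and columns indexed by the alphabet. -/
abbrev Mat (m n : ℕ) : Type := Matrix (Letter m n) (Letter m n) ℕ

/-- The set `M` of the matrices whose entries `a_{bb'}` with `|b| ≠ |b'|` are at most `1`. -/
def superMatrices (m n : ℕ) : Set (Mat m n) :=
  {A | ∀ b b', degree b ≠ degree b' → A b b' ≤ 1}

/-- The biword of `A`, which contains each pair `(b, b')` with multiplicity `a_{bb'}` and is weakly
increasing for the super lexicographic order: `(b, b') < (c, c')` if `b' < c'`, or
`b' = c'`, `|b'| = 0` and `b > c`, or `b' = c'`, `|b'| = 1` and `b < c`. -/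
def biword {m n : ℕ} (A : Mat m n) : List (Letter m n × Letter m n) :=
  (List.finRange (m + n)).flatMap fun b' =>
    (if degree b' = 0 then (List.finRange (m + n)).reverse else List.finRange (m + n)).flatMap
      fun b => List.replicate (A b b') (b, b')

/-- The word of the first components of the biword of `A`. -/
def topWord {m n : ℕ} (A : Mat m n) : Word m n := (biword A).map Prod.fst

/-- The word of the second components of the biword of `A`. -/
def bottomWord {m n : ℕ} (A : Mat m n) : Word m n := (biword A).map Prod.snd

/-- The matrix `A(v, w)` of a pair of words of the same length: `a_{bb'}` is the number of the
positions `k` with `(v_k, w_k) = (b, b')`. -/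
def matrixOf {m n : ℕ} (v w : Word m n) : Mat m n := fun b b' => (v.zip w).count (b, b')

/-- The operator `e_i` on matrices: it is applied to the first word of the biword. -/
def matE {m n : ℕ} (i : Index m n) (A : Mat m n) : Option (Mat m n) :=
  (wordE i (topWord A)).map fun w => matrixOf w (bottomWord A)

/-- The operator `f_i` on matrices. -/
def matF {m n : ℕ} (i : Index m n) (A : Mat m n) : Option (Mat m n) :=
  (wordF i (topWord A)).map fun w => matrixOf w (bottomWord A)

/-- The operator `e_i^*` on matrices: write `A = A(k, l)` where `(l, k)` is weakly increasing for
the super lexicographic order, that is, `(l, k)` is the biword of the transpose of `A`, and replace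
`l` by `e_i l`. -/
def matEStar {m n : ℕ} (i : Index m n) (A : Mat m n) : Option (Mat m n) :=
  (wordE i (topWord A.transpose)).map fun l => matrixOf (bottomWord A.transpose) l

/-- The operator `f_i^*` on matrices. -/
def matFStar {m n : ℕ} (i : Index m n) (A : Mat m n) : Option (Mat m n) :=
  (wordF i (topWord A.transpose)).map fun l => matrixOf (bottomWord A.transpose) l

/-- The set of the symmetric matrices in `M`. -/
def symmetricMatrices (m n : ℕ) : Set (Mat m n) :=
  {A | A ∈ superMatrices m n ∧ A.transpose = A}

/-- The diagonal operator `e_i e_i^*` (with `e_i 0 = 0`). -/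
def diagE {m n : ℕ} (i : Index m n) (A : Mat m n) : Option (Mat m n) := (matEStar i A).bind (matE i)

/-- The diagonal operator `f_i f_i^*` (with `f_i 0 = 0`). -/
def diagF {m n : ℕ} (i : Index m n) (A : Mat m n) : Option (Mat m n) := (matFStar i A).bind (matF i)

/-- The set of the `k` with `x^k A ≠ 0`, for a partial operator `x` extended by `x 0 = 0`. -/
def powersNeZero {B : Type} (x : B → Option B) (A : B) : Set ℕ :=
  {k | (fun y : Option B => y.bind x)^[k] (some A) ≠ none}

/-- The maps for the diagonal action: the weight is that of the first word of the biword, that is,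
`∑_b (∑_b' a_{bb'}) ε_b`, and `ε_i`, `φ_i` are the largest `k` with `(e_i e_i^*)^k A ≠ 0` and with
`(f_i f_i^*)^k A ≠ 0` respectively. -/
noncomputable def diagonalMaps (m n : ℕ) : CrystalMaps m n (Mat m n) where
  wt A := wordWt (topWord A)
  eps i A := sSup (powersNeZero (diagE i) A)
  phi i A := sSup (powersNeZero (diagF i) A)
  e := diagE
  f := diagF

end HookCrystal

/-!
The relation `ColLt`, which is `<` on even and `≤` on odd letters, treats both parities at once: the
columns of a tableau are its increasing words, and the super Knuth relations are the usual ones for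
`ColLt` in place of `<`. Greene's invariants show that a Knuth class contains at most one tableau,
and column insertion shows that it contains one. The signature rule for words shows that the crystal
operators commute with Knuth moves and preserve tableaux along with their shapes.

A matrix corresponds to a sorted biword, and hence to the pair formed by the insertion tableaux of
its own biword and of the biword of its transpose. Greene's invariants, applied to initial segments
of the two alphabets, show that both tableaux have the same shape. All such pairs occur, as in the
RSK correspondence, and `e_i`, `f_i` act on the first tableau and `e_i^*`, `f_i^*` on the second
one. Symmetric matrices correspond to pairs of equal tableaux, so the diagonal operators become the
crystal operators on a single tableau.
-/

namespace HookCrystal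

/-! ### Plactic equivalence and Greene's theorem -/

section Greene

variable {α : Type*} (D : α → α → Prop)

/-- The colours of two entries `p`, `q` of a coloured word, `p` to the left of `q`, are compatible:
if they share a colour `< k`, then `D` does not hold between their letters. The colours `≥ k` all
stand for "not coloured". -/
def Compat (k : ℕ) (p q : α × ℕ) : Prop := p.2 = q.2 → p.2 < k → ¬ D p.1 q.1

/-- There are `k` disjoint subwords of `w`, with at least `N` letters in total, none of which
contains an instance of `D`. The largest such `N` is the `k`-th invariant in Greene's theorem. -/
def RowColorable (k N : ℕ) (w : List α) : Prop :=
  ∃ L : List (α × ℕ), L.map Prod.fst = w ∧ L.Pairwise (Compat D k) ∧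
    N ≤ L.countP (fun p => p.2 < k)

/-- The elementary plactic (Knuth) relations, for the relation `D` that holds between an entry of a
column and the entries below it. -/
inductive KnuthStep : List α → List α → Prop
  | lower (u v : List α) (x y z : α) : D x y → ¬ D z y →
      KnuthStep (u ++ x :: z :: y :: v) (u ++ z :: x :: y :: v)
  | upper (u v : List α) (x y z : α) : D y z → ¬ D y x →
      KnuthStep (u ++ y :: z :: x :: v) (u ++ y :: x :: z :: v)

/-- Plactic equivalence of words. -/
def Knuth : List α → List α → Prop := Relation.EqvGen (KnuthStep D)

variable {D} {k N : ℕ} {u v w w' : List α} {x y z : α} {U W : List (α × ℕ)} {a b c : ℕ}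

theorem rowColorable_append_triple :
    RowColorable D k N (u ++ x :: y :: z :: v) ↔ ∃ U W a b c,
      U.map Prod.fst = u ∧ W.map Prod.fst = v ∧
      (U ++ (x, a) :: (y, b) :: (z, c) :: W).Pairwise (Compat D k) ∧
      N ≤ (U ++ (x, a) :: (y, b) :: (z, c) :: W).countP (fun p => p.2 < k) := by
  constructor
  · rintro ⟨L, hL, hcompat, hN⟩
    obtain ⟨U, L', rfl, hU, hL'⟩ := List.map_eq_append_iff.1 hL
    simp only [List.map_eq_cons_iff] at hL'
    obtain ⟨⟨_, a⟩, _, rfl, rfl, ⟨_, b⟩, _, rfl, rfl, ⟨_, c⟩, W, rfl, rfl, hW⟩ := hL'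
    exact ⟨U, W, a, b, c, hU, hW, hcompat, hN⟩
  · rintro ⟨U, W, a, b, c, rfl, rfl, hcompat, hN⟩
    exact ⟨_, by simp, hcompat, hN⟩

theorem pairwise_append_triple {R : α × ℕ → α × ℕ → Prop} {p q r : α × ℕ} :
    (U ++ p :: q :: r :: W).Pairwise R ↔ U.Pairwise R ∧
      (R p q ∧ R p r ∧ R q r) ∧ W.Pairwise R ∧
      (∀ t ∈ U, R t p ∧ R t q ∧ R t r) ∧ (∀ s ∈ W, R p s ∧ R q s ∧ R r s) ∧
      ∀ t ∈ U, ∀ s ∈ W, R t s := by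
  simp only [List.pairwise_append, List.pairwise_cons, List.mem_cons, forall_eq_or_imp]
  grind

theorem RowColorable.lower_left [IsTrans α D] (hxy : D x y) (hzy : ¬ D z y)
    (h : RowColorable D k N (u ++ x :: z :: y :: v)) :
    RowColorable D k N (u ++ z :: x :: y :: v) := by
  rw [rowColorable_append_triple] at h ⊢
  obtain ⟨U, W, a, b, c, hU, hW, hcompat, hN⟩ := h
  refine ⟨U, W, b, a, c, hU, hW, ?_, by grind⟩
  have hzx : ¬ D z x := fun h => hzy (_root_.trans h hxy)
  rw [pairwise_append_triple] at hcompat ⊢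
  grind [Compat]

theorem pairwise_compat_swap (hab : a = b → k ≤ a)
    (h : (U ++ (z, b) :: (x, a) :: (y, c) :: W).Pairwise (Compat D k)) :
    (U ++ (x, a) :: (z, b) :: (y, c) :: W).Pairwise (Compat D k) := by
  rw [pairwise_append_triple] at h ⊢
  grind [Compat]

section Recolor

variable [IsTrans α D] [IsOrderConnected α D] (hxy : D x y) (hzy : ¬ D z y)
include hxy hzy

theorem pairwise_compat_recolor_of_le (ha : a < k) (hc : k ≤ c)
    (h : (U ++ (z, a) :: (x, a) :: (y, c) :: W).Pairwise (Compat D k)) :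
    (U ++ (x, c) :: (z, a) :: (y, a) :: W).Pairwise (Compat D k) := by
  have h_left {t} (htz : ¬ D t z) : ¬ D t y := IsOrderConnected.neg_trans htz hzy
  have h_right {t} (hxt : ¬ D x t) : ¬ D y t := fun h => hxt (_root_.trans hxy h)
  rw [pairwise_append_triple] at h ⊢
  grind [Compat]

/-- The two colour classes meeting the triple exchange their tails behind it. -/
theorem pairwise_compat_recolor_of_lt (ha : a < k) (hc : c < k)
    (h : (U ++ (z, a) :: (x, a) :: (y, c) :: W).Pairwise (Compat D k)) :
    (U ++ (x, c) :: (z, a) :: (y, a) :: W.map (Prod.map id (Equiv.swap a c))).Pairwise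
      (Compat D k) := by
  have h_left {t} (htz : ¬ D t z) : ¬ D t y := IsOrderConnected.neg_trans htz hzy
  have h_left' {t} (hty : ¬ D t y) : ¬ D t x := fun h => hty (_root_.trans h hxy)
  have h_via_z {t s} (htz : ¬ D t z) (hys : ¬ D y s) : ¬ D t s :=
    IsOrderConnected.neg_trans (h_left htz) hys
  have h_via_x {t s} (htx : ¬ D t x) (hxs : ¬ D x s) : ¬ D t s :=
    IsOrderConnected.neg_trans htx hxs
  have h_z {s} (hys : ¬ D y s) : ¬ D z s := IsOrderConnected.neg_trans hzy hys
  rw [pairwise_append_triple] at h ⊢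
  simp only [List.pairwise_map, List.forall_mem_map]
  obtain ⟨hU, htriple, hW, hUt, htW, hUW⟩ := h
  refine ⟨hU, ?_, hW.imp fun {t s} hts => ?_, ?_, ?_, ?_⟩ <;>
    grind [Compat]

end Recolor

theorem countP_recolor (ha : a < k) (hc : c < k) :
    (W.map (Prod.map id (Equiv.swap a c))).countP (fun p => p.2 < k) =
      W.countP (fun p => p.2 < k) := by
  rw [List.countP_map]
  exact List.countP_congr fun p _ => by grind

theorem RowColorable.lower_right [IsTrans α D] [IsOrderConnected α D] (hxy : D x y)
    (hzy : ¬ D z y) (h : RowColorable D k N (u ++ z :: x :: y :: v)) :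
    RowColorable D k N (u ++ x :: z :: y :: v) := by
  rw [rowColorable_append_triple] at h ⊢
  obtain ⟨U, W, b, a, c, hU, hW, hcompat, hN⟩ := h
  by_cases hab : a = b → k ≤ a
  · exact ⟨U, W, a, b, c, hU, hW, pairwise_compat_swap hab hcompat, by grind⟩
  obtain ⟨rfl, ha⟩ : a = b ∧ a < k := by grind
  rcases le_or_gt k c with hc | hc
  · exact ⟨U, W, c, a, a, hU, hW, pairwise_compat_recolor_of_le hxy hzy ha hc hcompat, by grind⟩
  · refine ⟨U, W.map (Prod.map id (Equiv.swap a c)), c, a, a, hU, by simpa,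
      pairwise_compat_recolor_of_lt hxy hzy ha hc hcompat, ?_⟩
    have := countP_recolor (W := W) ha hc
    grind

theorem RowColorable.reverse (h : RowColorable D k N w) :
    RowColorable (Function.swap D) k N w.reverse := by
  obtain ⟨L, rfl, hcompat, hN⟩ := h
  refine ⟨L.reverse, List.map_reverse, ?_, by rwa [List.countP_reverse]⟩
  rw [List.pairwise_reverse]
  exact hcompat.imp fun {p q} h (hqp : q.2 = p.2) hq => h hqp.symm (hqp ▸ hq)

theorem rowColorable_reverse :
    RowColorable (Function.swap D) k N w.reverse ↔ RowColorable D k N w :=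
  ⟨fun h => List.reverse_reverse w ▸ h.reverse, .reverse⟩

theorem KnuthStep.rowColorable_iff [IsTrans α D] [IsOrderConnected α D] (h : KnuthStep D w w')
    (k N : ℕ) : RowColorable D k N w ↔ RowColorable D k N w' := by
  cases h with
  | lower u v x y z hxy hzy => exact ⟨.lower_left hxy hzy, .lower_right hxy hzy⟩
  | upper u v x y z hyz hyx =>
    have : IsOrderConnected α (Function.swap D) :=
      ⟨fun a b c h => (IsOrderConnected.conn c b a h).symm⟩
    rw [← rowColorable_reverse, ← rowColorable_reverse (w := u ++ y :: x :: z :: v)]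
    simp only [List.reverse_append, List.reverse_cons, List.append_assoc, List.cons_append,
      List.nil_append]
    exact ⟨.lower_right hyz hyx, .lower_left hyz hyx⟩

theorem Knuth.rowColorable_iff [IsTrans α D] [IsOrderConnected α D] (h : Knuth D w w')
    (k N : ℕ) : RowColorable D k N w ↔ RowColorable D k N w' := by
  induction h with
  | rel _ _ h => exact h.rowColorable_iff k N
  | refl => rfl
  | symm _ _ _ ih => exact ih.symm
  | trans _ _ _ _ _ ih₁ ih₂ => exact ih₁.trans ih₂

theorem KnuthStep.append (h : KnuthStep D w w') (u v : List α) :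
    KnuthStep D (u ++ w ++ v) (u ++ w' ++ v) := by
  cases h with
  | lower a b x y z hxy hzy => simpa using KnuthStep.lower (u ++ a) (b ++ v) x y z hxy hzy
  | upper a b x y z hyz hyx => simpa using KnuthStep.upper (u ++ a) (b ++ v) x y z hyz hyx

theorem Knuth.append (h : Knuth D w w') (u v : List α) :
    Knuth D (u ++ w ++ v) (u ++ w' ++ v) := by
  induction h with
  | rel _ _ h => exact .rel _ _ (h.append u v)
  | refl => exact .refl _
  | symm _ _ _ ih => exact .symm _ _ ih
  | trans _ _ _ _ _ ih₁ ih₂ => exact .trans _ _ _ ih₁ ih₂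

/-- The two hypotheses hold if `P` cuts out an order ideal of letters: `z` is the largest of the
three letters in `lower` and in `upper`. -/
theorem KnuthStep.filter {P : α → Bool} (hlower : ∀ x y z, D x y → ¬ D z y → P z → P x ∧ P y)
    (hupper : ∀ x y z, D y z → ¬ D y x → P z → P x ∧ P y) (h : KnuthStep D w w') :
    Knuth D (w.filter P) (w'.filter P) := by
  cases h with
  | lower u v x y z hxy hzy =>
    by_cases hz : P z
    · obtain ⟨hx, hy⟩ := hlower x y z hxy hzy hz
      simpa [hx, hy, hz] using
        .rel _ _ (KnuthStep.lower (u.filter P) (v.filter P) x y z hxy hzy)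
    · simpa [hz, List.filter_cons] using .refl _
  | upper u v x y z hyz hyx =>
    by_cases hz : P z
    · obtain ⟨hx, hy⟩ := hupper x y z hyz hyx hz
      simpa [hx, hy, hz] using
        .rel _ _ (KnuthStep.upper (u.filter P) (v.filter P) x y z hyz hyx)
    · simpa [hz, List.filter_cons] using .refl _

theorem Knuth.filter {P : α → Bool} (hlower : ∀ x y z, D x y → ¬ D z y → P z → P x ∧ P y)
    (hupper : ∀ x y z, D y z → ¬ D y x → P z → P x ∧ P y) (h : Knuth D w w') :
    Knuth D (w.filter P) (w'.filter P) := by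
  induction h with
  | rel _ _ h => exact h.filter hlower hupper
  | refl => exact .refl _
  | symm _ _ _ ih => exact .symm _ _ ih
  | trans _ _ _ _ _ ih₁ ih₂ => exact .trans _ _ _ ih₁ ih₂

end Greene

/-! ### Tableaux over a super alphabet -/

/-- A decomposition of an alphabet into even and odd letters. Even letters may not be repeated in a
column of a tableau, odd letters may not be repeated in a row. -/
class Parity (α : Type*) where
  /-- Whether a letter is odd. -/
  isOdd : α → Bool

section Columns

variable {α : Type*}

/-- The column reading of a list of columns: from right to left, each from top to bottom. -/
def readCols : List (List α) → List α
  | [] => []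
  | c :: T => readCols T ++ c

/-- The length of the column of index `j`, which is `0` beyond the last column. As a function of `j`
it encodes the shape of a tableau. -/
def colLen (T : List (List α)) (j : ℕ) : ℕ := (T.getD j []).length

@[simp] theorem colLen_nil (j : ℕ) : colLen ([] : List (List α)) j = 0 := rfl
@[simp] theorem colLen_cons_zero (c : List α) (T) : colLen (c :: T) 0 = c.length := rfl
@[simp] theorem colLen_cons_succ (c : List α) (T) (j : ℕ) :
    colLen (c :: T) (j + 1) = colLen T j := rfl

theorem mem_readCols {T : List (List α)} {a : α} : a ∈ readCols T ↔ ∃ c ∈ T, a ∈ c := by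
  induction T with
  | nil => simp [readCols]
  | cons c T ih => simp [readCols, ih, or_comm]

end Columns

section Tableaux

variable {α : Type*} [LinearOrder α] [Parity α]

/-- The letter `b` may stand below `a` in a column of a tableau. Dually, `b` may stand to the right
of `a` in a row if and only if `¬ ColLt b a`. -/
def ColLt (a b : α) : Prop := a < b ∨ a = b ∧ Parity.isOdd a

instance (a b : α) : Decidable (ColLt a b) := by unfold ColLt; infer_instance

instance : IsTrans α ColLt := ⟨by grind [ColLt]⟩

instance : IsOrderConnected α ColLt := ⟨by grind [ColLt]⟩

theorem ColLt.le {a b : α} (h : ColLt a b) : a ≤ b := by grind [ColLt]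

theorem le_of_not_colLt {a b : α} (h : ¬ ColLt b a) : a ≤ b := by grind [ColLt]

/-- Columns, read from top to bottom. -/
def IsColumn (c : List α) : Prop := c.Pairwise ColLt

/-- The column `d` may stand immediately to the right of `c`. -/
def Adj : List α → List α → Prop
  | _, [] => True
  | [], _ :: _ => False
  | x :: c, y :: d => ¬ ColLt y x ∧ Adj c d

/-- Tableaux, given by the list of their columns from left to right; columns may be empty. -/
def IsTableau : List (List α) → Prop
  | [] => True
  | c :: T => IsColumn c ∧ Adj c (T.headD []) ∧ IsTableau T

@[simp] theorem adj_nil (c : List α) : Adj c [] := by cases c <;> trivial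

theorem Adj.length_le : ∀ {c d : List α}, Adj c d → d.length ≤ c.length
  | _, [], _ => by simp
  | [], _ :: _, h => h.elim
  | _ :: _, _ :: _, h => by simpa using Adj.length_le h.2

theorem Adj.trans : ∀ {c d e : List α}, Adj c d → Adj d e → Adj c e
  | _, _, [], _, _ => by simp
  | _, [], _ :: _, _, h => h.elim
  | [], _ :: _, _ :: _, h, _ => h.elim
  | _ :: _, _ :: _, _ :: _, h, h' => ⟨IsOrderConnected.neg_trans h'.1 h.1, h.2.trans h'.2⟩

theorem Adj.not_colLt : ∀ {c d : List α} {r : ℕ} {a b : α}, Adj c d →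
    (d)[r]? = some b → (c)[r]? = some a → ¬ ColLt b a
  | _, [], _, _, _, _, hb, _ => by simp at hb
  | [], _ :: _, _, _, _, h, _, _ => h.elim
  | x :: c, y :: d, 0, a, b, h, hb, ha => by
    simp only [List.getElem?_cons_zero, Option.some.injEq] at hb ha
    exact ha ▸ hb ▸ h.1
  | x :: c, y :: d, r + 1, a, b, h, hb, ha => by
    simp only [List.getElem?_cons_succ] at hb ha
    exact Adj.not_colLt h.2 hb ha

theorem IsTableau.adj_of_mem {c d : List α} {T : List (List α)} (h : IsTableau (c :: T))
    (hd : d ∈ T) : Adj c d := by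
  induction T generalizing c with
  | nil => simp at hd
  | cons e T ih =>
    rcases List.mem_cons.1 hd with rfl | hd
    · exact h.2.1
    · exact Adj.trans (d := e) h.2.1 (ih h.2.2 hd)

theorem IsTableau.isColumn {c : List α} {T : List (List α)} (h : IsTableau T) (hc : c ∈ T) :
    IsColumn c := by
  induction T with
  | nil => simp at hc
  | cons e T ih =>
    rcases List.mem_cons.1 hc with rfl | hc
    · exact h.1
    · exact ih h.2.2 hc

theorem IsTableau.isColumn_getD {T : List (List α)} (h : IsTableau T) (j : ℕ) :
    IsColumn (T.getD j []) := by
  by_cases hj : j < T.length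
  · rw [List.getD_eq_getElem _ _ hj]
    exact h.isColumn (List.getElem_mem hj)
  · rw [List.getD_eq_default _ _ (not_lt.1 hj)]
    exact List.Pairwise.nil

theorem IsTableau.colLen_succ_le {T : List (List α)} (h : IsTableau T) (j : ℕ) :
    colLen T (j + 1) ≤ colLen T j := by
  induction T generalizing j with
  | nil => simp
  | cons c T ih =>
    cases j with
    | zero => cases T with
      | nil => simp
      | cons d T => exact h.2.1.length_le
    | succ j => simpa using ih h.2.2 j

theorem IsTableau.colLen_antitone {T : List (List α)} (h : IsTableau T) : Antitone (colLen T) :=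
  antitone_nat_of_succ_le h.colLen_succ_le

end Tableaux

/-! ### Greene's theorem for tableaux -/

section RowColoring

variable {α : Type*}

/-- The column reading in which each entry is coloured by the index of its row. -/
def rowColoring : List (List α) → List (α × ℕ)
  | [] => []
  | c :: T => rowColoring T ++ c.zipIdx

theorem map_fst_rowColoring (T : List (List α)) : (rowColoring T).map Prod.fst = readCols T := by
  induction T with
  | nil => rfl
  | cons c T ih => rw [rowColoring, readCols, List.map_append, ih, List.zipIdx_map_fst]

theorem mem_rowColoring {T : List (List α)} {p : α × ℕ} :
    p ∈ rowColoring T ↔ ∃ c ∈ T, (c)[p.2]? = some p.1 := by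
  induction T with
  | nil => simp [rowColoring]
  | cons c T ih => simp [rowColoring, ih, List.mem_zipIdx_iff_getElem?, or_comm]

theorem countP_zipIdx_lt (k : ℕ) (c : List α) (s : ℕ) :
    (c.zipIdx s).countP (fun p => p.2 < k) = min (k - s) c.length := by
  induction c generalizing s with
  | nil => simp
  | cons x c ih =>
    simp only [List.zipIdx_cons, List.countP_cons, ih, List.length_cons, decide_eq_true_eq]
    split_ifs <;> omega

theorem countP_rowColoring (T : List (List α)) (k : ℕ) :
    (rowColoring T).countP (fun p => p.2 < k) = (T.map fun c => min k c.length).sum := by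
  induction T with
  | nil => rfl
  | cons c T ih =>
    rw [rowColoring, List.countP_append, ih, countP_zipIdx_lt, List.map_cons, List.sum_cons,
      Nat.sub_zero, add_comm]

theorem sum_min_succ (T : List (List α)) (k : ℕ) :
    (T.map fun c => min (k + 1) c.length).sum =
      (T.map fun c => min k c.length).sum + T.countP (fun c => k < c.length) := by
  induction T with
  | nil => rfl
  | cons c T ih =>
    simp only [List.map_cons, List.sum_cons, List.countP_cons, ih, decide_eq_true_eq]
    split_ifs <;> omega

end RowColoring

section Tableaux

variable {α : Type*} [LinearOrder α] [Parity α]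

theorem countP_lt_le_of_isColumn {k : ℕ} {L : List (α × ℕ)} (h : IsColumn (L.map Prod.fst))
    (hL : L.Pairwise (Compat ColLt k)) : L.countP (fun p => p.2 < k) ≤ min k L.length := by
  refine le_min ?_ List.countP_le_length
  have hnodup : ((L.filter (fun p => p.2 < k)).map Prod.snd).Nodup := by
    rw [List.Nodup, List.pairwise_map, List.pairwise_filter]
    refine ((List.pairwise_map.1 h).and hL).imp fun {p q} hpq hp _ hcolor => ?_
    exact hpq.2 hcolor (by simpa using hp) hpq.1
  rw [List.countP_eq_length_filter, ← List.length_map Prod.snd,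
    ← List.toFinset_card_of_nodup hnodup]
  refine (Finset.card_le_card (t := Finset.range k) fun j hj => ?_).trans (Finset.card_range k).le
  simp only [List.mem_toFinset, List.mem_map, List.mem_filter, decide_eq_true_eq] at hj
  obtain ⟨p, ⟨_, hp⟩, rfl⟩ := hj
  exact Finset.mem_range.2 hp

theorem RowColorable.le_sum_min {T : List (List α)} (h : IsTableau T) {k N : ℕ}
    (hN : RowColorable ColLt k N (readCols T)) : N ≤ (T.map fun c => min k c.length).sum := by
  obtain ⟨L, hL, hcompat, hN⟩ := hN
  refine hN.trans ?_
  clear hN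
  induction T generalizing L with
  | nil => simp_all [readCols]
  | cons c T ih =>
    obtain ⟨U, W, rfl, hU, rfl⟩ := List.map_eq_append_iff.1 hL
    rw [List.pairwise_append] at hcompat
    have hU_le := ih h.2.2 U hU hcompat.1
    have hW_le := countP_lt_le_of_isColumn h.1 hcompat.2.1
    simp only [List.countP_append, List.map_cons, List.sum_cons, List.length_map]
    omega

theorem pairwise_compat_rowColoring {T : List (List α)} (h : IsTableau T) (k : ℕ) :
    (rowColoring T).Pairwise (Compat ColLt k) := by
  induction T with
  | nil => exact List.Pairwise.nil
  | cons c T ih =>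
    rw [rowColoring, List.pairwise_append]
    refine ⟨ih h.2.2, ?_, fun p hp q hq hrow _ => ?_⟩
    · have hnodup := List.nodup_zipIdx_map_snd c
      rw [List.Nodup, List.pairwise_map] at hnodup
      exact hnodup.imp fun {p q} hpq hrow => absurd hrow hpq
    · obtain ⟨d, hd, hp⟩ := mem_rowColoring.1 hp
      rw [List.mem_zipIdx_iff_getElem?] at hq
      exact (h.adj_of_mem hd).not_colLt (hrow ▸ hp) hq

theorem rowColorable_readCols {T : List (List α)} (h : IsTableau T) (k N : ℕ) :
    RowColorable ColLt k N (readCols T) ↔ N ≤ (T.map fun c => min k c.length).sum :=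
  ⟨RowColorable.le_sum_min h, fun hN => ⟨rowColoring T, map_fst_rowColoring T,
    pairwise_compat_rowColoring h k, (countP_rowColoring T k).symm ▸ hN⟩⟩

theorem lt_colLen_iff {T : List (List α)} (h : IsTableau T) (k j : ℕ) :
    k < colLen T j ↔ j < T.countP (fun c => k < c.length) := by
  induction T generalizing j with
  | nil => simp
  | cons c T ih =>
    have hshort (hk : ¬ k < c.length) : T.countP (fun c => k < c.length) = 0 := by
      rw [List.countP_eq_zero]
      intro d hd
      have := (h.adj_of_mem hd).length_le
      simp only [decide_eq_true_eq]
      omega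
    have ih := ih h.2.2
    cases j <;> grind [colLen_cons_zero, colLen_cons_succ]

theorem colLen_eq_of_rowColorable {β : Type*} [LinearOrder β] [Parity β] {T : List (List α)}
    {T' : List (List β)} (h : IsTableau T) (h' : IsTableau T')
    (hcolor : ∀ k N, RowColorable ColLt k N (readCols T) ↔ RowColorable ColLt k N (readCols T')) :
    colLen T = colLen T' := by
  have hsum k : (T.map fun c => min k c.length).sum = (T'.map fun c => min k c.length).sum := by
    simp only [rowColorable_readCols h, rowColorable_readCols h'] at hcolor
    exact eq_of_forall_le_iff (hcolor k)
  have hcount k : T.countP (fun c => k < c.length) = T'.countP (fun c => k < c.length) := by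
    have := hsum (k + 1)
    rw [sum_min_succ, sum_min_succ, hsum k] at this
    omega
  exact funext fun j => eq_of_forall_lt_iff fun k => by
    rw [lt_colLen_iff h, lt_colLen_iff h', hcount]

end Tableaux

/-! ### Restriction to an initial set of letters -/

section Restriction

variable {α : Type*}

/-- The subtableau of the letters satisfying `s`. -/
def restrict (s : α → Bool) (T : List (List α)) : List (List α) := T.map (List.filter s)

theorem readCols_restrict (s : α → Bool) (T : List (List α)) :
    readCols (restrict s T) = (readCols T).filter s := by
  induction T with
  | nil => rfl
  | cons c T ih =>
    rw [readCols, List.filter_append, ← ih]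
    rfl

theorem restrict_eq_self {s : α → Bool} {T : List (List α)} (h : ∀ a ∈ readCols T, s a) :
    restrict s T = T := by
  refine (List.map_congr_left fun c hc => ?_).trans (List.map_id T)
  exact List.filter_eq_self.2 fun a ha => h a (mem_readCols.2 ⟨c, hc, ha⟩)

theorem colLen_restrict (s : α → Bool) (T : List (List α)) (j : ℕ) :
    colLen (restrict s T) j = ((T.getD j []).filter s).length := by
  simp only [colLen, restrict, List.getD_eq_getElem?_getD, List.getElem?_map]
  cases (T)[j]? <;> rfl

end Restriction

section Tableaux

variable {α : Type*} [LinearOrder α] [Parity α]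

theorem Adj.filter {s : α → Bool} (hs : IsLowerSet {a | s a}) : ∀ {c d : List α}, Adj c d →
    IsColumn d → Adj (c.filter s) (d.filter s)
  | _, [], _, _ => by simp
  | [], _ :: _, h, _ => h.elim
  | x :: c, y :: d, h, hd => by
    obtain ⟨hyd, hd⟩ := List.pairwise_cons.1 hd
    by_cases hy : s y
    · have hx : s x := hs (le_of_not_colLt h.1) hy
      simp only [List.filter_cons, hx, hy, if_true]
      exact ⟨h.1, Adj.filter hs h.2 hd⟩
    · have hnil : (y :: d).filter s = [] := by
        refine List.filter_eq_nil_iff.2 fun z hz hsz => hy ?_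
        rcases List.mem_cons.1 hz with rfl | hz
        · exact hsz
        · exact hs (hyd z hz).le hsz
      rw [hnil]
      exact adj_nil _

theorem isTableau_restrict {s : α → Bool} (hs : IsLowerSet {a | s a}) {T : List (List α)}
    (h : IsTableau T) : IsTableau (restrict s T) := by
  induction T with
  | nil => trivial
  | cons c T ih =>
    refine ⟨List.Pairwise.filter _ h.1, ?_, ih h.2.2⟩
    cases T with
    | nil => exact adj_nil _
    | cons d T => exact Adj.filter hs h.2.1 h.2.2.1

theorem IsColumn.eq_of_length_filter_le {c d : List α} (hc : IsColumn c) (hd : IsColumn d)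
    (h : ∀ t, (c.filter (· ≤ t)).length = (d.filter (· ≤ t)).length) : c = d := by
  induction c generalizing d with
  | nil => cases d with
    | nil => rfl
    | cons y d => simpa using h y
  | cons x c ih => cases d with
    | nil => simpa using h x
    | cons y d =>
      obtain ⟨hxc, hc_tail⟩ := List.pairwise_cons.1 hc
      obtain ⟨hyd, hd_tail⟩ := List.pairwise_cons.1 hd
      have head_le {u v : α} {l : List α} (hl : ∀ a ∈ l, ColLt u a)
          (hpos : 0 < ((u :: l).filter (· ≤ v)).length) : u ≤ v := by
        obtain ⟨a, ha⟩ := List.exists_mem_of_length_pos hpos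
        grind [→ ColLt.le]
      obtain rfl : x = y := le_antisymm (head_le hxc (by rw [h]; simp))
        (head_le hyd (by rw [← h]; simp))
      rw [ih hc_tail hd_tail fun t => by have := h t; grind]

theorem IsTableau.eq_of_colLen_restrict {T T' : List (List α)} (h : IsTableau T)
    (h' : IsTableau T') (h0 : [] ∉ T) (h0' : [] ∉ T')
    (hlen : ∀ t, colLen (restrict (· ≤ t) T) = colLen (restrict (· ≤ t) T')) : T = T' := by
  have hcol j : T.getD j [] = T'.getD j [] :=
    (h.isColumn_getD j).eq_of_length_filter_le (h'.isColumn_getD j) fun t => by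
      rw [← colLen_restrict, ← colLen_restrict, hlen]
  refine List.ext_getElem? fun j => ?_
  have hne := hcol j
  grind

theorem Knuth.filter_lowerSet {s : α → Bool} (hs : IsLowerSet {a | s a}) {w w' : List α}
    (h : Knuth ColLt w w') : Knuth ColLt (w.filter s) (w'.filter s) := by
  refine h.filter (fun x y z hxy hzy hz => ?_) (fun x y z hyz hyx hz => ?_)
  · have hy := hs (le_of_not_colLt hzy) hz
    exact ⟨hs hxy.le hy, hy⟩
  · have hy := hs hyz.le hz
    exact ⟨hs (le_of_not_colLt hyx) hy, hy⟩

theorem Knuth.colLen_eq {T T' : List (List α)} (h : IsTableau T) (h' : IsTableau T')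
    (hknuth : Knuth ColLt (readCols T) (readCols T')) : colLen T = colLen T' :=
  colLen_eq_of_rowColorable h h' fun k N => hknuth.rowColorable_iff k N

theorem Knuth.tableau_eq {T T' : List (List α)} (h : IsTableau T) (h' : IsTableau T')
    (h0 : [] ∉ T) (h0' : [] ∉ T') (hknuth : Knuth ColLt (readCols T) (readCols T')) : T = T' := by
  refine h.eq_of_colLen_restrict h' h0 h0' fun t => ?_
  have ht : IsLowerSet {a | decide (a ≤ t)} := fun a b hba ha => by
    simpa using hba.trans (by simpa using ha)
  refine Knuth.colLen_eq (isTableau_restrict ht h) (isTableau_restrict ht h') ?_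
  rw [readCols_restrict, readCols_restrict]
  exact hknuth.filter_lowerSet ht

end Tableaux

/-! ### Column insertion -/

section Insertion

variable {α : Type*} [LinearOrder α] [Parity α] {c d e : List α} {T T' : List (List α)}
  {x x' y y' : α}

/-- The column obtained by inserting `x` into a column: `x` replaces the topmost entry that may not
stand above it, or is appended. -/
def colInsert : List α → α → List α
  | [], x => [x]
  | y :: c, x => if ColLt y x then y :: colInsert c x else x :: c

/-- The entry bumped by the insertion of `x` into a column, if any. -/
def bump : List α → α → Option α
  | [], _ => none
  | y :: c, x => if ColLt y x then bump c x else some y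

/-- Column insertion into a tableau. -/
def tabInsert : List (List α) → α → List (List α)
  | [], x => [[x]]
  | c :: T, x => colInsert c x :: (bump c x).elim T (tabInsert T)

/-- The index of the column that grows under column insertion. -/
def growthCol : List (List α) → α → ℕ
  | [], _ => 0
  | c :: T, x => (bump c x).elim 0 fun y => growthCol T y + 1

theorem bump_eq_none : bump c x = none ↔ ∀ a ∈ c, ColLt a x := by
  induction c with
  | nil => simp [bump]
  | cons y c ih => grind [bump]

theorem colInsert_of_bump_eq_none (h : bump c x = none) : colInsert c x = c ++ [x] := by
  induction c with
  | nil => rfl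
  | cons y c ih => grind [bump, colInsert]

theorem length_colInsert (c : List α) (x : α) :
    (colInsert c x).length = c.length + if bump c x = none then 1 else 0 := by
  induction c with
  | nil => rfl
  | cons y c ih => grind [bump, colInsert]

theorem mem_colInsert_self (c : List α) (x : α) : x ∈ colInsert c x := by
  induction c with
  | nil => exact List.mem_singleton_self x
  | cons y c ih => grind [colInsert]

theorem eq_or_mem_of_mem_colInsert {a : α} (h : a ∈ colInsert c x) : a = x ∨ a ∈ c := by
  induction c with
  | nil => exact .inl (List.mem_singleton.1 h)
  | cons y c ih => grind [colInsert]

theorem bump_spec (h : bump c x = some y) : ¬ ColLt y x ∧ y ∈ c := by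
  induction c with
  | nil => simp [bump] at h
  | cons z c ih => grind [bump]

theorem ColLt.trans {a b c : α} (h : ColLt a b) (h' : ColLt b c) : ColLt a c :=
  _root_.trans h h'

theorem not_colLt_trans {a b c : α} (h : ¬ ColLt a b) (h' : ¬ ColLt b c) : ¬ ColLt a c :=
  IsOrderConnected.neg_trans h h'

theorem IsColumn.colInsert (h : IsColumn c) (x : α) : IsColumn (colInsert c x) := by
  induction c with
  | nil => exact List.pairwise_singleton _ _
  | cons y c ih =>
    obtain ⟨hy, hc⟩ := List.pairwise_cons.1 h
    rw [HookCrystal.colInsert]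
    split_ifs with hyx
    · refine List.pairwise_cons.2 ⟨fun a ha => ?_, ih hc⟩
      rcases eq_or_mem_of_mem_colInsert ha with rfl | ha
      exacts [hyx, hy a ha]
    · exact List.pairwise_cons.2
        ⟨fun a ha => by_contra fun hxa => not_colLt_trans hyx hxa (hy a ha), hc⟩

theorem knuth_append_singleton (h : IsColumn (y :: c)) (hyx : ¬ ColLt y x) :
    Knuth ColLt (y :: c ++ [x]) (y :: x :: c) := by
  induction c generalizing y with
  | nil => exact .refl _
  | cons b c ih =>
    obtain ⟨hy, hc⟩ := List.pairwise_cons.1 h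
    have hyb : ColLt y b := hy b List.mem_cons_self
    have htail := (ih hc fun hbx => hyx (hyb.trans hbx)).append [y] []
    simp only [List.append_nil] at htail
    exact .trans _ _ _ htail (.rel _ _ (.upper [] c x y b hyb hyx))

theorem knuth_colInsert (hc : IsColumn c) (h : bump c x = some y) :
    Knuth ColLt (c ++ [x]) (y :: colInsert c x) := by
  induction c with
  | nil => simp [bump] at h
  | cons z c ih =>
    obtain ⟨hz, hc_tail⟩ := List.pairwise_cons.1 hc
    by_cases hzx : ColLt z x
    · simp only [bump, colInsert, hzx, if_true] at h ⊢
      have htail := (ih hc_tail h).append [z] []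
      simp only [List.append_nil] at htail
      refine .trans _ _ _ htail ?_
      obtain ⟨hyx, hy⟩ := bump_spec h
      -- The first entry `w` of `colInsert c x` is at most `x`, so `y` can jump over it.
      obtain ⟨w, l, hl, hzw, hyw⟩ :
          ∃ w l, colInsert c x = w :: l ∧ ColLt z w ∧ ¬ ColLt y w := by
        cases c with
        | nil => simp [bump] at h
        | cons w c =>
          by_cases hwx : ColLt w x
          · exact ⟨w, colInsert c x, by simp only [colInsert, hwx, if_true],
              hz w List.mem_cons_self, fun hyw => hyx (hyw.trans hwx)⟩
          · exact ⟨x, c, by simp only [colInsert, hwx, if_false], hzx, hyx⟩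
      rw [hl]
      exact .rel _ _ (.lower [] l z w y hzw hyw)
    · simp only [bump, colInsert, hzx, if_false, Option.some.injEq] at h ⊢
      subst h
      exact knuth_append_singleton hc hzx

theorem Adj.append_left (h : Adj c d) (e : List α) : Adj (c ++ e) d := by
  induction c generalizing d with
  | nil => cases d with
    | nil => exact adj_nil _
    | cons => exact h.elim
  | cons x c ih => cases d with
    | nil => exact adj_nil _
    | cons y d => exact ⟨h.1, ih h.2⟩

theorem Adj.of_append_left (h : Adj (c ++ e) d) (hlen : d.length ≤ c.length) : Adj c d := by
  induction c generalizing d with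
  | nil => rw [List.length_eq_zero_iff.1 (Nat.le_zero.1 hlen)]; exact adj_nil _
  | cons x c ih => cases d with
    | nil => exact adj_nil _
    | cons y d => exact ⟨h.1, ih h.2 (Nat.le_of_succ_le_succ hlen)⟩

theorem Adj.exists_not_colLt {b : α} (h : Adj c d) (hb : b ∈ d) : ∃ a ∈ c, ¬ ColLt b a := by
  obtain ⟨r, hr, rfl⟩ := List.getElem_of_mem hb
  have hrc : r < c.length := hr.trans_le h.length_le
  exact ⟨(c)[r], List.getElem_mem hrc,
    h.not_colLt (List.getElem?_eq_getElem hr) (List.getElem?_eq_getElem hrc)⟩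

theorem Adj.colInsert_left (h : Adj c d) (hb : bump c x = some y) : Adj (colInsert c x) d := by
  induction c generalizing d with
  | nil => simp [bump] at hb
  | cons z c ih => cases d with
    | nil => exact adj_nil _
    | cons w d =>
      simp only [bump, colInsert] at hb ⊢
      split_ifs at hb ⊢ with hzx
      · exact ⟨h.1, ih h.2 hb⟩
      · exact ⟨not_colLt_trans h.1 hzx, h.2⟩

theorem Adj.colInsert_colInsert (h : Adj c d) (hb : bump c x = some y) :
    Adj (colInsert c x) (colInsert d y) := by
  induction c generalizing d with
  | nil => simp [bump] at hb
  | cons z c ih =>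
    simp only [bump] at hb
    by_cases hzx : ColLt z x
    · simp only [hzx, if_true] at hb
      have hyz : ¬ ColLt y z := fun hyz => (bump_spec hb).1 (hyz.trans hzx)
      rw [colInsert, if_pos hzx]
      cases d with
      | nil => exact ⟨hyz, adj_nil _⟩
      | cons w d =>
        rw [colInsert]
        split_ifs
        exacts [⟨h.1, ih h.2 hb⟩, ⟨hyz, h.2.colInsert_left hb⟩]
    · obtain rfl : z = y := by simpa [hzx] using hb
      rw [colInsert, if_neg hzx]
      cases d with
      | nil => exact ⟨hzx, adj_nil _⟩
      | cons w d =>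
        rw [colInsert, if_neg h.1]
        exact ⟨hzx, h.2⟩

theorem Adj.of_colInsert_left (h : Adj (colInsert c x) d) (hb : bump c x = some y)
    (hd : ∀ e ∈ d, ¬ ColLt e y) : Adj c d := by
  induction c generalizing d with
  | nil => simp [bump] at hb
  | cons z c ih => cases d with
    | nil => exact adj_nil _
    | cons w d =>
      rw [List.forall_mem_cons] at hd
      simp only [bump, colInsert] at hb h
      split_ifs at hb h with hzx
      · exact ⟨h.1, ih h.2 hb hd.2⟩
      · cases hb
        exact ⟨hd.1, h.2⟩

theorem Adj.of_colInsert_colInsert (hc : IsColumn c) (hd : IsColumn d)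
    (h : Adj (colInsert c x) (colInsert d y)) (hb : bump c x = some y) : Adj c d := by
  induction c generalizing d with
  | nil => simp [bump] at hb
  | cons z c ih => cases d with
    | nil => exact adj_nil _
    | cons w d =>
      obtain ⟨hz, hc_tail⟩ := List.pairwise_cons.1 hc
      obtain ⟨hw, hd_tail⟩ := List.pairwise_cons.1 hd
      by_cases hzx : ColLt z x <;> by_cases hwy : ColLt w y <;>
        simp only [bump, colInsert, hzx, hwy, if_true, if_false, Option.some.injEq] at hb h
      · exact ⟨h.1, ih hc_tail hd_tail h.2 hb⟩
      · exact ⟨not_colLt_trans hwy h.1,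
          h.2.of_colInsert_left hb fun e he hey => hwy ((hw e he).trans hey)⟩
      · subst hb
        obtain ⟨a, ha, hza⟩ := h.2.exists_not_colLt (mem_colInsert_self d z)
        exact absurd (hz a ha) hza
      · subst hb
        exact ⟨hwy, h.2⟩

theorem colInsert_injective (hc : IsColumn c) (hd : IsColumn d) (hb : bump c x = some y)
    (hb' : bump d x' = some y) (h : colInsert c x = colInsert d x') : c = d ∧ x = x' := by
  induction c generalizing d with
  | nil => simp [bump] at hb
  | cons z c ih => cases d with
    | nil => simp [bump] at hb'
    | cons w d =>
      obtain ⟨hz, hc_tail⟩ := List.pairwise_cons.1 hc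
      obtain ⟨hw, hd_tail⟩ := List.pairwise_cons.1 hd
      by_cases hzx : ColLt z x <;> by_cases hwx' : ColLt w x' <;>
        simp only [bump, colInsert, hzx, hwx', if_true, if_false, Option.some.injEq,
          List.cons.injEq] at hb hb' h ⊢
      · obtain ⟨rfl, rfl⟩ := ih hc_tail hd_tail hb hb' h.2
        exact ⟨⟨h.1, rfl⟩, rfl⟩
      · have hwx := hw x (h.2 ▸ mem_colInsert_self c x)
        exact absurd (hb' ▸ hwx) (bump_spec hb).1
      · have hzx' := hz x' (h.2 ▸ mem_colInsert_self d x')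
        exact absurd (hb ▸ hzx') (bump_spec hb').1
      · exact ⟨⟨hb.trans hb'.symm, h.2⟩, h.1⟩

theorem exists_colInsert (hc : IsColumn c) (h : ∃ a ∈ c, ¬ ColLt y a) :
    ∃ c' x, IsColumn c' ∧ bump c' x = some y ∧ colInsert c' x = c ∧ ∀ a ∈ c', a = y ∨ a ∈ c := by
  induction c with
  | nil => simp at h
  | cons z c ih =>
    obtain ⟨hz, hc_tail⟩ := List.pairwise_cons.1 hc
    by_cases htail : ∃ a ∈ c, ¬ ColLt y a
    · obtain ⟨c', x, hc', hbump, hins, hmem⟩ := ih hc_tail htail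
      have hzx : ColLt z x := hz x (hins ▸ mem_colInsert_self c' x)
      have hzy : ColLt z y := by
        obtain ⟨b, hb, hyb⟩ := htail
        exact by_contra fun hzy => not_colLt_trans hzy hyb (hz b hb)
      exact ⟨z :: c', x, List.pairwise_cons.2 ⟨by grind, hc'⟩, by simp [bump, hzx, hbump],
        by simp [colInsert, hzx, hins], by grind⟩
    · push Not at htail
      have hyz : ¬ ColLt y z := by grind
      exact ⟨y :: c, z, List.pairwise_cons.2 ⟨htail, hc_tail⟩, by simp [bump, hyz],
        by simp [colInsert, hyz], by grind⟩

theorem headD_tabInsert (T : List (List α)) (y : α) :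
    (tabInsert T y).headD [] = colInsert (T.headD []) y := by
  cases T <;> rfl

theorem IsTableau.isColumn_headD (h : IsTableau T) : IsColumn (T.headD []) := by
  cases T with
  | nil => exact List.Pairwise.nil
  | cons => exact h.1

theorem isTableau_tabInsert (h : IsTableau T) (x : α) : IsTableau (tabInsert T x) := by
  induction T generalizing x with
  | nil => exact ⟨List.pairwise_singleton _ _, adj_nil _, trivial⟩
  | cons c T ih =>
    rw [tabInsert]
    cases hb : bump c x with
    | none =>
      refine ⟨h.1.colInsert x, ?_, h.2.2⟩
      rw [colInsert_of_bump_eq_none hb]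
      exact h.2.1.append_left _
    | some y =>
      refine ⟨h.1.colInsert x, ?_, ih h.2.2 y⟩
      rw [Option.elim_some, headD_tabInsert]
      exact h.2.1.colInsert_colInsert hb

theorem nil_notMem_tabInsert (h : [] ∉ T) (x : α) : [] ∉ tabInsert T x := by
  induction T generalizing x with
  | nil => simp [tabInsert]
  | cons c T ih =>
    have hne : colInsert c x ≠ [] := List.ne_nil_of_mem (mem_colInsert_self c x)
    cases hb : bump c x <;> grind [tabInsert]

theorem knuth_tabInsert (h : IsTableau T) (x : α) :
    Knuth ColLt (readCols T ++ [x]) (readCols (tabInsert T x)) := by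
  induction T generalizing x with
  | nil => exact .refl _
  | cons c T ih =>
    cases hb : bump c x with
    | none =>
      simp only [tabInsert, hb, readCols, Option.elim_none, colInsert_of_bump_eq_none hb,
        List.append_assoc]
      exact .refl _
    | some y =>
      simp only [tabInsert, hb, readCols, Option.elim_some, List.append_assoc]
      have hcol := (knuth_colInsert h.1 hb).append (readCols T) []
      have htail := (ih h.2.2 y).append [] (colInsert c x)
      simp only [List.append_nil, List.nil_append, List.append_assoc, List.singleton_append]
        at hcol htail
      exact .trans _ _ _ hcol htail

theorem colLen_tabInsert (T : List (List α)) (x : α) (j : ℕ) :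
    colLen (tabInsert T x) j = colLen T j + if j = growthCol T x then 1 else 0 := by
  induction T generalizing x j with
  | nil => cases j <;> simp [tabInsert, growthCol]
  | cons c T ih =>
    cases hb : bump c x <;> cases j <;> simp [tabInsert, growthCol, hb, length_colInsert, ih]

theorem tabInsert_ne_singleton (h0 : [] ∉ c :: T) (h : growthCol (c :: T) x = 0) :
    tabInsert (c :: T) x ≠ [[x']] := by
  cases hb : bump c x with
  | none =>
    have : c ≠ [] := by grind
    simp [tabInsert, hb, colInsert_of_bump_eq_none, List.append_eq_singleton_iff, this]
  | some y => simp [growthCol, hb] at h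

theorem tabInsert_injective (hT : IsTableau T) (hT' : IsTableau T') (h0 : [] ∉ T) (h0' : [] ∉ T')
    (hgrowth : growthCol T x = growthCol T' x') (h : tabInsert T x = tabInsert T' x') :
    T = T' ∧ x = x' := by
  induction T generalizing T' x x' with
  | nil => cases T' with
    | nil => simpa [tabInsert] using h
    | cons c' T' => exact absurd h.symm (tabInsert_ne_singleton h0' hgrowth.symm)
  | cons c T ih => cases T' with
    | nil => exact absurd h (tabInsert_ne_singleton h0 hgrowth)
    | cons c' T' =>
      cases hb : bump c x <;> cases hb' : bump c' x' <;>
        simp only [tabInsert, growthCol, hb, hb', List.cons.injEq, Option.elim_some,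
          Option.elim_none, add_left_inj, Nat.add_eq_zero_iff, one_ne_zero, and_false,
          reduceCtorEq] at h hgrowth
      · rw [colInsert_of_bump_eq_none hb, colInsert_of_bump_eq_none hb'] at h
        obtain ⟨⟨rfl, rfl⟩, rfl⟩ := And.imp_left List.append_singleton_inj.1 h
        exact ⟨rfl, rfl⟩
      · obtain ⟨rfl, rfl⟩ := ih hT.2.2 hT'.2.2 (by grind) (by grind) hgrowth h.2
        obtain ⟨rfl, rfl⟩ := colInsert_injective hT.1 hT'.1 hb hb' h.1
        exact ⟨rfl, rfl⟩

/-- The corner at the foot of the first column is vacated without bumping. -/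
theorem exists_tabInsert_zero (hT : IsTableau (c :: T)) (h0 : [] ∉ c :: T)
    (hcorner : colLen T 0 < c.length) :
    ∃ T' x, IsTableau T' ∧ [] ∉ T' ∧ tabInsert T' x = c :: T ∧ growthCol T' x = 0 := by
  obtain ⟨c', x, rfl⟩ : ∃ c' x, c = c' ++ [x] :=
    (List.eq_nil_or_concat' c).resolve_left fun hc => h0 (by simp [hc])
  obtain ⟨hc', _, hx⟩ := List.pairwise_append.1 hT.1
  have hb : bump c' x = none := bump_eq_none.2 fun a ha => hx a ha x (List.mem_singleton_self x)
  have hlen : colLen T 0 ≤ c'.length := by simpa [Nat.lt_succ_iff] using hcorner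
  by_cases hnil : c' = []
  · subst hnil
    have hTnil : T = [] := by
      cases T with
      | nil => rfl
      | cons d T => simp_all
    exact ⟨[], x, trivial, by simp, by rw [hTnil]; rfl, rfl⟩
  · refine ⟨c' :: T, x, ⟨hc', hT.2.1.of_append_left ?_, hT.2.2⟩, by grind,
      by simp [tabInsert, hb, colInsert_of_bump_eq_none], by simp [growthCol, hb]⟩
    cases T with
    | nil => simp
    | cons d T => simpa using hlen

theorem exists_tabInsert (hT : IsTableau T) (h0 : [] ∉ T) {j : ℕ}
    (hcorner : colLen T (j + 1) < colLen T j) :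
    ∃ T' x, IsTableau T' ∧ [] ∉ T' ∧ tabInsert T' x = T ∧ growthCol T' x = j := by
  induction T generalizing j with
  | nil => simp at hcorner
  | cons c T ih => cases j with
    | zero => exact exists_tabInsert_zero hT h0 (by simpa using hcorner)
    | succ j =>
      obtain ⟨S, y, hS, hS0, rfl, rfl⟩ := ih hT.2.2 (by grind) (by simpa using hcorner)
      have hadj := hT.2.1
      rw [headD_tabInsert] at hadj
      obtain ⟨c', x, hc', hb, rfl, _⟩ := exists_colInsert hT.1
        (hadj.exists_not_colLt (mem_colInsert_self _ y))
      have hne : c' ≠ [] := by rintro rfl; simp [bump] at hb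
      exact ⟨c' :: S, x, ⟨hc', hadj.of_colInsert_colInsert hc' hS.isColumn_headD hb, hS⟩,
        by grind, by simp [tabInsert, hb], by simp [growthCol, hb]⟩

theorem exists_bump_colInsert (hb : bump c x = some x') (h : ¬ ColLt x y) :
    ∃ y', bump (colInsert c x) y = some y' ∧ ¬ ColLt x' y' := by
  induction c with
  | nil => simp [bump] at hb
  | cons z c ih =>
    simp only [bump, colInsert] at hb ⊢
    split_ifs at hb ⊢ with hzx
    · by_cases hzy : ColLt z y
      · simpa only [bump, hzy, if_true] using ih hb
      · exact ⟨z, by simp [bump, hzy], fun hxz => (bump_spec hb).1 (hxz.trans hzx)⟩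
    · cases hb
      exact ⟨x, by simp [bump, h], hzx⟩

theorem colLt_of_bump_colInsert (hc : IsColumn c) (hb : bump c x = some x') (h : ColLt x y)
    (hb' : bump (colInsert c x) y = some y') : ColLt x' y' := by
  induction c with
  | nil => simp [bump] at hb
  | cons z c ih =>
    obtain ⟨hz, hc_tail⟩ := List.pairwise_cons.1 hc
    simp only [bump, colInsert] at hb hb'
    split_ifs at hb hb' with hzx
    · simp only [bump, hzx.trans h, if_true] at hb'
      exact ih hc_tail hb hb'
    · cases hb
      simp only [bump, h, if_true] at hb'
      exact hz _ (bump_spec hb').2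

theorem growthCol_lt_growthCol_tabInsert (hT : IsTableau T) :
    growthCol T x < growthCol (tabInsert T x) y ↔ ¬ ColLt x y := by
  induction T generalizing x y with
  | nil => by_cases h : ColLt x y <;> simp [tabInsert, growthCol, bump, h]
  | cons c T ih =>
    cases hb : bump c x with
    | none =>
      have hbump : bump (colInsert c x) y = none ↔ ColLt x y := by
        have hall := bump_eq_none.1 hb
        rw [colInsert_of_bump_eq_none hb, bump_eq_none, List.forall_mem_append]
        exact ⟨fun h => h.2 x (List.mem_singleton_self x),
          fun h => ⟨fun a ha => (hall a ha).trans h, by simpa using h⟩⟩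
      rw [← hbump]
      cases hb' : bump (colInsert c x) y <;> simp [tabInsert, growthCol, hb, hb']
    | some x' =>
      by_cases h : ColLt x y
      · cases hb' : bump (colInsert c x) y with
        | none => simp [tabInsert, growthCol, hb, hb', h]
        | some y' =>
          simp [tabInsert, growthCol, hb, hb', ih hT.2.2, h, colLt_of_bump_colInsert hT.1 hb h hb']
      · obtain ⟨y', hb', hxy'⟩ := exists_bump_colInsert hb h
        simp [tabInsert, growthCol, hb, hb', ih hT.2.2, h, hxy']

/-- The insertion tableau of a word. -/
def insertionTableau (w : List α) : List (List α) := w.foldl tabInsert []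

theorem insertionTableau_concat (w : List α) (x : α) :
    insertionTableau (w ++ [x]) = tabInsert (insertionTableau w) x := by
  rw [insertionTableau, List.foldl_append]
  rfl

theorem isTableau_insertionTableau (w : List α) : IsTableau (insertionTableau w) := by
  induction w using List.reverseRecOn with
  | nil => trivial
  | append_singleton w x ih => exact insertionTableau_concat w x ▸ isTableau_tabInsert ih x

theorem nil_notMem_insertionTableau (w : List α) : [] ∉ insertionTableau w := by
  induction w using List.reverseRecOn with
  | nil => exact List.not_mem_nil
  | append_singleton w x ih => exact insertionTableau_concat w x ▸ nil_notMem_tabInsert ih x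

theorem knuth_readCols_insertionTableau (w : List α) :
    Knuth ColLt w (readCols (insertionTableau w)) := by
  induction w using List.reverseRecOn with
  | nil => exact .refl _
  | append_singleton w x ih =>
    rw [insertionTableau_concat]
    exact .trans _ _ _ (ih.append [] [x]) (knuth_tabInsert (isTableau_insertionTableau w) x)

theorem insertionTableau_eq_of_knuth (hT : IsTableau T) (h0 : [] ∉ T) {w : List α}
    (h : Knuth ColLt w (readCols T)) : insertionTableau w = T :=
  Knuth.tableau_eq (isTableau_insertionTableau w) hT (nil_notMem_insertionTableau w) h0
    (.trans _ _ _ (.symm _ _ (knuth_readCols_insertionTableau w)) h)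

theorem Knuth.insertionTableau_eq {w w' : List α} (h : Knuth ColLt w w') :
    insertionTableau w = insertionTableau w' :=
  insertionTableau_eq_of_knuth (isTableau_insertionTableau w') (nil_notMem_insertionTableau w')
    (.trans _ _ _ h (knuth_readCols_insertionTableau w'))

theorem insertionTableau_readCols (hT : IsTableau T) (h0 : [] ∉ T) :
    insertionTableau (readCols T) = T :=
  insertionTableau_eq_of_knuth hT h0 (.refl _)

theorem colLen_restrict_insertionTableau {s : α → Bool} (hs : IsLowerSet {a | s a}) (w : List α) :
    colLen (restrict s (insertionTableau w)) = colLen (insertionTableau (w.filter s)) := by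
  refine Knuth.colLen_eq (isTableau_restrict hs (isTableau_insertionTableau w))
    (isTableau_insertionTableau _) ?_
  rw [readCols_restrict]
  exact .trans _ _ _ (.symm _ _ ((knuth_readCols_insertionTableau w).filter_lowerSet hs))
    (knuth_readCols_insertionTableau _)

theorem sum_length_tabInsert (T : List (List α)) (x : α) :
    ((tabInsert T x).map List.length).sum = (T.map List.length).sum + 1 := by
  induction T generalizing x with
  | nil => rfl
  | cons c T ih =>
    cases hb : bump c x with
    | none => simp [tabInsert, hb, length_colInsert]; omega
    | some y => simp [tabInsert, hb, length_colInsert, ih, add_assoc]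

theorem sum_length_insertionTableau (w : List α) :
    ((insertionTableau w).map List.length).sum = w.length := by
  induction w using List.reverseRecOn with
  | nil => rfl
  | append_singleton w x ih => simp [insertionTableau_concat, sum_length_tabInsert, ih]

end Insertion

/-! ### The operators on words -/

section Words

variable {m n : ℕ}

theorem Index.lo_ne_hi (i : Index m n) : i.lo ≠ i.hi := by
  simp [Index.lo, Index.hi, Fin.ext_iff]

theorem coroot_eq (i : Index m n) (x : Weight m n) :
    coroot i x = x i.lo + if i.val + 1 = m then x i.hi else -x i.hi := by
  have hl : i.lo.val = i.val := rfl
  have hh : i.hi.val = i.val + 1 := rfl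
  have hform : form (simpleRoot i) x =
      (-1) ^ degree i.lo * x i.lo - (-1) ^ degree i.hi * x i.hi := by
    simp only [form, simpleRoot, Pi.sub_apply, sub_mul, mul_sub, Finset.sum_sub_distrib,
      Pi.single_apply, ite_mul, one_mul, zero_mul, mul_ite, mul_zero, Finset.sum_ite_eq',
      Finset.mem_univ, if_true]
  simp only [coroot, hform, degree, hl, hh]
  split_ifs <;> omega

theorem coroot_add (i : Index m n) (x y : Weight m n) :
    coroot i (x + y) = coroot i x + coroot i y := by
  simp only [coroot_eq, Pi.add_apply]
  split_ifs <;> ring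

theorem coroot_zero (i : Index m n) : coroot i 0 = 0 := by
  simp [coroot_eq]

theorem coroot_single (i : Index m n) (b : Letter m n) : coroot i (Pi.single b 1) =
    if b = i.lo then 1 else if b = i.hi then (if i.val + 1 = m then 1 else -1) else 0 := by
  have := i.lo_ne_hi
  simp only [coroot_eq, Pi.single_apply]
  grind

theorem wordWt_apply (w : Word m n) (b : Letter m n) : wordWt w b = w.count b := by
  induction w with
  | nil => rfl
  | cons a w ih =>
    simp only [wordWt, letterMaps, Pi.add_apply, ih, List.count_cons, Pi.single_apply]
    grind

theorem wordWt_append (u v : Word m n) : wordWt (u ++ v) = wordWt u + wordWt v := by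
  funext b
  simp [wordWt_apply]

theorem coroot_wordWt (i : Index m n) (w : Word m n) : coroot i (wordWt w) =
    w.count i.lo + if i.val + 1 = m then (w.count i.hi : ℤ) else -w.count i.hi := by
  rw [coroot_eq, wordWt_apply, wordWt_apply]

theorem coroot_wordWt_nonneg {i : Index m n} (hi : i.val + 1 = m) (w : Word m n) :
    0 ≤ coroot i (wordWt w) := by
  rw [coroot_wordWt, if_pos hi]
  omega

theorem wordPhi_sub_wordEps {i : Index m n} (hi : i.val + 1 ≠ m) (w : Word m n) :
    (wordPhi i w : ℤ) - wordEps i w = coroot i (wordWt w) := by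
  have := i.lo_ne_hi
  induction w with
  | nil => simp [wordPhi, wordEps, wordWt, coroot_zero]
  | cons b w ih =>
    simp only [wordPhi, wordEps, wordWt, tensorPhi, tensorEps, coroot_add, letterMaps,
      coroot_single]
    grind

theorem wordPhi_add_wordEps {i : Index m n} (hi : i.val + 1 = m) (w : Word m n) :
    wordPhi i w + wordEps i w = if coroot i (wordWt w) = 0 then 0 else 1 := by
  have := i.lo_ne_hi
  induction w with
  | nil => simp [wordPhi, wordEps, wordWt, coroot_zero]
  | cons b w ih =>
    have := coroot_wordWt_nonneg hi w
    simp only [wordPhi, wordEps, wordWt, tensorPhi, tensorEps, coroot_add, letterMaps,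
      coroot_single]
    grind

theorem wordPhi_singleton (i : Index m n) (b : Letter m n) :
    wordPhi i [b] = if b = i.lo then 1 else 0 := by
  have := i.lo_ne_hi
  simp only [wordPhi, wordWt, tensorPhi, coroot_zero, letterMaps, coroot_single]
  grind

theorem wordEps_singleton (i : Index m n) (b : Letter m n) :
    wordEps i [b] = if b = i.hi then 1 else 0 := by
  have := i.lo_ne_hi
  simp only [wordEps, wordWt, tensorEps, coroot_zero, letterMaps, coroot_single]
  grind

theorem wordEps_cons (i : Index m n) (b : Letter m n) (w : Word m n) : wordEps i (b :: w) =
    if i.val + 1 < m then wordEps i [b] + (wordEps i w - wordPhi i [b])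
    else if i.val + 1 = m then
      if wordPhi i [b] + wordEps i [b] = 0 then wordEps i w else wordEps i [b]
    else wordEps i w + (wordEps i [b] - wordPhi i w) := by
  have h := i.lo_ne_hi
  have hw := wordPhi_sub_wordEps (i := i) (w := w)
  simp only [wordPhi_singleton, wordEps_singleton]
  simp only [wordEps, tensorEps, letterMaps, coroot_single]
  split_ifs <;> grind

theorem wordPhi_cons (i : Index m n) (b : Letter m n) (w : Word m n) : wordPhi i (b :: w) =
    if i.val + 1 < m then wordPhi i w + (wordPhi i [b] - wordEps i w)
    else if i.val + 1 = m then
      if wordPhi i [b] + wordEps i [b] = 0 then wordPhi i w else wordPhi i [b]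
    else wordPhi i [b] + (wordPhi i w - wordEps i [b]) := by
  have h := i.lo_ne_hi
  have hw := wordPhi_sub_wordEps (i := i) (w := w)
  simp only [wordPhi_singleton, wordEps_singleton]
  simp only [wordPhi, tensorPhi, letterMaps, coroot_single]
  split_ifs <;> grind

theorem wordEps_append_and_wordPhi_append (i : Index m n) (u v : Word m n) :
    (wordEps i (u ++ v) =
      if i.val + 1 < m then wordEps i u + (wordEps i v - wordPhi i u)
      else if i.val + 1 = m then
        if wordPhi i u + wordEps i u = 0 then wordEps i v else wordEps i u
      else wordEps i v + (wordEps i u - wordPhi i v)) ∧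
    wordPhi i (u ++ v) =
      if i.val + 1 < m then wordPhi i v + (wordPhi i u - wordEps i v)
      else if i.val + 1 = m then
        if wordPhi i u + wordEps i u = 0 then wordPhi i v else wordPhi i u
      else wordPhi i u + (wordPhi i v - wordEps i u) := by
  induction u with
  | nil =>
    simp only [List.nil_append, wordEps, wordPhi]
    split_ifs <;> omega
  | cons b u ih =>
    rw [List.cons_append, wordEps_cons i b (u ++ v), wordPhi_cons i b (u ++ v),
      wordEps_cons i b u, wordPhi_cons i b u, ih.1, ih.2]
    split_ifs <;> omega

theorem wordEps_append (i : Index m n) (u v : Word m n) : wordEps i (u ++ v) =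
    if i.val + 1 < m then wordEps i u + (wordEps i v - wordPhi i u)
    else if i.val + 1 = m then if wordPhi i u + wordEps i u = 0 then wordEps i v else wordEps i u
    else wordEps i v + (wordEps i u - wordPhi i v) :=
  (wordEps_append_and_wordPhi_append i u v).1

theorem wordPhi_append (i : Index m n) (u v : Word m n) : wordPhi i (u ++ v) =
    if i.val + 1 < m then wordPhi i v + (wordPhi i u - wordEps i v)
    else if i.val + 1 = m then if wordPhi i u + wordEps i u = 0 then wordPhi i v else wordPhi i u
    else wordPhi i u + (wordPhi i v - wordEps i u) :=
  (wordEps_append_and_wordPhi_append i u v).2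

/-- The Kashiwara operator `f_i` (for `d = true`) or `e_i` (for `d = false`) on words. -/
def wordOp : Bool → Index m n → Word m n → Option (Word m n)
  | true => wordF
  | false => wordE

/-- The statistic `φ_i` or `ε_i` of words that counts how often `wordOp d i` can be applied. -/
def wordNum : Bool → Index m n → Word m n → ℕ
  | true => wordPhi
  | false => wordEps

/-- The letter that `wordOp d i` replaces. -/
def source : Bool → Index m n → Letter m n
  | true => Index.lo
  | false => Index.hi

/-- The letter that `wordOp d i` writes. -/
def target : Bool → Index m n → Letter m n
  | true => Index.hi
  | false => Index.lo

/-- The condition under which `wordOp d i` acts on the left factor of `u ⊗ v`. -/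
def ActsLeft : Bool → Index m n → Word m n → Word m n → Prop
  | true, i, u, v =>
    TensorFLeft i (wordEps i u) (wordPhi i u) (wordWt u) (wordEps i v) (wordPhi i v)
  | false, i, u, v =>
    TensorELeft i (wordEps i u) (wordPhi i u) (wordWt u) (wordEps i v) (wordPhi i v)

instance (d : Bool) (i : Index m n) (u v : Word m n) : Decidable (ActsLeft d i u v) := by
  cases d <;> (unfold ActsLeft; infer_instance)

theorem actsLeft_iff (d : Bool) (i : Index m n) (u v : Word m n) : ActsLeft d i u v ↔
    if i.val + 1 < m then wordEps i v < wordPhi i u + (!d).toNat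
    else if i.val + 1 = m then 0 < wordPhi i u + wordEps i u
    else wordPhi i v < wordEps i u + d.toNat := by
  have h := coroot_wordWt_nonneg (i := i) (w := u)
  have h' := wordPhi_add_wordEps (i := i) (w := u)
  cases d <;>
  · simp only [ActsLeft, TensorELeft, TensorFLeft, Bool.toNat, Bool.not, cond]
    split_ifs at h' ⊢ <;> omega

theorem wordNum_nil (d : Bool) (i : Index m n) : wordNum d i [] = 0 := by
  cases d <;> rfl

theorem wordNum_singleton (d : Bool) (i : Index m n) (b : Letter m n) :
    wordNum d i [b] = if b = source d i then 1 else 0 := by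
  cases d
  · exact wordEps_singleton i b
  · exact wordPhi_singleton i b

theorem wordWt_singleton (b : Letter m n) : wordWt [b] = Pi.single b 1 :=
  add_zero _

theorem wordOp_nil (d : Bool) (i : Index m n) : wordOp d i [] = none := by
  cases d <;> rfl

theorem wordOp_cons (d : Bool) (i : Index m n) (b : Letter m n) (w : Word m n) :
    wordOp d i (b :: w) =
      if ActsLeft d i [b] w then if b = source d i then some (target d i :: w) else none
      else (wordOp d i w).map (b :: ·) := by
  cases d <;>
  · simp only [wordOp, wordE, wordF, ActsLeft, source, target, wordPhi_singleton,
      wordEps_singleton, wordWt_singleton, letterMaps, Option.map_if]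
    congr

theorem wordNum_append_eq_zero (d : Bool) (i : Index m n) (u v : Word m n) :
    wordNum d i (u ++ v) = 0 ↔
      (ActsLeft d i u v → wordNum d i u = 0) ∧ (¬ActsLeft d i u v → wordNum d i v = 0) := by
  simp only [actsLeft_iff]
  cases d <;>
  · simp only [wordNum, wordEps_append, wordPhi_append, Bool.toNat, Bool.not, cond]
    split_ifs <;> omega

theorem actsLeft_append_right (d : Bool) (i : Index m n) (u v w : Word m n) :
    ActsLeft d i u (v ++ w) ↔ ActsLeft d i (u ++ v) w ∧ ActsLeft d i u v := by
  simp only [actsLeft_iff, wordEps_append, wordPhi_append]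
  cases d <;>
  · simp only [Bool.toNat, Bool.not, cond]
    split_ifs <;> omega

theorem actsLeft_append_left (d : Bool) (i : Index m n) (u v w : Word m n) :
    ActsLeft d i (u ++ v) w ↔ ActsLeft d i u (v ++ w) ∨ ActsLeft d i v w := by
  simp only [actsLeft_iff, wordEps_append, wordPhi_append]
  cases d <;>
  · simp only [Bool.toNat, Bool.not, cond]
    split_ifs <;> omega

theorem wordOp_eq_none {d : Bool} {i : Index m n} {w : Word m n} :
    wordOp d i w = none ↔ wordNum d i w = 0 := by
  induction w with
  | nil => simp only [wordOp_nil, wordNum_nil]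
  | cons b w ih =>
    have h := wordNum_append_eq_zero d i [b] w
    rw [wordNum_singleton, List.singleton_append] at h
    rw [wordOp_cons, h]
    by_cases hbw : ActsLeft d i [b] w
    · simp [hbw]
    · simp [hbw, ih]

theorem wordOp_append (d : Bool) (i : Index m n) (u v : Word m n) : wordOp d i (u ++ v) =
    if ActsLeft d i u v then (wordOp d i u).map (· ++ v) else (wordOp d i v).map (u ++ ·) := by
  induction u with
  | nil =>
    have h := wordNum_append_eq_zero d i [] v
    rw [List.nil_append, ← wordOp_eq_none, ← wordOp_eq_none] at h
    by_cases hv : ActsLeft d i [] v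
    · simp [hv, wordOp_nil, h.2]
    · simp [hv]
  | cons b u ih =>
    have h₁ := actsLeft_append_right d i [b] u v
    have h₂ := actsLeft_append_left d i [b] u v
    simp only [List.singleton_append] at h₁ h₂
    rw [List.cons_append, wordOp_cons, wordOp_cons, ih]
    by_cases hl : ActsLeft d i [b] (u ++ v)
    · rw [if_pos hl, if_pos (h₁.1 hl).1, if_pos (h₁.1 hl).2]
      split_ifs <;> rfl
    by_cases hr : ActsLeft d i u v
    · have hbu : ¬ActsLeft d i [b] u := fun h => hl (h₁.2 ⟨h₂.2 (.inr hr), h⟩)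
      simp [hl, hr, h₂, hbu, Function.comp_def]
    · simp [hl, hr, h₂, Function.comp_def]

/-- In `p ++ source d i :: s` the operator `wordOp d i` acts on the displayed letter. The first
clause is for the indices `(m-1)‾, …, 1̄`, the second one for `0`, the third one for the others. -/
def ActsBetween (i : Index m n) (p s : Word m n) : Prop :=
  if i.val + 1 < m then wordPhi i p = 0 ∧ wordEps i s = 0
  else if i.val + 1 = m then wordPhi i p = 0 ∧ wordEps i p = 0
  else wordEps i p = 0 ∧ wordPhi i s = 0

theorem actsBetween_iff {d : Bool} {i : Index m n} {p s : Word m n} : ActsBetween i p s ↔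
    ¬ActsLeft d i p (source d i :: s) ∧ ActsLeft d i [source d i] s := by
  have hne := i.lo_ne_hi
  rw [← List.singleton_append]
  simp only [ActsBetween, actsLeft_iff, wordEps_append, wordPhi_append, wordPhi_singleton,
    wordEps_singleton]
  cases d <;>
  · simp only [source, hne, hne.symm, if_true, if_false, Bool.toNat, Bool.not, cond]
    split_ifs <;> omega

end Words

section Words

variable {m n : ℕ} {d : Bool} {i : Index m n} {p s u v w w' : Word m n}

theorem wordEps_nil (i : Index m n) : wordEps i [] = 0 := rfl

theorem wordPhi_nil (i : Index m n) : wordPhi i [] = 0 := rfl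

theorem actsBetween_nil : ActsBetween i [] s ↔ ActsLeft d i [source d i] s := by
  have hne := i.lo_ne_hi
  simp only [ActsBetween, actsLeft_iff, wordPhi_singleton, wordEps_singleton, wordEps_nil,
    wordPhi_nil]
  cases d <;>
  · simp only [source, hne, hne.symm, if_true, if_false, Bool.toNat, Bool.not, cond]
    grind

theorem wordOp_eq_some : wordOp d i w = some w' ↔
    ∃ p s, w = p ++ source d i :: s ∧ w' = p ++ target d i :: s ∧ ActsBetween i p s := by
  constructor
  · intro h
    induction w generalizing w' with
    | nil => simp [wordOp_nil] at h
    | cons b w ih =>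
      rw [wordOp_cons] at h
      split_ifs at h with hl hb
      · subst hb
        exact ⟨[], w, rfl, (Option.some.inj h).symm, actsBetween_nil.2 hl⟩
      · obtain ⟨w', hw', rfl⟩ := Option.map_eq_some_iff.1 h
        obtain ⟨p, s, rfl, rfl, hps⟩ := ih hw'
        rw [actsBetween_iff] at hps
        exact ⟨b :: p, s, rfl, rfl, actsBetween_iff.2
          ⟨fun h => ((actsLeft_append_left d i [b] p _).1 h).elim hl hps.1, hps.2⟩⟩
  · rintro ⟨p, s, rfl, rfl, h⟩
    rw [actsBetween_iff] at h
    rw [wordOp_append, if_neg h.1, wordOp_cons, if_pos h.2, if_pos rfl]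
    rfl

theorem wordOp_eq_some_comm : wordOp d i w = some w' ↔ wordOp (!d) i w' = some w := by
  rw [wordOp_eq_some, wordOp_eq_some]
  cases d <;> simp only [source, target, Bool.not] <;> grind

theorem ActsBetween.wordPhi_eq (h : ActsBetween i p s) :
    wordPhi i (p ++ i.lo :: s) = wordPhi i (p ++ i.hi :: s) + 1 := by
  have hne := i.lo_ne_hi
  simp only [ActsBetween, wordPhi_append, wordEps_cons i _ s, wordPhi_cons i _ s,
    wordPhi_singleton, wordEps_singleton, hne, hne.symm, if_true, if_false] at h ⊢
  grind

theorem ActsBetween.wordEps_eq (h : ActsBetween i p s) :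
    wordEps i (p ++ i.hi :: s) = wordEps i (p ++ i.lo :: s) + 1 := by
  have hne := i.lo_ne_hi
  simp only [ActsBetween, wordEps_append, wordEps_cons i _ s, wordPhi_cons i _ s,
    wordPhi_singleton, wordEps_singleton, hne, hne.symm, if_true, if_false] at h ⊢
  grind

theorem wordNum_of_wordOp (h : wordOp d i w = some w') :
    wordNum d i w = wordNum d i w' + 1 ∧ wordNum (!d) i w' = wordNum (!d) i w + 1 := by
  obtain ⟨p, s, rfl, rfl, hps⟩ := wordOp_eq_some.1 h
  cases d
  · exact ⟨hps.wordEps_eq, hps.wordPhi_eq⟩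
  · exact ⟨hps.wordPhi_eq, hps.wordEps_eq⟩

theorem wordWt_append_cons (b : Letter m n) :
    wordWt (p ++ b :: s) = wordWt (p ++ s) + Pi.single b 1 := by
  rw [wordWt_append, wordWt_append, wordWt]
  simp only [letterMaps]
  abel

theorem isCrystalOn_wordMaps {S : Set (Word m n)}
    (hS : ∀ d i w w', w ∈ S → wordOp d i w = some w' → w' ∈ S) :
    IsCrystalOn (wordMaps m n) S where
  e_mem i w hw w' h := hS false i w w' hw h
  f_mem i w hw w' h := hS true i w w' hw h
  phi_sub_eps _ hi w _ := wordPhi_sub_wordEps hi w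
  coroot_zero_nonneg _ hi w _ := coroot_wordWt_nonneg hi w
  phi_add_eps _ hi w _ := wordPhi_add_wordEps hi w
  of_e i w _ w' h := by
    obtain ⟨p, s, rfl, rfl, hps⟩ := wordOp_eq_some.1 (show wordOp false i w = some w' from h)
    refine ⟨?_, hps.wordPhi_eq, ?_⟩
    · simp [wordMaps, source, target, hps.wordEps_eq]
    · simp only [wordMaps, source, target, wordWt_append_cons, simpleRoot]
      abel
  of_f i w _ w' h := by
    obtain ⟨p, s, rfl, rfl, hps⟩ := wordOp_eq_some.1 (show wordOp true i w = some w' from h)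
    refine ⟨hps.wordEps_eq, ?_, ?_⟩
    · simp [wordMaps, source, target, hps.wordPhi_eq]
    · simp only [wordMaps, source, target, wordWt_append_cons, simpleRoot]
      abel
  f_iff_e i w _ w' _ := wordOp_eq_some_comm (d := true)

theorem ActsBetween.of_append (h : ActsBetween i (u ++ p) (s ++ v)) : ActsBetween i p s := by
  simp only [ActsBetween, wordEps_append, wordPhi_append] at h ⊢
  split_ifs at h ⊢ <;> omega

end Words

instance (m n : ℕ) : Parity (Letter m n) := ⟨fun b => decide (m ≤ b.val)⟩

section Plactic

variable {m n : ℕ} {i : Index m n} {w w' w'' : Word m n}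

/-- The words `w` and `w'` have the same `ε_i` and `φ_i`, and the operators `e_i` and `f_i` map them
to plactically equivalent words. -/
structure SameCrystal (i : Index m n) (w w' : Word m n) : Prop where
  eps : wordEps i w = wordEps i w'
  phi : wordPhi i w = wordPhi i w'
  op : ∀ d, Option.Rel (Knuth ColLt) (wordOp d i w) (wordOp d i w')

theorem colLt_iff {a b : Letter m n} : ColLt a b ↔ a.val < b.val ∨ a.val = b.val ∧ m ≤ a.val := by
  simp [ColLt, Parity.isOdd, Fin.ext_iff]

theorem wordOp_singleton (d : Bool) (i : Index m n) (b : Letter m n) :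
    wordOp d i [b] = if b = source d i then some [target d i] else none := by
  split_ifs with hb
  · subst hb
    exact wordOp_eq_some.2 ⟨[], [], rfl, rfl, by simp [ActsBetween, wordEps_nil, wordPhi_nil]⟩
  · rw [wordOp_eq_none, wordNum_singleton, if_neg hb]

end Plactic

theorem Knuth.perm {α : Type*} {D : α → α → Prop} {w w' : List α} (h : Knuth D w w') :
    w.Perm w' := by
  induction h with
  | rel _ _ h =>
    cases h with
    | lower u v x y z _ _ => exact List.Perm.append_left u (.swap _ _ _)
    | upper u v x y z _ _ => exact List.Perm.append_left u (.cons _ (.swap _ _ _))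
  | refl => exact .refl _
  | symm _ _ _ ih => exact ih.symm
  | trans _ _ _ _ _ ih₁ ih₂ => exact ih₁.trans ih₂

section PlacticOperators

variable {m n : ℕ} {i : Index m n} {w w' w'' : Word m n}

theorem optionRel_knuth_lower {x y z : Letter m n} (hxy : ColLt x y) (hzy : ¬ColLt z y) :
    Option.Rel (Knuth ColLt) (some [x, z, y]) (some [z, x, y]) :=
  .some (.rel _ _ (.lower [] [] x y z hxy hzy))

theorem optionRel_knuth_upper {x y z : Letter m n} (hyz : ColLt y z) (hyx : ¬ColLt y x) :
    Option.Rel (Knuth ColLt) (some [y, z, x]) (some [y, x, z]) :=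
  .some (.rel _ _ (.upper [] [] x y z hyz hyx))

theorem eq_lo_or_eq_hi_or_ne (i : Index m n) (b : Letter m n) :
    b = i.lo ∨ b = i.hi ∨ b.val ≠ i.val ∧ b.val ≠ i.val + 1 := by
  have hlo : i.lo.val = i.val := rfl
  have hhi : i.hi.val = i.val + 1 := rfl
  rw [Fin.ext_iff, Fin.ext_iff]
  omega

theorem wordEps_wordPhi_lower (i : Index m n) {x y z : Letter m n} (hxy : ColLt x y)
    (hzy : ¬ColLt z y) :
    wordEps i [x, z, y] = wordEps i [z, x, y] ∧ wordPhi i [x, z, y] = wordPhi i [z, x, y] := by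
  have hlo : i.lo.val = i.val := rfl
  have hhi : i.hi.val = i.val + 1 := rfl
  rw [colLt_iff] at hxy hzy
  change wordEps i ([x] ++ ([z] ++ [y])) = wordEps i ([z] ++ ([x] ++ [y])) ∧
    wordPhi i ([x] ++ ([z] ++ [y])) = wordPhi i ([z] ++ ([x] ++ [y]))
  simp only [wordEps_append, wordPhi_append, wordEps_singleton, wordPhi_singleton]
  rcases eq_lo_or_eq_hi_or_ne i x with rfl | rfl | hx <;>
  rcases eq_lo_or_eq_hi_or_ne i y with rfl | rfl | hy <;>
  rcases eq_lo_or_eq_hi_or_ne i z with rfl | rfl | hz <;> try omega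
  all_goals
    simp only [*, Fin.ext_iff, if_true, if_false, Nat.left_eq_add, Nat.add_eq_left, one_ne_zero]
    try omega
  all_goals grind

theorem wordEps_wordPhi_upper (i : Index m n) {x y z : Letter m n} (hyz : ColLt y z)
    (hyx : ¬ColLt y x) :
    wordEps i [y, z, x] = wordEps i [y, x, z] ∧ wordPhi i [y, z, x] = wordPhi i [y, x, z] := by
  have hlo : i.lo.val = i.val := rfl
  have hhi : i.hi.val = i.val + 1 := rfl
  rw [colLt_iff] at hyz hyx
  change wordEps i ([y] ++ ([z] ++ [x])) = wordEps i ([y] ++ ([x] ++ [z])) ∧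
    wordPhi i ([y] ++ ([z] ++ [x])) = wordPhi i ([y] ++ ([x] ++ [z]))
  simp only [wordEps_append, wordPhi_append, wordEps_singleton, wordPhi_singleton]
  rcases eq_lo_or_eq_hi_or_ne i x with rfl | rfl | hx <;>
  rcases eq_lo_or_eq_hi_or_ne i y with rfl | rfl | hy <;>
  rcases eq_lo_or_eq_hi_or_ne i z with rfl | rfl | hz <;> try omega
  all_goals
    simp only [*, Fin.ext_iff, if_true, if_false, Nat.left_eq_add, Nat.add_eq_left, one_ne_zero]
    try omega
  all_goals grind

theorem sameCrystal_lower (i : Index m n) {x y z : Letter m n} (hxy : ColLt x y)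
    (hzy : ¬ColLt z y) : SameCrystal i [x, z, y] [z, x, y] := by
  obtain ⟨heps, hphi⟩ := wordEps_wordPhi_lower i hxy hzy
  refine ⟨heps, hphi, fun d => ?_⟩
  clear heps hphi
  have hlo : i.lo.val = i.val := rfl
  have hhi : i.hi.val = i.val + 1 := rfl
  rw [colLt_iff] at hxy hzy
  change Option.Rel _ (wordOp d i ([x] ++ ([z] ++ [y]))) (wordOp d i ([z] ++ ([x] ++ [y])))
  by_cases hi : i.val + 1 < m <;> by_cases hi' : i.val + 1 = m <;> try omega
  all_goals
    simp only [wordOp_append, actsLeft_iff, wordEps_append, wordPhi_append, wordEps_singleton,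
      wordPhi_singleton, wordOp_singleton, hi, hi', lt_irrefl, if_true, if_false]
    rw [eq_comm] at hi' -- orients `i + 1 = m` for the simplification with all hypotheses below
    rcases eq_lo_or_eq_hi_or_ne i x with rfl | rfl | hx <;>
    rcases eq_lo_or_eq_hi_or_ne i y with rfl | rfl | hy <;>
    rcases eq_lo_or_eq_hi_or_ne i z with rfl | rfl | hz <;> try omega
  all_goals
    cases d <;>
    simp only [source, target, *, Fin.ext_iff, if_true, if_false, Bool.toNat, Bool.not, cond,
      Option.map_some, Option.map_none, Nat.left_eq_add, Nat.add_eq_left, one_ne_zero]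
  all_goals try simp only [Nat.reduceSub, Nat.reduceAdd, Nat.reduceLT, if_true, if_false,
    Option.map_some, Option.map_none, List.cons_append, List.nil_append]
  all_goals first
    | exact .none
    | exact optionRel_knuth_lower (colLt_iff.2 (by omega)) (mt colLt_iff.1 (by omega))
    | exact optionRel_knuth_upper (colLt_iff.2 (by omega)) (mt colLt_iff.1 (by omega))

theorem sameCrystal_upper (i : Index m n) {x y z : Letter m n} (hyz : ColLt y z)
    (hyx : ¬ColLt y x) : SameCrystal i [y, z, x] [y, x, z] := by
  obtain ⟨heps, hphi⟩ := wordEps_wordPhi_upper i hyz hyx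
  refine ⟨heps, hphi, fun d => ?_⟩
  clear heps hphi
  have hlo : i.lo.val = i.val := rfl
  have hhi : i.hi.val = i.val + 1 := rfl
  rw [colLt_iff] at hyz hyx
  change Option.Rel _ (wordOp d i ([y] ++ ([z] ++ [x]))) (wordOp d i ([y] ++ ([x] ++ [z])))
  by_cases hi : i.val + 1 < m <;> by_cases hi' : i.val + 1 = m <;> try omega
  all_goals
    simp only [wordOp_append, actsLeft_iff, wordEps_append, wordPhi_append, wordEps_singleton,
      wordPhi_singleton, wordOp_singleton, hi, hi', lt_irrefl, if_true, if_false]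
    rw [eq_comm] at hi' -- orients `i + 1 = m` for the simplification with all hypotheses below
    rcases eq_lo_or_eq_hi_or_ne i x with rfl | rfl | hx <;>
    rcases eq_lo_or_eq_hi_or_ne i y with rfl | rfl | hy <;>
    rcases eq_lo_or_eq_hi_or_ne i z with rfl | rfl | hz <;> try omega
  all_goals
    cases d <;>
    simp only [source, target, *, Fin.ext_iff, if_true, if_false, Bool.toNat, Bool.not, cond,
      Option.map_some, Option.map_none, Nat.left_eq_add, Nat.add_eq_left, one_ne_zero]
  all_goals try simp only [Nat.reduceSub, Nat.reduceAdd, Nat.reduceLT, if_true, if_false,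
    Option.map_some, Option.map_none, List.cons_append, List.nil_append]
  all_goals first
    | exact .none
    | exact optionRel_knuth_lower (colLt_iff.2 (by omega)) (mt colLt_iff.1 (by omega))
    | exact optionRel_knuth_upper (colLt_iff.2 (by omega)) (mt colLt_iff.1 (by omega))

theorem SameCrystal.refl (i : Index m n) (w : Word m n) : SameCrystal i w w where
  eps := rfl
  phi := rfl
  op d := by cases wordOp d i w with
    | none => exact .none
    | some w => exact .some (.refl w)

theorem SameCrystal.symm (h : SameCrystal i w w') : SameCrystal i w' w where
  eps := h.eps.symm
  phi := h.phi.symm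
  op d := by
    have key {a b : Option (Word m n)} : Option.Rel (Knuth ColLt) a b →
        Option.Rel (Knuth ColLt) b a
      | .some h => .some (.symm _ _ h)
      | .none => .none
    exact key (h.op d)

theorem SameCrystal.trans (h : SameCrystal i w w') (h' : SameCrystal i w' w'') :
    SameCrystal i w w'' where
  eps := h.eps.trans h'.eps
  phi := h.phi.trans h'.phi
  op d := by
    have key {a b c : Option (Word m n)} : Option.Rel (Knuth ColLt) a b →
        Option.Rel (Knuth ColLt) b c → Option.Rel (Knuth ColLt) a c
      | .some h, .some h' => .some (.trans _ _ _ h h')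
      | .none, .none => .none
    exact key (h.op d) (h'.op d)

theorem optionRel_map_append {a b : Option (Word m n)} (h : Option.Rel (Knuth ColLt) a b)
    (u v : Word m n) : Option.Rel (Knuth ColLt) (a.map (u ++ · ++ v)) (b.map (u ++ · ++ v)) := by
  rcases h with h | _
  exacts [.some (h.append u v), .none]

theorem SameCrystal.append (h : SameCrystal i w w') (hk : Knuth ColLt w w') (u v : Word m n) :
    SameCrystal i (u ++ w ++ v) (u ++ w' ++ v) where
  eps := by simp only [wordEps_append, wordPhi_append, h.eps, h.phi]
  phi := by simp only [wordEps_append, wordPhi_append, h.eps, h.phi]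
  op d := by
    have map_left (a : Option (Word m n)) :
        Option.Rel (Knuth ColLt) (a.map (· ++ w ++ v)) (a.map (· ++ w' ++ v)) := by
      cases a
      exacts [.none, .some (hk.append _ v)]
    have map_right (a : Option (Word m n)) :
        Option.Rel (Knuth ColLt) (a.map (u ++ w ++ ·)) (a.map (u ++ w' ++ ·)) := by
      cases a
      exacts [.none, .some (by simpa using hk.append u _)]
    simp only [wordOp_append, actsLeft_iff, wordEps_append, wordPhi_append, h.eps, h.phi]
    have := map_left (wordOp d i u)
    have := optionRel_map_append (h.op d) u v
    have := map_right (wordOp d i v)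
    split_ifs <;> simp_all [Function.comp_def]

theorem Knuth.sameCrystal (h : Knuth ColLt w w') (i : Index m n) : SameCrystal i w w' := by
  induction h with
  | rel _ _ h =>
    cases h with
    | lower u v x y z h1 h2 =>
      simpa using (sameCrystal_lower i h1 h2).append (.rel _ _ (.lower [] [] x y z h1 h2)) u v
    | upper u v x y z h1 h2 =>
      simpa using (sameCrystal_upper i h1 h2).append (.rel _ _ (.upper [] [] x y z h1 h2)) u v
  | refl => exact .refl i _
  | symm _ _ _ ih => exact ih.symm
  | trans _ _ _ _ _ ih1 ih2 => exact ih1.trans ih2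
theorem Knuth.exists_wordOp (h : Knuth ColLt w w') {d : Bool} {v : Word m n}
    (hv : wordOp d i w = some v) : ∃ v', wordOp d i w' = some v' ∧ Knuth ColLt v v' := by
  have h := (h.sameCrystal i).op d
  cases hv' : wordOp d i w' with
  | none => rw [hv, hv'] at h; nomatch h
  | some v' => exact ⟨v', rfl, by rwa [hv, hv', Option.rel_some_some] at h⟩

theorem Knuth.wordWt_eq (h : Knuth ColLt w w') : wordWt w = wordWt w' := by
  funext b
  rw [wordWt_apply, wordWt_apply, h.perm.count_eq]

end PlacticOperators

/-! ### Stability of tableaux under the crystal operators -/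

section Adjacency

variable {α : Type*} [LinearOrder α] [Parity α] {a b c d l : List α} {x y : α}

theorem Adj.append : ∀ {a b c d : List α}, a.length = b.length → Adj a b → Adj c d →
    Adj (a ++ c) (b ++ d)
  | [], [], _, _, _, _, h => h
  | _ :: _, _ :: _, _, _, hl, h, h' => ⟨h.1, Adj.append (by simpa using hl) h.2 h'⟩

theorem Adj.split_left : ∀ {a c d : List α}, Adj (a ++ c) d →
    Adj a d ∨ ∃ d₁ d₂, d = d₁ ++ d₂ ∧ d₁.length = a.length ∧ Adj a d₁ ∧ Adj c d₂
  | [], _, d, h => .inr ⟨[], d, rfl, rfl, adj_nil _, h⟩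
  | _ :: _, _, [], _ => .inl (adj_nil _)
  | _ :: _, _, y :: _, h => by
    rcases Adj.split_left h.2 with h' | ⟨d₁, d₂, rfl, hlen, h₁, h₂⟩
    · exact .inl ⟨h.1, h'⟩
    · exact .inr ⟨y :: d₁, d₂, rfl, by simp [hlen], ⟨h.1, h₁⟩, h₂⟩

theorem Adj.split_right : ∀ {l a b : List α}, Adj l (a ++ b) →
    ∃ l₁ l₂, l = l₁ ++ l₂ ∧ l₁.length = a.length ∧ Adj l₁ a ∧ Adj l₂ b
  | l, [], _, h => ⟨[], l, rfl, rfl, adj_nil _, h⟩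
  | [], _ :: _, _, h => h.elim
  | y :: _, _ :: _, _, h => by
    obtain ⟨l₁, l₂, rfl, hlen, h₁, h₂⟩ := Adj.split_right h.2
    exact ⟨y :: l₁, l₂, rfl, by simp [hlen], ⟨h.1, h₁⟩, h₂⟩

theorem Adj.replace_left (h : Adj (a ++ x :: b) d)
    (hxy : ∀ d₁ z d₂, d = d₁ ++ z :: d₂ → d₁.length = a.length → Adj a d₁ → ¬ ColLt z x →
      Adj b d₂ → ¬ ColLt z y) : Adj (a ++ y :: b) d := by
  rcases h.split_left with h | ⟨d₁, d₂, rfl, hlen, h₁, h₂⟩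
  · exact h.append_left _
  · refine Adj.append hlen.symm h₁ ?_
    cases d₂ with
    | nil => simp
    | cons z d₂ => exact ⟨hxy d₁ z d₂ rfl hlen h₁ h₂.1 h₂.2, h₂.2⟩

theorem Adj.replace_right (h : Adj l (a ++ x :: b))
    (hxy : ∀ l₁ z l₂, l = l₁ ++ z :: l₂ → l₁.length = a.length → Adj l₁ a → ¬ ColLt x z →
      Adj l₂ b → ¬ ColLt y z) : Adj l (a ++ y :: b) := by
  obtain ⟨l₁, l₂, rfl, hlen, h₁, h₂⟩ := h.split_right
  refine Adj.append hlen h₁ ?_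
  cases l₂ with
  | nil => exact h₂
  | cons z l₂ => exact ⟨hxy l₁ z l₂ rfl hlen h₁ h₂.1 h₂.2, h₂.2⟩

theorem Adj.exists_not_colLt_left (h : Adj c d) (hlen : c.length = d.length) (hx : x ∈ c) :
    ∃ y ∈ d, ¬ ColLt y x := by
  obtain ⟨r, hr, rfl⟩ := List.getElem_of_mem hx
  exact ⟨(d)[r], List.getElem_mem _,
    h.not_colLt (List.getElem?_eq_getElem (hlen ▸ hr)) (List.getElem?_eq_getElem hr)⟩

theorem readCols_append {α : Type*} (L L' : List (List α)) :
    readCols (L ++ L') = readCols L' ++ readCols L := by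
  induction L with
  | nil => simp [readCols]
  | cons c L ih => simp [readCols, ih]

theorem exists_of_readCols_eq {α : Type*} {T : List (List α)} {p s : List α} {x : α}
    (h : readCols T = p ++ x :: s) : ∃ L a b L', T = L ++ (a ++ x :: b) :: L' ∧
      p = readCols L' ++ a ∧ s = b ++ readCols L := by
  induction T generalizing s with
  | nil => simp [readCols] at h
  | cons c T ih =>
    rcases List.append_eq_append_iff.1 h with ⟨a, rfl, hc⟩ | ⟨t, hT, ht⟩
    · exact ⟨[], a, s, T, by rw [hc]; rfl, rfl, by simp [readCols]⟩
    · rcases List.cons_eq_append_iff.1 ht with ⟨rfl, rfl⟩ | ⟨t, rfl, rfl⟩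
      · exact ⟨[], [], s, T, rfl, by simpa using hT.symm, by simp [readCols]⟩
      · obtain ⟨L, a, b, L', rfl, hp, rfl⟩ := ih hT
        exact ⟨c :: L, a, b, L', rfl, hp, by simp [readCols]⟩

theorem isTableau_append_cons {L L' : List (List α)} : IsTableau (L ++ c :: L') ↔
    IsTableau L ∧ (∀ l, L.getLast? = some l → Adj l c) ∧ IsColumn c ∧ Adj c (L'.headD []) ∧
      IsTableau L' := by
  induction L with
  | nil => simp [IsTableau]
  | cons d L ih =>
    cases L with
    | nil => simp [IsTableau, and_left_comm]
    | cons e L =>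
      rw [List.getLast?_cons_cons]
      simp only [List.cons_append] at ih ⊢
      rw [IsTableau, ih]
      simp [IsTableau, and_assoc]

end Adjacency

section Stability

variable {m n : ℕ} {i : Index m n} {a b d l p s u v : Word m n} {x y z : Letter m n}

theorem ActsBetween.count_left (h : ActsBetween i (u ++ p) s) :
    (i.val + 1 < m → p.count i.lo ≤ p.count i.hi) ∧
    (i.val + 1 = m → i.lo ∉ p ∧ i.hi ∉ p) ∧
    (m < i.val + 1 → p.count i.hi ≤ p.count i.lo) := by
  have h' : ActsBetween i p s := .of_append (v := []) (by simpa using h)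
  have hsub := fun hi => wordPhi_sub_wordEps (i := i) hi p
  have hadd := fun hi => wordPhi_add_wordEps (i := i) hi p
  simp only [coroot_wordWt] at hsub hadd
  rw [← List.count_eq_zero, ← List.count_eq_zero]
  unfold ActsBetween at h'
  grind

theorem ActsBetween.count_right (h : ActsBetween i p (s ++ v)) :
    (i.val + 1 < m → s.count i.hi ≤ s.count i.lo) ∧
    (m < i.val + 1 → s.count i.lo ≤ s.count i.hi) := by
  have h' : ActsBetween i p s := .of_append (u := []) h
  have hsub := fun hi => wordPhi_sub_wordEps (i := i) hi s
  simp only [coroot_wordWt] at hsub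
  unfold ActsBetween at h'
  grind

theorem ActsBetween.ne_of_cons (h : ActsBetween i p (y :: s)) :
    (i.val + 1 < m → y ≠ i.hi) ∧ (m < i.val + 1 → y ≠ i.lo) := by
  have hcount := ActsBetween.count_right (s := [y]) h
  have := i.lo_ne_hi
  simp only [List.count_singleton, beq_iff_eq] at hcount
  grind

theorem ActsBetween.ne_of_concat (h : ActsBetween i (p ++ [y]) s) :
    (i.val + 1 ≤ m → y ≠ i.lo) ∧ (m ≤ i.val + 1 → y ≠ i.hi) := by
  have hcount := ActsBetween.count_left (p := [y]) h
  have := i.lo_ne_hi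
  simp only [List.count_singleton, beq_iff_eq, List.mem_singleton] at hcount
  grind

theorem Index.colLt_mono (i : Index m n) (y : Letter m n) :
    (ColLt y i.lo → ColLt y i.hi) ∧ (ColLt i.hi y → ColLt i.lo y) := by
  simp only [colLt_iff, Index.lo, Index.hi]
  omega

theorem ActsBetween.colLt_lo_iff (h : ActsBetween i p (y :: s)) :
    ColLt i.lo y ↔ ColLt i.hi y := by
  have := h.ne_of_cons
  simp only [ne_eq, Fin.ext_iff, colLt_iff, Index.lo, Index.hi] at this ⊢
  omega

theorem ActsBetween.colLt_hi_iff (h : ActsBetween i (p ++ [y]) s) :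
    ColLt y i.hi ↔ ColLt y i.lo := by
  have := h.ne_of_concat
  simp only [ne_eq, Fin.ext_iff, colLt_iff, Index.lo, Index.hi] at this ⊢
  omega

theorem ActsBetween.forall_colLt_hi (h : ActsBetween i p (b ++ s)) (hc : IsColumn (i.lo :: b)) :
    ∀ y ∈ b, ColLt i.hi y := by
  obtain ⟨hlo, hb⟩ := List.pairwise_cons.1 hc
  cases b with
  | nil => simp
  | cons e b =>
    have he : ColLt i.hi e := h.colLt_lo_iff.1 (hlo e (by simp))
    intro y hy
    rcases List.mem_cons.1 hy with rfl | hy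
    · exact he
    · exact ColLt.trans he ((List.pairwise_cons.1 hb).1 y hy)

theorem ActsBetween.forall_colLt_lo (h : ActsBetween i (p ++ a) s)
    (hc : IsColumn (a ++ [i.hi])) : ∀ x ∈ a, ColLt x i.lo := by
  obtain ⟨ha, -, hhi⟩ := List.pairwise_append.1 hc
  rcases List.eq_nil_or_concat' a with rfl | ⟨a, e, rfl⟩
  · simp
  · have he : ColLt e i.lo := ActsBetween.colLt_hi_iff (p := p ++ a) (by simpa using h) |>.1
      (hhi e (by simp) _ (by simp))
    intro x hx
    rcases List.mem_append.1 hx with hx | hx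
    · exact ColLt.trans ((List.pairwise_append.1 ha).2.2 x hx e (by simp)) he
    · exact List.mem_singleton.1 hx ▸ he

theorem ActsBetween.isColumn_replace (h : ActsBetween i (p ++ a) (b ++ s)) (t : Bool)
    (hc : IsColumn (a ++ source t i :: b)) : IsColumn (a ++ target t i :: b) := by
  obtain ⟨ha, hb, hab⟩ := List.pairwise_append.1 hc
  have hb' := (List.pairwise_cons.1 hb).1
  have hbelow : ∀ y ∈ b, ColLt (target t i) y := by
    cases t
    · exact fun y hy => (i.colLt_mono y).2 (hb' y hy)
    · exact h.forall_colLt_hi hb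
  have habove : ∀ x ∈ a, ColLt x (target t i) := by
    cases t
    · exact h.forall_colLt_lo (hc.sublist (by simp [source]))
    · exact fun x hx => (i.colLt_mono x).1 (hab x hx _ List.mem_cons_self)
  refine List.pairwise_append.2 ⟨ha, List.pairwise_cons.2 ⟨hbelow, hb.of_cons⟩, ?_⟩
  rintro x hx y (- | ⟨-, hy⟩)
  · exact habove x hx
  · exact hab x hx y (List.mem_cons_of_mem _ hy)

theorem ActsBetween.count_hi_add_le (h : ActsBetween i (p ++ (d ++ a)) s) (hd : IsColumn d)
    (hi : m < i.val + 1) : d.count i.hi + a.count i.hi ≤ a.count i.lo := by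
  induction d generalizing p with
  | nil => simpa using (ActsBetween.count_left (u := p) h).2.2 hi
  | cons x d ih =>
    have hx := (List.pairwise_cons.1 hd).1
    by_cases hxhi : x = i.hi
    · have hlo : i.lo ∉ x :: d := by
        intro hlo
        rcases List.mem_cons.1 hlo with hlo | hlo
        · exact i.lo_ne_hi (hlo.trans hxhi)
        · have := hx _ hlo
          simp only [hxhi, colLt_iff, Index.lo, Index.hi] at this
          omega
      have := (ActsBetween.count_left (u := p) h).2.2 hi
      rwa [List.count_append, List.count_append, List.count_eq_zero.2 hlo, zero_add] at this
    · rw [List.count_cons_of_ne hxhi]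
      exact ih (p := p ++ [x]) (by simpa using h) hd.of_cons

theorem ActsBetween.count_lo_add_le (h : ActsBetween i p (b ++ (l ++ s))) (hl : IsColumn l)
    (hi : m < i.val + 1) : b.count i.lo + l.count i.lo ≤ b.count i.hi := by
  induction l using List.reverseRecOn generalizing s with
  | nil => simpa using (ActsBetween.count_right h).2 hi
  | append_singleton l x ih =>
    obtain ⟨hl, -, hx⟩ := List.pairwise_append.1 hl
    by_cases hxlo : x = i.lo
    · have hhi : i.hi ∉ l ++ [x] := by
        intro hhi
        rcases List.mem_append.1 hhi with hhi | hhi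
        · have := hx _ hhi x (by simp)
          simp only [hxlo, colLt_iff, Index.lo, Index.hi] at this
          omega
        · exact i.lo_ne_hi (hxlo.symm.trans (List.mem_singleton.1 hhi).symm)
      have := (ActsBetween.count_right (s := b ++ (l ++ [x])) (by simpa using h)).2 hi
      rwa [List.count_append, List.count_append (l₁ := b), List.count_eq_zero.2 hhi, add_zero]
        at this
    · rw [List.count_append, List.count_singleton, beq_eq_false_iff_ne.2 hxlo]
      exact ih (s := x :: s) (by simpa using h) hl

theorem Adj.count_lo_le_count_hi (hi : m < i.val + 1) : ∀ {a d : Word m n}, Adj a d →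
    a.length = d.length → (∀ y ∈ d, y ≤ i.hi) → a.count i.lo ≤ d.count i.hi
  | [], _, _, _, _ => by simp
  | x :: a, y :: d, h, hlen, hd => by
    have ih := h.2.count_lo_le_count_hi hi (by simpa using hlen) fun z hz => hd z (by simp [hz])
    have hy := hd y (by simp)
    have hxy := h.1
    simp only [colLt_iff, Fin.le_def, Index.hi] at hxy hy
    simp only [List.count_cons, beq_iff_eq, Fin.ext_iff, Index.lo, Index.hi] at ih ⊢
    split_ifs <;> omega

theorem Adj.count_hi_le_count_lo (hi : m < i.val + 1) : ∀ {l b : Word m n}, Adj l b →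
    (∀ x ∈ l, i.lo ≤ x) → b.count i.hi ≤ l.count i.lo
  | _, [], _, _ => by simp
  | x :: l, y :: b, h, hl => by
    have ih := h.2.count_hi_le_count_lo hi fun z hz => hl z (by simp [hz])
    have hx := hl x (by simp)
    have hxy := h.1
    simp only [colLt_iff, Fin.le_def, Index.lo] at hxy hx
    simp only [List.count_cons, beq_iff_eq, Fin.ext_iff, Index.lo, Index.hi] at ih ⊢
    split_ifs <;> omega

theorem ActsBetween.adj_right (h : ActsBetween i (p ++ (d ++ a)) (b ++ s))
    (hc : IsColumn (a ++ i.lo :: b)) (hd : IsColumn d) (hadj : Adj (a ++ i.lo :: b) d) :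
    Adj (a ++ i.hi :: b) d := by
  refine hadj.replace_left ?_
  rintro d₁ z d₂ rfl hlen hadj₁ hz hadj₂ hzhi
  obtain ⟨-, hb, ha⟩ := List.pairwise_append.1 hc
  have hz₁ := (List.pairwise_append.1 hd).2.2
  have hval : z.val = i.val ∧ i.val + 1 ≤ m ∨ z.val = i.val + 1 ∧ m ≤ i.val + 1 := by
    simp only [colLt_iff, Index.lo, Index.hi] at hz hzhi
    omega
  have hcount := ActsBetween.count_left (u := p ++ d₁) (p := z :: d₂ ++ a) (by simpa using h)
  rcases hval with ⟨hzlo, hi⟩ | ⟨hz, hi⟩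
  · obtain rfl : z = i.lo := Fin.ext hzlo
    obtain hi | hi := hi.lt_or_eq
    · have hmem : i.hi ∈ i.lo :: d₂ ++ a :=
        List.count_pos_iff.1 (lt_of_lt_of_le (by simp) (hcount.1 hi))
      have hhi : i.hi ∈ d₂ := by
        rcases List.mem_append.1 hmem with hmem | hmem
        · exact (List.mem_cons.1 hmem).resolve_left i.lo_ne_hi.symm
        · have := ha _ hmem _ List.mem_cons_self
          simp only [colLt_iff, Index.lo, Index.hi] at this
          omega
      obtain ⟨y, hy, hyhi⟩ := hadj₂.exists_not_colLt hhi
      exact hyhi (h.forall_colLt_hi hb y hy)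
    · exact (hcount.2.1 hi).1 (by simp)
  · obtain rfl : z = i.hi := Fin.ext hz
    obtain hi | hi := hi.lt_or_eq
    · have h₁ := h.count_hi_add_le hd hi
      have h₂ := hadj₁.count_lo_le_count_hi hi hlen.symm fun y hy => (hz₁ y hy _ (by simp)).le
      rw [List.count_append, List.count_cons_self] at h₁
      omega
    · exact (hcount.2.1 hi.symm).2 (by simp)

theorem ActsBetween.adj_left (h : ActsBetween i (p ++ a) (b ++ (l ++ s)))
    (hc : IsColumn (a ++ i.hi :: b)) (hl : IsColumn l) (hadj : Adj l (a ++ i.hi :: b)) :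
    Adj l (a ++ i.lo :: b) := by
  refine hadj.replace_right ?_
  rintro l₁ z l₂ rfl hlen hadj₁ hz hadj₂ hzlo
  have hb := (List.pairwise_cons.1 (List.pairwise_append.1 hc).2.1).1
  have hz₂ := (List.pairwise_cons.1 (List.pairwise_append.1 hl).2.1).1
  have hval : z.val = i.val + 1 ∧ i.val + 1 < m ∨ z.val = i.val ∧ m < i.val + 1 := by
    simp only [colLt_iff, Index.lo, Index.hi] at hz hzlo
    omega
  rcases hval with ⟨hzhi, hi⟩ | ⟨hz, hi⟩
  · obtain rfl : z = i.hi := Fin.ext hzhi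
    have hcount := (ActsBetween.count_right (s := b ++ (l₁ ++ [i.hi])) (v := l₂ ++ s)
      (by simpa using h)).1 hi
    have hmem : i.lo ∈ b ++ (l₁ ++ [i.hi]) :=
      List.count_pos_iff.1 (lt_of_lt_of_le (by simp) hcount)
    have hlo : i.lo ∈ l₁ := by
      simp only [List.mem_append, List.mem_singleton, i.lo_ne_hi, or_false] at hmem
      refine hmem.resolve_left fun hmem => ?_
      have := hb _ hmem
      simp only [colLt_iff, Index.lo, Index.hi] at this
      omega
    obtain ⟨x, hx, hxlo⟩ := hadj₁.exists_not_colLt_left hlen hlo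
    exact hxlo (h.forall_colLt_lo (hc.sublist (by simp)) x hx)
  · obtain rfl : z = i.lo := Fin.ext hz
    have h₁ := h.count_lo_add_le hl hi
    have h₂ := hadj₂.count_hi_le_count_lo hi fun y hy => (hz₂ y hy).le
    rw [List.count_append, List.count_cons_self] at h₁
    omega

theorem exists_tableau_of_wordOp {T : List (Word m n)} {w : Word m n} {t : Bool}
    (hT : IsTableau T) (h0 : [] ∉ T) (h : wordOp t i (readCols T) = some w) :
    ∃ T', IsTableau T' ∧ [] ∉ T' ∧ T'.map List.length = T.map List.length ∧ readCols T' = w := by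
  obtain ⟨p, s, hread, rfl, hps⟩ := wordOp_eq_some.1 h
  obtain ⟨L, a, b, L', rfl, rfl, rfl⟩ := exists_of_readCols_eq hread
  obtain ⟨hL, hleft, hc, hright, hL'⟩ := isTableau_append_cons.1 hT
  refine ⟨L ++ (a ++ target t i :: b) :: L', isTableau_append_cons.2
    ⟨hL, fun l hl => ?_, hps.isColumn_replace t hc, ?_, hL'⟩, by simpa using h0, by simp,
    by simp [readCols_append, readCols]⟩
  · cases t
    · obtain ⟨M, rfl⟩ := List.getLast?_eq_some_iff.1 hl
      exact ActsBetween.adj_left (p := readCols L') (s := readCols M)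
        (by simpa [readCols_append, readCols] using hps) hc (hL.isColumn (by simp)) (hleft l hl)
    · exact (hleft l hl).replace_right fun _ z _ _ _ _ hz _ hz' => hz ((i.colLt_mono z).2 hz')
  · cases t
    · exact hright.replace_left fun _ z _ _ _ _ hz _ hz' => hz ((i.colLt_mono z).1 hz')
    · cases L' with
      | nil => exact adj_nil _
      | cons d L' =>
        exact ActsBetween.adj_right (p := readCols L') (s := readCols L)
          (by simpa [readCols] using hps) hc hL'.1 hright

end Stability

/-! ### Sorted biwords -/

section Coloring

variable {α β γ : Type*}

theorem exists_perm_map_eq {f : α → β} {l : List α} {l' : List β} (h : l'.Perm (l.map f)) :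
    ∃ k : List α, k.Perm l ∧ k.map f = l' := by
  have hmap : List.Forall₂ (fun b a => b = f a) (l.map f) l :=
    List.forall₂_map_left_iff.2 (List.forall₂_same.2 fun _ _ => rfl)
  obtain ⟨k, hk, hperm⟩ := List.perm_comp_forall₂ h hmap
  exact ⟨k, hperm, (List.forall₂_eq_eq_eq ▸ List.forall₂_map_right_iff.2 hk :).symm⟩

theorem exists_map_fst_eq {f : α → β} {l : List α} {C : List (β × γ)}
    (h : C.map Prod.fst = l.map f) :
    ∃ E : List (α × γ), E.map Prod.fst = l ∧ E.map (Prod.map f id) = C := by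
  induction l generalizing C with
  | nil => exact ⟨[], rfl, (List.map_eq_nil_iff.1 h).symm⟩
  | cons a l ih =>
    obtain ⟨⟨_, c⟩, C, rfl, rfl, htail⟩ := List.map_eq_cons_iff.1 h
    obtain ⟨E, rfl, rfl⟩ := ih htail
    exact ⟨(a, c) :: E, rfl, rfl⟩

end Coloring

section Biwords

variable {α β : Type*} [LinearOrder α] [Parity α] [LinearOrder β] [Parity β]

/-- The super lexicographic order on pairs of letters. A pair is below itself exactly if its letters
have the same parity, so that a strictly sorted biword repeats no pair of letters of different
parity. -/
def BiLe (p q : α × β) : Prop :=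
  p.2 < q.2 ∨ p.2 = q.2 ∧ if Parity.isOdd p.2 then ColLt p.1 q.1 else ¬ ColLt p.1 q.1

instance : IsTrans (α × β) BiLe := ⟨by grind [BiLe, ColLt]⟩

variable {p q : α × β} {L L' : List (α × β)} {k N : ℕ}

theorem BiLe.snd_le (h : BiLe p q) : p.2 ≤ q.2 := by grind [BiLe]

theorem BiLe.antisymm (h : BiLe p q) (h' : BiLe q p) : p = q := by
  have h₂ : p.2 = q.2 := le_antisymm h.snd_le h'.snd_le
  refine Prod.ext ?_ h₂
  grind [BiLe, ColLt]

theorem eq_of_count_eq (h : L.Pairwise BiLe) (h' : L'.Pairwise BiLe)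
    (hcount : ∀ p, L.count p = L'.count p) : L = L' :=
  (List.perm_iff_count.2 hcount).eq_of_pairwise (fun _ _ _ _ h h' => h.antisymm h') h h'

/-- The pairs `p` and `q` may be chosen together when a subword with rows as in a tableau is
selected from a sorted biword. In contrast to `¬ ColLt p.1 q.1`, this is symmetric in `p` and `q`
and under transposition. -/
def Comparable (p q : α × β) : Prop :=
  (¬ ColLt p.1 q.1 ∧ ¬ ColLt q.2 p.2) ∨ (¬ ColLt q.1 p.1 ∧ ¬ ColLt p.2 q.2)

theorem Comparable.symm (h : Comparable p q) : Comparable q p := Or.symm h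

theorem Comparable.swap (h : Comparable p q) : Comparable p.swap q.swap :=
  h.symm.imp And.symm And.symm

theorem BiLe.comparable_iff (h : BiLe p q) : Comparable p q ↔ ¬ ColLt p.1 q.1 := by
  grind [BiLe, Comparable, ColLt]

/-- The symmetric reformulation of `RowColorable ColLt k N (L.map Prod.fst)` for sorted `L`. -/
def BiColorable (k N : ℕ) (L : List (α × β)) : Prop :=
  ∃ E : List ((α × β) × ℕ), E.map Prod.fst = L ∧
    E.Pairwise (fun e f => e.2 = f.2 → e.2 < k → Comparable e.1 f.1) ∧ N ≤ E.countP (·.2 < k)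

theorem rowColorable_map_fst_iff (h : L.Pairwise BiLe) :
    RowColorable ColLt k N (L.map Prod.fst) ↔ BiColorable k N L := by
  constructor
  · rintro ⟨C, hC, hcompat, hN⟩
    obtain ⟨E, rfl, rfl⟩ := exists_map_fst_eq hC
    refine ⟨E, rfl, ?_, by simpa [List.countP_map, Function.comp_def] using hN⟩
    exact ((List.pairwise_map.1 hcompat).and (List.pairwise_map.1 h)).imp
      fun hef hcolor hk => hef.2.comparable_iff.2 (hef.1 hcolor hk)
  · rintro ⟨E, rfl, hcompat, hN⟩
    refine ⟨E.map (Prod.map Prod.fst id), by simp [Function.comp_def], ?_,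
      by simpa [List.countP_map, Function.comp_def] using hN⟩
    exact List.pairwise_map.2 ((hcompat.and (List.pairwise_map.1 h)).imp
      fun hef hcolor hk => hef.2.comparable_iff.1 (hef.1 hcolor hk))

theorem BiColorable.perm (h : BiColorable k N L) (hperm : L'.Perm L) : BiColorable k N L' := by
  obtain ⟨E, rfl, hcompat, hN⟩ := h
  obtain ⟨F, hF, rfl⟩ := exists_perm_map_eq hperm
  refine ⟨F, rfl, hF.symm.pairwise hcompat fun {e f} hef hcolor hk => ?_, hF.countP_eq _ ▸ hN⟩
  exact (hef hcolor.symm (hcolor ▸ hk)).symm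

theorem BiColorable.map_swap (h : BiColorable k N L) : BiColorable k N (L.map Prod.swap) := by
  obtain ⟨E, rfl, hcompat, hN⟩ := h
  refine ⟨E.map (Prod.map Prod.swap id), by simp [Function.comp_def], ?_,
    by simpa [List.countP_map, Function.comp_def] using hN⟩
  exact List.pairwise_map.2 (hcompat.imp fun hef hcolor hk => (hef hcolor hk).swap)

/-- The sorted biwords `L` and `L'` belong to transposed matrices. -/
structure Dual (L : List (α × β)) (L' : List (β × α)) : Prop where
  left : L.Pairwise BiLe
  right : L'.Pairwise BiLe
  perm : L'.Perm (L.map Prod.swap)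

theorem Dual.symm {L' : List (β × α)} (h : Dual L L') : Dual L' L := by
  refine ⟨h.right, h.left, ?_⟩
  have := (h.perm.map Prod.swap).symm
  rwa [List.map_map, Prod.swap_swap_eq, List.map_id] at this

theorem Dual.filter {L' : List (β × α)} (h : Dual L L') (s : β → Bool) :
    Dual (L.filter fun p => s p.2) (L'.filter fun p => s p.1) := by
  refine ⟨h.left.filter _, h.right.filter _, ?_⟩
  convert h.perm.filter _ using 1
  rw [List.filter_map]
  rfl

theorem Dual.rowColorable {L' : List (β × α)} (h : Dual L L')
    (hcolor : RowColorable ColLt k N (L.map Prod.fst)) :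
    RowColorable ColLt k N (L'.map Prod.fst) :=
  (rowColorable_map_fst_iff h.right).2
    (((rowColorable_map_fst_iff h.left).1 hcolor).map_swap.perm h.perm)

theorem colLen_insertionTableau_eq {w : List α} {w' : List β}
    (h : ∀ k N, RowColorable ColLt k N w ↔ RowColorable ColLt k N w') :
    colLen (insertionTableau w) = colLen (insertionTableau w') := by
  refine colLen_eq_of_rowColorable (isTableau_insertionTableau w) (isTableau_insertionTableau w')
    fun k N => ?_
  rw [← (knuth_readCols_insertionTableau w).rowColorable_iff k N,
    ← (knuth_readCols_insertionTableau w').rowColorable_iff k N, h]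

/-- The shape of the insertion tableau of the first components of the pairs in `L` whose second
component satisfies `s`; for the initial sets of letters `s`, these shapes form the recording
tableau of `L`. -/
def prefixShape (s : β → Bool) (L : List (α × β)) : ℕ → ℕ :=
  colLen (insertionTableau ((L.filter fun p => s p.2).map Prod.fst))

theorem Dual.colLen_restrict {L' : List (β × α)} (h : Dual L L') {s : β → Bool}
    (hs : IsLowerSet {b | s b}) :
    colLen (restrict s (insertionTableau (L'.map Prod.fst))) = prefixShape s L := by
  rw [colLen_restrict_insertionTableau hs, List.filter_map]
  refine colLen_insertionTableau_eq fun k N => ?_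
  exact ⟨(h.filter s).symm.rowColorable, (h.filter s).rowColorable⟩

end Biwords

/-! ### A sorted biword is determined by its insertion and recording tableaux -/

section Recording

variable {α β : Type*} [LinearOrder α] [Parity α] {s : β → Bool}

theorem insertionTableau_map_fst_concat (L : List (α × β)) (p : α × β) :
    insertionTableau ((L ++ [p]).map Prod.fst) =
      tabInsert (insertionTableau (L.map Prod.fst)) p.1 := by
  rw [List.map_append, List.map_singleton, insertionTableau_concat]

theorem isLowerSet_lt [LinearOrder β] (b : β) : IsLowerSet {a | decide (a < b)} :=
  fun _ _ hle h => decide_eq_true (hle.trans_lt (of_decide_eq_true h))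

variable {L L' : List (α × β)} {p p' : α × β}

theorem prefixShape_concat_of_not (hp : ¬ s p.2) : prefixShape s (L ++ [p]) = prefixShape s L := by
  simp [prefixShape, List.filter_append, hp]

theorem prefixShape_of_forall (h : ∀ p ∈ L, s p.2) :
    prefixShape s L = colLen (insertionTableau (L.map Prod.fst)) := by
  rw [prefixShape, List.filter_eq_self.2 h]

variable [LinearOrder β] [Parity β]

theorem snd_le_of_pairwise_concat (h : (L ++ [p]).Pairwise BiLe) : ∀ q ∈ L ++ [p], q.2 ≤ p.2 := by
  intro q hq
  rcases List.mem_append.1 hq with hq | hq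
  · exact ((List.pairwise_append.1 h).2.2 q hq p (by simp)).snd_le
  · rw [List.mem_singleton.1 hq]

theorem prefixShape_of_last (hs : IsLowerSet {b | s b}) (h : (L ++ [p]).Pairwise BiLe)
    (hp : s p.2) : prefixShape s (L ++ [p]) = colLen (insertionTableau ((L ++ [p]).map Prod.fst)) :=
  prefixShape_of_forall fun q hq => hs (snd_le_of_pairwise_concat h q hq) hp

theorem prefixShape_le (hs : IsLowerSet {b | s b}) (h : L.Pairwise BiLe) (j : ℕ) :
    prefixShape s L j ≤ colLen (insertionTableau (L.map Prod.fst)) j := by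
  induction L using List.reverseRecOn with
  | nil => exact le_rfl
  | append_singleton L p ih =>
    by_cases hp : s p.2
    · rw [prefixShape_of_last hs h hp]
    · rw [prefixShape_concat_of_not hp, insertionTableau_map_fst_concat, colLen_tabInsert]
      exact (ih (List.pairwise_append.1 h).1).trans (Nat.le_add_right _ _)

/-- The boxes recorded by one letter form a horizontal strip filled from left to right if the letter
is even, and a vertical strip filled from right to left if it is odd. -/
theorem prefixShape_lt_last (h : (L ++ [p]).Pairwise BiLe) {j : ℕ}
    (hj : if Parity.isOdd p.2 then j < growthCol (insertionTableau (L.map Prod.fst)) p.1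
      else growthCol (insertionTableau (L.map Prod.fst)) p.1 < j) :
    prefixShape (· < p.2) L j = colLen (insertionTableau (L.map Prod.fst)) j := by
  induction L using List.reverseRecOn generalizing p with
  | nil => rfl
  | append_singleton L q ih =>
    have hLq := (List.pairwise_append.1 h).1
    have hqp : BiLe q p := (List.pairwise_append.1 h).2.2 q (by simp) p (by simp)
    rcases hqp with hlt | ⟨heq, hqp⟩
    · rw [prefixShape_of_last (isLowerSet_lt _) hLq (by simpa using hlt)]
    · have hgrowth := growthCol_lt_growthCol_tabInsert (x := q.1) (y := p.1)
        (isTableau_insertionTableau (L.map Prod.fst))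
      rw [insertionTableau_map_fst_concat] at hj ⊢
      rw [prefixShape_concat_of_not (by simp [heq]), colLen_tabInsert, ← heq]
      rw [← heq] at hj
      split_ifs at hqp hj with hodd
      · have hle := not_lt.1 (mt hgrowth.1 (not_not.2 hqp))
        rw [ih hLq (by rw [if_pos hodd]; omega), if_neg (by omega), add_zero]
      · have hlt := hgrowth.2 hqp
        rw [ih hLq (by rw [if_neg hodd]; omega), if_neg (by omega), add_zero]

theorem not_snd_lt_of_insertionTableau_eq (h : (L ++ [p]).Pairwise BiLe)
    (h' : (L' ++ [p']).Pairwise BiLe) (hT : insertionTableau ((L ++ [p]).map Prod.fst) =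
      insertionTableau ((L' ++ [p']).map Prod.fst))
    (hshape : ∀ s, IsLowerSet {b | s b} → prefixShape s (L ++ [p]) = prefixShape s (L' ++ [p'])) :
    ¬ p.2 < p'.2 := by
  intro hlt
  have hcol := congrFun (hshape _ (isLowerSet_lt p'.2))
    (growthCol (insertionTableau (L'.map Prod.fst)) p'.1)
  rw [prefixShape_of_last (isLowerSet_lt _) h (by simpa using hlt),
    prefixShape_concat_of_not (by simp), hT, insertionTableau_map_fst_concat, colLen_tabInsert,
    if_pos rfl] at hcol
  have := prefixShape_le (isLowerSet_lt p'.2) (List.pairwise_append.1 h').1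
    (growthCol (insertionTableau (L'.map Prod.fst)) p'.1)
  omega

theorem growthCol_eq_of_prefixShape_eq (h : (L ++ [p]).Pairwise BiLe)
    (h' : (L' ++ [p']).Pairwise BiLe) (hsnd : p.2 = p'.2)
    (hT : insertionTableau ((L ++ [p]).map Prod.fst) =
      insertionTableau ((L' ++ [p']).map Prod.fst))
    (hshape : prefixShape (· < p.2) L = prefixShape (· < p.2) L') :
    growthCol (insertionTableau (L.map Prod.fst)) p.1 =
      growthCol (insertionTableau (L'.map Prod.fst)) p'.1 := by
  have hcol j := congrFun (congrArg colLen hT) j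
  simp only [insertionTableau_map_fst_concat, colLen_tabInsert] at hcol
  have hle := prefixShape_le (isLowerSet_lt p.2) (List.pairwise_append.1 h).1
  have hle' := prefixShape_le (isLowerSet_lt p.2) (List.pairwise_append.1 h').1
  have hlast j := prefixShape_lt_last h (j := j)
  have hlast' j := prefixShape_lt_last h' (j := j)
  rw [← hsnd] at hlast'
  rw [hshape] at hle hlast
  set g := growthCol (insertionTableau (L.map Prod.fst)) p.1
  set g' := growthCol (insertionTableau (L'.map Prod.fst)) p'.1
  have hg := hcol g
  have hg' := hcol g'
  by_contra hne
  rw [if_pos rfl, if_neg hne] at hg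
  rw [if_pos rfl, if_neg (Ne.symm hne)] at hg'
  have := hle g
  have := hle' g'
  have := hlast g'
  have := hlast' g
  split_ifs at * <;> omega

theorem eq_of_insertionTableau_eq (h : L.Pairwise BiLe) (h' : L'.Pairwise BiLe)
    (hT : insertionTableau (L.map Prod.fst) = insertionTableau (L'.map Prod.fst))
    (hshape : ∀ s, IsLowerSet {b | s b} → prefixShape s L = prefixShape s L') : L = L' := by
  induction L using List.reverseRecOn generalizing L' with
  | nil =>
    have := sum_length_insertionTableau (L'.map Prod.fst)
    rw [← hT, sum_length_insertionTableau] at this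
    exact (List.length_eq_zero_iff.1 (by simpa using this.symm)).symm
  | append_singleton L p ih =>
    cases L' using List.reverseRecOn with
    | nil =>
      have := sum_length_insertionTableau ((L ++ [p]).map Prod.fst)
      rw [hT, sum_length_insertionTableau] at this
      simp at this
    | append_singleton L' p' =>
      have hsnd : p.2 = p'.2 := le_antisymm
        (not_lt.1 (not_snd_lt_of_insertionTableau_eq h' h hT.symm fun s hs => (hshape s hs).symm))
        (not_lt.1 (not_snd_lt_of_insertionTableau_eq h h' hT hshape))
      have hgrowth : growthCol (insertionTableau (L.map Prod.fst)) p.1 =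
          growthCol (insertionTableau (L'.map Prod.fst)) p'.1 := by
        refine growthCol_eq_of_prefixShape_eq h h' hsnd hT ?_
        have := hshape _ (isLowerSet_lt p.2)
        rwa [prefixShape_concat_of_not (by simp), prefixShape_concat_of_not (by simp [hsnd])]
          at this
      rw [insertionTableau_map_fst_concat, insertionTableau_map_fst_concat] at hT
      obtain ⟨hT, hfst⟩ := tabInsert_injective (isTableau_insertionTableau _)
        (isTableau_insertionTableau _) (nil_notMem_insertionTableau _)
        (nil_notMem_insertionTableau _) hgrowth hT
      have hL : L = L' := by
        refine ih (List.pairwise_append.1 h).1 (List.pairwise_append.1 h').1 hT fun s hs => ?_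
        by_cases hp : s p.2
        · have hL : ∀ q ∈ L, s q.2 := fun q hq =>
            hs (snd_le_of_pairwise_concat h q (by simp [hq])) hp
          have hL' : ∀ q ∈ L', s q.2 := fun q hq =>
            hs (snd_le_of_pairwise_concat h' q (by simp [hq])) (hsnd ▸ hp)
          rw [prefixShape_of_forall hL, prefixShape_of_forall hL', hT]
        · rw [← prefixShape_concat_of_not hp, hshape s hs, prefixShape_concat_of_not (hsnd ▸ hp)]
      rw [hL, Prod.ext hfst hsnd]

end Recording

/-! ### Every pair of tableaux of the same shape comes from a sorted biword -/

section Corner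

variable {α : Type*}

theorem colLen_append_concat (V W : List (List α)) (c : List α) (b : α) (j : ℕ) :
    colLen (V ++ (c ++ [b]) :: W) j = colLen (V ++ c :: W) j + if j = V.length then 1 else 0 := by
  induction V generalizing j with
  | nil => cases j <;> simp
  | cons d V ih => cases j <;> simp [ih]

theorem exists_first_split {P : α → Prop} {l : List α} (h : ∃ a ∈ l, P a) :
    ∃ l₁ a l₂, l = l₁ ++ a :: l₂ ∧ P a ∧ ∀ x ∈ l₁, ¬ P x := by
  classical
  obtain ⟨a, ha, hPa⟩ := h
  obtain ⟨b, l₁, l₂, hl₁, hb, hl, -⟩ := List.exists_of_eraseP (p := (P ·)) ha (by simpa using hPa)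
  exact ⟨l₁, b, l₂, hl, by simpa using hb, by simpa using hl₁⟩

theorem exists_last_split {P : α → Prop} {l : List α} (h : ∃ a ∈ l, P a) :
    ∃ l₁ a l₂, l = l₁ ++ a :: l₂ ∧ P a ∧ ∀ x ∈ l₂, ¬ P x := by
  obtain ⟨l₁, a, l₂, hl, ha, hl₁⟩ := exists_first_split (l := l.reverse) (by simpa using h)
  exact ⟨l₂.reverse, a, l₁.reverse, by simpa using congrArg List.reverse hl, ha,
    by simpa using hl₁⟩

variable [LinearOrder α] [Parity α] {V W : List (List α)} {c d : List α} {b : α}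

theorem Adj.left_of_concat (h : Adj (c ++ [b]) d) (hd : ∀ z ∈ d, ColLt z b) : Adj c d := by
  rcases h.split_left with h | ⟨d₁, d₂, rfl, -, h₁, h₂⟩
  · exact h
  · cases d₂ with
    | nil => simpa using h₁
    | cons y d₂ => exact absurd (hd y (by simp)) h₂.1

theorem Adj.right_of_concat (h : Adj c (d ++ [b])) : Adj c d := by
  obtain ⟨l₁, l₂, rfl, -, h₁, -⟩ := h.split_right
  exact h₁.append_left _

theorem IsColumn.exists_eq_concat (hd : IsColumn d) (hb : b ∈ d) (hmax : ∀ a ∈ d, a ≤ b) :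
    ∃ c, d = c ++ [b] := by
  obtain ⟨c, z, rfl⟩ := (List.eq_nil_or_concat d).resolve_left (List.ne_nil_of_mem hb)
  rw [List.concat_eq_append] at *
  refine ⟨c, ?_⟩
  rcases List.mem_append.1 hb with hbc | hbz
  · have hle := ((List.pairwise_append.1 hd).2.2 b hbc z (by simp)).le
    rw [le_antisymm hle (hmax z (by simp))]
  · rw [List.mem_singleton.1 hbz]

/-- In a tableau `V ++ (c ++ [b]) :: W` with largest entry `b`, the last box of the column
`c ++ [b]` is the extreme one with entry `b`: the rightmost one if `b` is even, the leftmost one if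
`b` is odd. -/
def IsExtremeBox (V : List (List α)) (b : α) (W : List (List α)) : Prop :=
  if Parity.isOdd b then ∀ d ∈ V, b ∉ d else ∀ d ∈ W, b ∉ d

theorem exists_isExtremeBox {U : List (List α)} (hU : IsTableau U) (h0 : readCols U ≠ []) :
    ∃ V c b W, U = V ++ (c ++ [b]) :: W ∧ (∀ a ∈ readCols U, a ≤ b) ∧ IsExtremeBox V b W := by
  obtain ⟨b, hb, hmax⟩ : ∃ b ∈ readCols U, ∀ a ∈ readCols U, a ≤ b := by
    obtain ⟨b, hb, hmax⟩ := (readCols U).toFinset.exists_max_image id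
      ⟨_, List.mem_toFinset.2 (List.head_mem h0)⟩
    exact ⟨b, List.mem_toFinset.1 hb, fun a ha => hmax a (List.mem_toFinset.2 ha)⟩
  obtain ⟨V, d, W, rfl, hd, hext⟩ : ∃ V d W, U = V ++ d :: W ∧ b ∈ d ∧ IsExtremeBox V b W := by
    unfold IsExtremeBox
    split_ifs
    · exact exists_first_split (P := fun d => b ∈ d) (mem_readCols.1 hb)
    · exact exists_last_split (P := fun d => b ∈ d) (mem_readCols.1 hb)
  obtain ⟨c, rfl⟩ := (hU.isColumn (by simp)).exists_eq_concat hd fun a ha =>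
    hmax a (mem_readCols.2 ⟨d, by simp, ha⟩)
  exact ⟨V, c, b, W, rfl, hmax, hext⟩

theorem IsExtremeBox.isTableau (hext : IsExtremeBox V b W) (hU : IsTableau (V ++ (c ++ [b]) :: W))
    (hmax : ∀ a ∈ readCols (V ++ (c ++ [b]) :: W), a ≤ b) : IsTableau (V ++ c :: W) := by
  obtain ⟨hV, hadj, hc, hright, hW⟩ := isTableau_append_cons.1 hU
  refine isTableau_append_cons.2 ⟨hV, fun l hl => (hadj l hl).right_of_concat,
    (List.pairwise_append.1 hc).1, hright.left_of_concat fun z hz => ?_, hW⟩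
  have hmem : W.headD [] ∈ W := by
    cases W with
    | nil => simp at hz
    | cons => simp
  have hzb : z ≤ b := hmax z (mem_readCols.2
    ⟨_, List.mem_append_right _ (List.mem_cons_of_mem _ hmem), hz⟩)
  have hne (hb : ¬ Parity.isOdd b) : z ≠ b := by
    rintro rfl
    rw [IsExtremeBox, if_neg hb] at hext
    exact hext _ hmem hz
  grind [ColLt]

theorem IsExtremeBox.of_mem (hext : IsExtremeBox V b W) (hc : IsColumn (c ++ [b])) {j : ℕ}
    (hj : b ∈ (V ++ c :: W).getD j []) : if Parity.isOdd b then V.length ≤ j else j < V.length := by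
  have hbc (hb : ¬ Parity.isOdd b) : b ∉ c := fun hmem => by
    have := (List.pairwise_append.1 hc).2.2 b hmem b (by simp)
    grind [ColLt]
  unfold IsExtremeBox at hext
  grind

theorem IsExtremeBox.of_colLen_restrict_lt (hext : IsExtremeBox V b W) (hc : IsColumn (c ++ [b]))
    (hmax : ∀ a ∈ readCols (V ++ c :: W), a ≤ b) {j : ℕ}
    (hj : colLen (restrict (· < b) (V ++ c :: W)) j < colLen (V ++ c :: W) j) :
    if Parity.isOdd b then V.length ≤ j else j < V.length := by
  refine hext.of_mem hc ?_
  rw [colLen_restrict] at hj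
  by_contra hb
  refine hj.ne (congrArg List.length (List.filter_eq_self.2 fun a ha => decide_eq_true ?_))
  refine (hmax a (mem_readCols.2 ⟨_, ?_, ha⟩)).lt_of_ne fun hab => hb (hab ▸ ha)
  grind

end Corner

section Surjectivity

variable {α β : Type*} [LinearOrder α] [Parity α] [LinearOrder β] [Parity β]

/-- `U` is the recording tableau of `L`, up to trailing empty columns. -/
structure IsRecording (L : List (α × β)) (U : List (List β)) : Prop where
  perm : (L.map Prod.snd).Perm (readCols U)
  prefixShape_eq : ∀ s, IsLowerSet {b | s b} → prefixShape s L = colLen (restrict s U)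

omit [Parity β] in
theorem isRecording_nil {U : List (List β)} (hU : ∀ d ∈ U, d = []) :
    IsRecording ([] : List (α × β)) U := by
  have hget (j : ℕ) : U.getD j [] = [] := by grind [List.getElem_mem]
  refine ⟨?_, fun s _ => funext fun j => ?_⟩
  · have : readCols U = [] := List.eq_nil_iff_forall_not_mem.2 fun a ha => by
      obtain ⟨d, hd, had⟩ := mem_readCols.1 ha
      simp [hU d hd] at had
    rw [this, List.map_nil]
  · rw [colLen_restrict, hget]
    rfl

variable {L : List (α × β)} {V W : List (List β)} {c : List β} {x : α} {b : β}

theorem IsRecording.pairwise_concat (hrec : IsRecording L (V ++ c :: W)) (hL : L.Pairwise BiLe)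
    (hext : IsExtremeBox V b W) (hc : IsColumn (c ++ [b]))
    (hmax : ∀ a ∈ readCols (V ++ c :: W), a ≤ b)
    (hshape : colLen (insertionTableau (L.map Prod.fst)) = colLen (V ++ c :: W))
    (hgrowth : growthCol (insertionTableau (L.map Prod.fst)) x = V.length) :
    (L ++ [(x, b)]).Pairwise BiLe := by
  induction L using List.reverseRecOn with
  | nil => simp
  | append_singleton K q =>
    suffices hq : BiLe q (x, b) by
      refine List.pairwise_append.2 ⟨hL, by simp, fun p hp r hr => ?_⟩
      obtain rfl := List.mem_singleton.1 hr
      rcases List.mem_append.1 hp with hp | hp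
      · exact _root_.trans ((List.pairwise_append.1 hL).2.2 p hp q (by simp)) hq
      · rwa [List.mem_singleton.1 hp]
    have hqb : q.2 ≤ b := hmax _ (hrec.perm.subset (by simp))
    rcases hqb.lt_or_eq with hlt | rfl
    · exact .inl hlt
    refine .inr ⟨rfl, ?_⟩
    set j := growthCol (insertionTableau (K.map Prod.fst)) q.1
    have hj := hext.of_colLen_restrict_lt hc hmax (j := j) (by
      rw [← hrec.prefixShape_eq _ (isLowerSet_lt _), prefixShape_concat_of_not (by simp), ← hshape,
        insertionTableau_map_fst_concat, colLen_tabInsert, if_pos rfl]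
      exact Nat.lt_succ_of_le (prefixShape_le (isLowerSet_lt _) (List.pairwise_append.1 hL).1 j))
    have hlt := growthCol_lt_growthCol_tabInsert (x := q.1) (y := x)
      (isTableau_insertionTableau (K.map Prod.fst))
    rw [← insertionTableau_map_fst_concat, hgrowth] at hlt
    split_ifs at hj ⊢
    · exact not_not.1 (mt hlt.2 hj.not_gt)
    · exact hlt.1 hj

theorem IsRecording.concat (hrec : IsRecording L (V ++ c :: W))
    (hL : (L ++ [(x, b)]).Pairwise BiLe)
    (hmax : ∀ a ∈ readCols (V ++ (c ++ [b]) :: W), a ≤ b)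
    (hshape : colLen (insertionTableau ((L ++ [(x, b)]).map Prod.fst)) =
      colLen (V ++ (c ++ [b]) :: W)) :
    IsRecording (L ++ [(x, b)]) (V ++ (c ++ [b]) :: W) := by
  refine ⟨?_, fun s hs => ?_⟩
  · refine List.perm_iff_count.2 fun a => ?_
    have := hrec.perm.count_eq a
    simp only [List.map_append, List.map_singleton, readCols_append, readCols,
      List.count_append] at this ⊢
    omega
  · by_cases hb : s b
    · rw [prefixShape_of_last hs hL hb, hshape, restrict_eq_self fun a ha => hs (hmax a ha) hb]
    · rw [prefixShape_concat_of_not hb, hrec.prefixShape_eq s hs]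
      simp [restrict, List.filter_append, hb]

theorem exists_isRecording {T : List (List α)} {U : List (List β)} (hT : IsTableau T)
    (h0 : [] ∉ T) (hU : IsTableau U) (hshape : colLen T = colLen U) :
    ∃ L : List (α × β), L.Pairwise BiLe ∧ insertionTableau (L.map Prod.fst) = T ∧
      IsRecording L U := by
  induction hN : (readCols U).length using Nat.strong_induction_on generalizing T U with | _ N ih
  by_cases hU0 : readCols U = []
  · have hnil : ∀ d ∈ U, d = [] := fun d hd => List.eq_nil_iff_forall_not_mem.2 fun a ha => by
      simpa [hU0] using mem_readCols.2 ⟨d, hd, ha⟩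
    have hT0 : T = [] := by
      have hU0 : colLen U 0 = 0 := by
        cases U with
        | nil => rfl
        | cons d U => simp [hnil d]
      rw [← hshape] at hU0
      cases T with
      | nil => rfl
      | cons d T => exact absurd (List.eq_nil_of_length_eq_zero hU0 ▸ List.mem_cons_self) h0
    exact ⟨[], .nil, hT0.symm, isRecording_nil hnil⟩
  obtain ⟨V, c, b, W, rfl, hmax, hext⟩ := exists_isExtremeBox hU hU0
  have hcol j := congrFun hshape j
  simp only [colLen_append_concat] at hcol
  have hV := hext.isTableau hU hmax
  obtain ⟨T₀, x, hT₀, h0₀, rfl, hgrowth⟩ := exists_tabInsert (j := V.length) hT h0 (by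
    rw [hcol, hcol, if_pos rfl, if_neg (by simp)]
    exact Nat.lt_succ_of_le (hV.colLen_succ_le _))
  have hshape₀ : colLen T₀ = colLen (V ++ c :: W) := by
    funext j
    have := hcol j
    rw [colLen_tabInsert, hgrowth] at this
    omega
  obtain ⟨L, hL, rfl, hrec⟩ := ih _ (by
    simp only [← hN, readCols_append, readCols, List.length_append, List.length_singleton]
    omega) hT₀ h0₀ hV hshape₀ rfl
  have hsorted := hrec.pairwise_concat hL hext (hU.isColumn (by simp)) (fun a ha => hmax a (by
    simp only [readCols_append, readCols, List.mem_append] at ha ⊢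
    tauto)) hshape₀ hgrowth
  refine ⟨L ++ [(x, b)], hsorted, insertionTableau_map_fst_concat _ _, ?_⟩
  exact hrec.concat hsorted hmax (by rw [insertionTableau_map_fst_concat, hshape])

end Surjectivity

/-! ### Matrices and sorted biwords -/

section Matrices

variable {m n : ℕ} {A B : Mat m n}

theorem degree_eq_zero_iff {b : Letter m n} : degree b = 0 ↔ ¬ Parity.isOdd b := by
  simp [degree, Parity.isOdd]

theorem degree_eq_one_iff {b : Letter m n} : degree b = 1 ↔ Parity.isOdd b := by
  simp [degree, Parity.isOdd]

theorem degree_eq_degree_iff {b c : Letter m n} :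
    degree b = degree c ↔ (Parity.isOdd b ↔ Parity.isOdd c) := by
  simp only [degree, Parity.isOdd, decide_eq_true_eq]
  split_ifs <;> simp <;> omega

/-- The letters in the order in which they occur in the block of the biwords with second component
`b`. -/
def blockOrder (b : Letter m n) : List (Letter m n) :=
  if degree b = 0 then (List.finRange (m + n)).reverse else List.finRange (m + n)

theorem count_blockOrder (a b : Letter m n) : (blockOrder b).count a = 1 := by
  have h := List.count_eq_one_of_mem (List.nodup_finRange (m + n)) (List.mem_finRange a)
  unfold blockOrder
  split_ifs
  · rw [List.count_reverse, h]
  · exact h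

theorem pairwise_blockOrder (b : Letter m n) :
    (blockOrder b).Pairwise fun a a' => if Parity.isOdd b then a < a' else a' < a := by
  have hlt : (List.finRange (m + n)).Pairwise (· < ·) := List.pairwise_lt_finRange _
  simp only [blockOrder, degree_eq_zero_iff, ite_not]
  split_ifs
  · exact hlt
  · exact List.pairwise_reverse.2 hlt

theorem count_flatMap_of_count_eq_one {α β : Type*} [DecidableEq α] [BEq β] [LawfulBEq β]
    {l : List α} {a : α} (h : l.count a = 1) {f : α → List β} {x : β}
    (hf : ∀ c ∈ l, x ∈ f c → c = a) :
    (l.flatMap f).count x = (f a).count x := by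
  induction l with
  | nil => simp at h
  | cons c l ih =>
    have hf' : ∀ d ∈ l, x ∈ f d → d = a := fun d hd => hf d (List.mem_cons_of_mem c hd)
    rw [List.flatMap_cons, List.count_append]
    by_cases hc : c = a
    · subst hc
      have hcl : c ∉ l := List.count_eq_zero.1 (by simpa using h)
      rw [Nat.add_eq_left, List.count_eq_zero, List.mem_flatMap]
      rintro ⟨d, hd, hx⟩
      exact hcl (hf' d hd hx ▸ hd)
    · rw [List.count_cons_of_ne hc] at h
      rw [ih h hf', List.count_eq_zero.2 (mt (hf c List.mem_cons_self) hc), zero_add]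

theorem count_biword (A : Mat m n) (p : Letter m n × Letter m n) :
    (biword A).count p = A p.1 p.2 := by
  have hcount := List.count_eq_one_of_mem (List.nodup_finRange (m + n)) (List.mem_finRange p.2)
  unfold biword
  rw [count_flatMap_of_count_eq_one hcount, ← blockOrder,
    count_flatMap_of_count_eq_one (count_blockOrder p.1 p.2), List.count_replicate_self]
  · intro a _ hp
    rw [List.eq_of_mem_replicate hp]
  · intro b _ hp
    obtain ⟨a, -, hp⟩ := List.mem_flatMap.1 hp
    rw [List.eq_of_mem_replicate hp]

theorem pairwise_biword (hA : A ∈ superMatrices m n) : (biword A).Pairwise BiLe := by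
  refine List.pairwise_flatMap.2 ⟨fun b _ => List.pairwise_flatMap.2 ⟨fun a _ => ?_, ?_⟩, ?_⟩
  · rw [List.pairwise_replicate]
    have := hA a b
    by_cases hab : degree a = degree b
    · exact .inr (.inr ⟨rfl, by grind [ColLt, degree_eq_degree_iff]⟩)
    · exact .inl (this hab)
  · refine (pairwise_blockOrder b).imp fun {a a'} h p hp q hq => ?_
    rw [List.eq_of_mem_replicate hp, List.eq_of_mem_replicate hq]
    exact .inr ⟨rfl, by grind [ColLt]⟩
  · refine (List.pairwise_lt_finRange _).imp fun {b b'} h p hp q hq => ?_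
    obtain ⟨_, _, hp⟩ := List.mem_flatMap.1 hp
    obtain ⟨_, _, hq⟩ := List.mem_flatMap.1 hq
    rw [List.eq_of_mem_replicate hp, List.eq_of_mem_replicate hq]
    exact .inl h

/-- The matrix of a biword. -/
def toMat (L : List (Letter m n × Letter m n)) : Mat m n := fun b b' => L.count (b, b')

theorem matrixOf_map (L : List (Letter m n × Letter m n)) :
    matrixOf (L.map Prod.fst) (L.map Prod.snd) = toMat L := by
  have hzip : (L.map Prod.fst).zip (L.map Prod.snd) = L := by
    rw [List.zip_map']
    exact List.map_id L
  funext b b'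
  rw [matrixOf, hzip, toMat]

theorem toMat_biword (A : Mat m n) : toMat (biword A) = A :=
  funext fun b => funext fun b' => count_biword A (b, b')

variable {L : List (Letter m n × Letter m n)}

theorem toMat_mem_superMatrices (hL : L.Pairwise BiLe) : toMat L ∈ superMatrices m n := by
  intro b b' hne
  by_contra hlt
  have hsub : [(b, b'), (b, b')].Sublist L :=
    List.replicate_sublist_iff.2 (Nat.succ_le_of_lt (not_le.1 hlt))
  have hle : BiLe (b, b') (b, b') := by simpa using hL.sublist hsub
  grind [BiLe, ColLt, degree_eq_degree_iff]

theorem biword_toMat (hL : L.Pairwise BiLe) : biword (toMat L) = L :=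
  eq_of_count_eq (pairwise_biword (toMat_mem_superMatrices hL)) hL fun p => count_biword _ p

theorem transpose_mem_superMatrices (hA : A ∈ superMatrices m n) :
    A.transpose ∈ superMatrices m n := fun b b' h => hA b' b h.symm

theorem dual_biword (hA : A ∈ superMatrices m n) : Dual (biword A) (biword A.transpose) := by
  refine ⟨pairwise_biword hA, pairwise_biword (transpose_mem_superMatrices hA),
    List.perm_iff_count.2 fun p => ?_⟩
  rw [count_biword, ← Prod.swap_swap p, List.count_map_of_injective _ _ Prod.swap_injective,
    count_biword]
  rfl

/-- The insertion tableau of a matrix; that of the transpose is its recording tableau. -/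
def matTableau (A : Mat m n) : List (List (Letter m n)) := insertionTableau (topWord A)

theorem isTableau_matTableau (A : Mat m n) : IsTableau (matTableau A) :=
  isTableau_insertionTableau _

theorem nil_notMem_matTableau (A : Mat m n) : [] ∉ matTableau A := nil_notMem_insertionTableau _

theorem colLen_restrict_matTableau_transpose (hA : A ∈ superMatrices m n) {s : Letter m n → Bool}
    (hs : IsLowerSet {b | s b}) :
    colLen (restrict s (matTableau A.transpose)) = prefixShape s (biword A) :=
  (dual_biword hA).colLen_restrict hs

theorem eq_of_matTableau_eq (hA : A ∈ superMatrices m n) (hB : B ∈ superMatrices m n)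
    (h : matTableau A = matTableau B) (h' : matTableau A.transpose = matTableau B.transpose) :
    A = B := by
  rw [← toMat_biword A, ← toMat_biword B]
  refine congrArg toMat (eq_of_insertionTableau_eq (pairwise_biword hA) (pairwise_biword hB) h
    fun s hs => ?_)
  rw [← colLen_restrict_matTableau_transpose hA hs, ← colLen_restrict_matTableau_transpose hB hs,
    h']

theorem matTableau_transpose_eq {U : List (List (Letter m n))} (hA : A ∈ superMatrices m n)
    (hU : IsTableau U) (hU0 : [] ∉ U)
    (h : ∀ s, IsLowerSet {b | s b} → prefixShape s (biword A) = colLen (restrict s U)) :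
    matTableau A.transpose = U := by
  refine (isTableau_matTableau _).eq_of_colLen_restrict hU (nil_notMem_matTableau _) hU0 fun t => ?_
  have ht : IsLowerSet {b : Letter m n | decide (b ≤ t)} := fun _ _ hle hb =>
    decide_eq_true (hle.trans (of_decide_eq_true hb))
  rw [colLen_restrict_matTableau_transpose hA ht, h _ ht]

theorem exists_matTableau {T U : List (List (Letter m n))} (hT : IsTableau T) (hT0 : [] ∉ T)
    (hU : IsTableau U) (hU0 : [] ∉ U) (h : colLen T = colLen U) :
    ∃ A ∈ superMatrices m n, matTableau A = T ∧ matTableau A.transpose = U := by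
  obtain ⟨L, hL, hfst, hrec⟩ := exists_isRecording hT hT0 hU h
  refine ⟨toMat L, toMat_mem_superMatrices hL, ?_, ?_⟩
  · rw [matTableau, topWord, biword_toMat hL, hfst]
  · refine matTableau_transpose_eq (toMat_mem_superMatrices hL) hU hU0 fun s hs => ?_
    rw [biword_toMat hL, hrec.prefixShape_eq s hs]

end Matrices

/-! ### The operators on matrices -/

section

variable {α : Type*}

theorem pairwise_replace {R : α → α → Prop} [IsTrans α R] {l l' : List α} {x y : α}
    (h : (l ++ x :: l').Pairwise R) (hl : ∀ a, l.getLast? = some a → R a x → R a y)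
    (hl' : ∀ a, l'.head? = some a → R x a → R y a) : (l ++ y :: l').Pairwise R := by
  rw [← List.isChain_iff_pairwise, List.isChain_append, List.isChain_cons] at h ⊢
  simp only [List.head?_cons, Option.mem_def, Option.some_inj, forall_eq'] at h ⊢
  exact ⟨h.1, ⟨fun a ha => hl' a ha (h.2.1.1 a ha), h.2.1.2⟩, fun a ha => hl a ha (h.2.2 a ha)⟩

theorem colLen_eq_of_map_length_eq {T T' : List (List α)}
    (h : T.map List.length = T'.map List.length) : colLen T = colLen T' := by
  have key (T : List (List α)) (j : ℕ) : colLen T j = (T.map List.length).getD j 0 :=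
    (List.getD_map (d := []) ..).symm
  funext j
  rw [key, key, h]

end

section Operators

variable {m n : ℕ} {d : Bool} {i : Index m n}

theorem wordOp_insertionTableau {w w' : Word m n} (h : wordOp d i w = some w') :
    wordOp d i (readCols (insertionTableau w)) = some (readCols (insertionTableau w')) ∧
      (insertionTableau w').map List.length = (insertionTableau w).map List.length := by
  obtain ⟨v, hv, hk⟩ := (knuth_readCols_insertionTableau w).exists_wordOp h
  obtain ⟨T, hT, h0, hlen, rfl⟩ := exists_tableau_of_wordOp (isTableau_insertionTableau w)
    (nil_notMem_insertionTableau w) hv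
  rw [hk.insertionTableau_eq, insertionTableau_readCols hT h0]
  exact ⟨hv, hlen⟩

theorem exists_wordOp_of_insertionTableau {w v : Word m n}
    (h : wordOp d i (readCols (insertionTableau w)) = some v) : ∃ w', wordOp d i w = some w' := by
  have hknuth : Knuth ColLt (readCols (insertionTableau w)) w :=
    .symm _ _ (knuth_readCols_insertionTableau w)
  obtain ⟨w', hw', -⟩ := hknuth.exists_wordOp h
  exact ⟨w', hw'⟩

section Biwords

variable {b : Letter m n} {K L : List (Letter m n × Letter m n)}

theorem ActsBetween.pairwise_biLe (h : ActsBetween i (K.map Prod.fst) (L.map Prod.fst))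
    (hs : (K ++ (source d i, b) :: L).Pairwise BiLe) :
    (K ++ (target d i, b) :: L).Pairwise BiLe := by
  refine pairwise_replace hs (fun p hp => ?_) fun p hp => ?_
  · obtain ⟨K, rfl⟩ := List.getLast?_eq_some_iff.1 hp
    rw [List.map_append, List.map_singleton] at h
    have := h.colLt_hi_iff
    cases d <;> simp only [BiLe, source, target, this] <;> exact id
  · obtain ⟨L, rfl⟩ := List.head?_eq_some_iff.1 hp
    rw [List.map_cons] at h
    have := h.colLt_lo_iff
    cases d <;> simp only [BiLe, source, target, this] <;> exact id

theorem exists_eq_filter_append (h : L.Pairwise BiLe) {s : Letter m n → Bool}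
    (hs : IsLowerSet {b | s b}) : ∃ R, L = (L.filter fun p => s p.2) ++ R := by
  induction L with
  | nil => exact ⟨[], rfl⟩
  | cons p L ih =>
    obtain ⟨hp, hL⟩ := List.pairwise_cons.1 h
    by_cases hsp : s p.2
    · obtain ⟨R, hR⟩ := ih hL
      refine ⟨R, ?_⟩
      simpa only [List.filter_cons, hsp, if_true, List.cons_append, List.cons.injEq, true_and]
    · refine ⟨p :: L, ?_⟩
      rw [List.filter_eq_nil_iff.2, List.nil_append]
      intro q hq hsq
      refine hsp (hs ?_ hsq)
      rcases List.mem_cons.1 hq with rfl | hq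
      · exact le_rfl
      · exact (hp q hq).snd_le

theorem ActsBetween.prefixShape_eq (h : ActsBetween i (K.map Prod.fst) (L.map Prod.fst))
    (hsorted : (K ++ (source d i, b) :: L).Pairwise BiLe) {s : Letter m n → Bool}
    (hs : IsLowerSet {b | s b}) :
    prefixShape s (K ++ (target d i, b) :: L) = prefixShape s (K ++ (source d i, b) :: L) := by
  obtain ⟨-, hL, hKL⟩ := List.pairwise_append.1 hsorted
  by_cases hb : s b
  · obtain ⟨R, hR⟩ := exists_eq_filter_append (List.pairwise_cons.1 hL).2 hs
    have hK : K.filter (fun p => s p.2) = K := List.filter_eq_self.2 fun p hp =>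
      hs (hKL p hp _ List.mem_cons_self).snd_le hb
    rw [hR, List.map_append] at h
    have h' := ActsBetween.of_append (u := []) h
    refine colLen_eq_of_map_length_eq (wordOp_insertionTableau (d := d) (i := i)
      (wordOp_eq_some.2 ⟨K.map Prod.fst, _, ?_, ?_, h'⟩)).2 <;>
    rw [List.filter_append, hK, List.filter_cons_of_pos (by exact hb), List.map_append,
      List.map_cons]
  · simp [prefixShape, hb]

end Biwords

/-- The operators `e_i` (`d = false`) and `f_i` (`d = true`) on matrices. -/
def matOp (d : Bool) (i : Index m n) (A : Mat m n) : Option (Mat m n) :=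
  (wordOp d i (topWord A)).map fun w => matrixOf w (bottomWord A)

/-- The operators `e_i^*` (`d = false`) and `f_i^*` (`d = true`) on matrices. -/
def matOpStar (d : Bool) (i : Index m n) (A : Mat m n) : Option (Mat m n) :=
  (wordOp d i (topWord A.transpose)).map fun l => matrixOf (bottomWord A.transpose) l

theorem transpose_matrixOf (v w : Word m n) : (matrixOf v w).transpose = matrixOf w v := by
  funext b b'
  simp only [Matrix.transpose_apply, matrixOf]
  rw [← List.zip_swap w v, ← Prod.swap_prod_mk,
    List.count_map_of_injective _ _ Prod.swap_injective]

theorem matOpStar_eq (d : Bool) (i : Index m n) (A : Mat m n) :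
    matOpStar d i A = (matOp d i A.transpose).map Matrix.transpose := by
  rw [matOpStar, matOp, Option.map_map]
  congr 1
  funext l
  exact (transpose_matrixOf _ _).symm

variable {A B : Mat m n}

theorem exists_biword_of_matOp (hA : A ∈ superMatrices m n) (h : matOp d i A = some B) :
    B ∈ superMatrices m n ∧ ∃ K b L, biword A = K ++ (source d i, b) :: L ∧
      biword B = K ++ (target d i, b) :: L ∧
      ActsBetween i (K.map Prod.fst) (L.map Prod.fst) := by
  obtain ⟨w, hw, rfl⟩ := Option.map_eq_some_iff.1 h
  obtain ⟨p, s, htop, rfl, hbetween⟩ := wordOp_eq_some.1 hw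
  obtain ⟨K, R, hbiword, rfl, hR⟩ := List.map_eq_append_iff.1 htop
  obtain ⟨⟨a, b⟩, L, rfl, rfl : a = source d i, rfl⟩ := List.map_eq_cons_iff.1 hR
  have hsorted := hbetween.pairwise_biLe (hbiword ▸ pairwise_biword hA)
  have hmat : matrixOf (K.map Prod.fst ++ target d i :: L.map Prod.fst) (bottomWord A) =
      toMat (K ++ (target d i, b) :: L) := by
    simp [← matrixOf_map, bottomWord, hbiword]
  rw [hmat]
  exact ⟨toMat_mem_superMatrices hsorted, K, b, L, hbiword, biword_toMat hsorted, hbetween⟩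

theorem exists_matOp_of_matTableau {w : Word m n}
    (h : wordOp d i (readCols (matTableau A)) = some w) : ∃ B, matOp d i A = some B := by
  obtain ⟨w', hw'⟩ := exists_wordOp_of_insertionTableau h
  exact ⟨_, by rw [matOp, hw', Option.map_some]⟩

theorem matTableau_of_matOp (hA : A ∈ superMatrices m n) (h : matOp d i A = some B) :
    wordOp d i (readCols (matTableau A)) = some (readCols (matTableau B)) ∧
      matTableau B.transpose = matTableau A.transpose := by
  obtain ⟨hB, K, b, L, hbA, hbB, hbetween⟩ := exists_biword_of_matOp hA h
  constructor
  · refine (wordOp_insertionTableau (wordOp_eq_some.2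
      ⟨K.map Prod.fst, L.map Prod.fst, ?_, ?_, hbetween⟩)).1
    · rw [topWord, hbA, List.map_append, List.map_cons]
    · rw [topWord, hbB, List.map_append, List.map_cons]
  · refine matTableau_transpose_eq hB (isTableau_matTableau _) (nil_notMem_matTableau _)
      fun s hs => ?_
    rw [colLen_restrict_matTableau_transpose hA hs, hbA, hbB]
    exact hbetween.prefixShape_eq (hbA ▸ pairwise_biword hA) hs

theorem readCols_injective {T U : List (List (Letter m n))} (hT : IsTableau T) (hT0 : [] ∉ T)
    (hU : IsTableau U) (hU0 : [] ∉ U) (h : readCols T = readCols U) : T = U := by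
  rw [← insertionTableau_readCols hT hT0, h, insertionTableau_readCols hU hU0]

theorem readCols_matTableau_inj :
    readCols (matTableau A) = readCols (matTableau B) ↔ matTableau A = matTableau B :=
  ⟨readCols_injective (isTableau_matTableau _) (nil_notMem_matTableau _) (isTableau_matTableau _)
    (nil_notMem_matTableau _), congrArg readCols⟩

theorem matOp_eq_some_iff (hA : A ∈ superMatrices m n) :
    matOp d i A = some B ↔ B ∈ superMatrices m n ∧
      wordOp d i (readCols (matTableau A)) = some (readCols (matTableau B)) ∧
      matTableau B.transpose = matTableau A.transpose := by
  refine ⟨fun h => ⟨(exists_biword_of_matOp hA h).1, matTableau_of_matOp hA h⟩, ?_⟩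
  rintro ⟨hB, hop, hrec⟩
  obtain ⟨C, hC⟩ := exists_matOp_of_matTableau hop
  obtain ⟨hop', hrec'⟩ := matTableau_of_matOp hA hC
  rw [hop, Option.some_inj, readCols_matTableau_inj] at hop'
  rw [hC, eq_of_matTableau_eq (exists_biword_of_matOp hA hC).1 hB hop'.symm
    (hrec'.trans hrec.symm)]

theorem transpose_mem_superMatrices_iff : A.transpose ∈ superMatrices m n ↔ A ∈ superMatrices m n :=
  ⟨fun h => transpose_mem_superMatrices h, transpose_mem_superMatrices⟩

theorem matOpStar_eq_some_iff_matOp :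
    matOpStar d i A = some B ↔ matOp d i A.transpose = some B.transpose := by
  rw [matOpStar_eq, Option.map_eq_some_iff]
  constructor
  · rintro ⟨C, hC, rfl⟩
    rwa [Matrix.transpose_transpose]
  · exact fun h => ⟨_, h, Matrix.transpose_transpose _⟩

theorem matOpStar_eq_some_iff (hA : A ∈ superMatrices m n) :
    matOpStar d i A = some B ↔ B ∈ superMatrices m n ∧
      wordOp d i (readCols (matTableau A.transpose)) = some (readCols (matTableau B.transpose)) ∧
      matTableau B = matTableau A := by
  rw [matOpStar_eq_some_iff_matOp, matOp_eq_some_iff (transpose_mem_superMatrices hA),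
    transpose_mem_superMatrices_iff, Matrix.transpose_transpose, Matrix.transpose_transpose]

theorem matOpStar_bind_matOp_eq_some_iff (hA : A ∈ superMatrices m n) :
    (matOpStar d i A).bind (matOp d i) = some B ↔ B ∈ superMatrices m n ∧
      wordOp d i (readCols (matTableau A)) = some (readCols (matTableau B)) ∧
      wordOp d i (readCols (matTableau A.transpose)) =
        some (readCols (matTableau B.transpose)) := by
  rw [Option.bind_eq_some_iff]
  constructor
  · rintro ⟨C, hAC, hCB⟩
    obtain ⟨hC, hrec, hins⟩ := (matOpStar_eq_some_iff hA).1 hAC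
    obtain ⟨hB, hins', hrec'⟩ := (matOp_eq_some_iff hC).1 hCB
    exact ⟨hB, hins ▸ hins', hrec' ▸ hrec⟩
  · rintro ⟨hB, hins, hrec⟩
    obtain ⟨D, hD⟩ := exists_matOp_of_matTableau hrec
    have hAD : matOpStar d i A = some D.transpose := matOpStar_eq_some_iff_matOp.2 hD
    obtain ⟨hD', hrec', hins'⟩ := (matOpStar_eq_some_iff hA).1 hAD
    rw [hrec, Option.some_inj, readCols_matTableau_inj] at hrec'
    exact ⟨_, hAD, (matOp_eq_some_iff hD').2 ⟨hB, hins' ▸ hins, hrec'⟩⟩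

theorem matOp_bind_matOpStar_eq_some_iff :
    (matOp d i A).bind (matOpStar d i) = some B ↔
      (matOpStar d i A.transpose).bind (matOp d i) = some B.transpose := by
  rw [Option.bind_eq_some_iff, Option.bind_eq_some_iff]
  simp only [matOpStar_eq_some_iff_matOp, Matrix.transpose_transpose]
  refine ⟨fun ⟨C, hAC, hCB⟩ => ⟨C.transpose, by simpa using hAC, hCB⟩,
    fun ⟨C, hAC, hCB⟩ => ⟨C.transpose, hAC, by simpa using hCB⟩⟩

theorem matOpStar_bind_matOp_comm (d : Bool) (i : Index m n) (hA : A ∈ superMatrices m n) :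
    (matOpStar d i A).bind (matOp d i) = (matOp d i A).bind (matOpStar d i) := by
  ext B
  rw [matOp_bind_matOpStar_eq_some_iff, matOpStar_bind_matOp_eq_some_iff hA,
    matOpStar_bind_matOp_eq_some_iff (transpose_mem_superMatrices hA),
    transpose_mem_superMatrices_iff, Matrix.transpose_transpose, Matrix.transpose_transpose,
    and_comm (a := wordOp d i (readCols (matTableau A)) = _)]

/-- The diagonal operators `e_i e_i^*` (`d = false`) and `f_i f_i^*` (`d = true`). -/
def diagOp (d : Bool) (i : Index m n) (A : Mat m n) : Option (Mat m n) :=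
  (matOpStar d i A).bind (matOp d i)

theorem mem_symmetricMatrices_iff (hA : A ∈ superMatrices m n) :
    A ∈ symmetricMatrices m n ↔ matTableau A.transpose = matTableau A :=
  ⟨fun h => congrArg matTableau h.2, fun h => ⟨hA, eq_of_matTableau_eq
    (transpose_mem_superMatrices hA) hA h (by rw [Matrix.transpose_transpose, h])⟩⟩

theorem exists_symmetric_matTableau {T : List (List (Letter m n))} (hT : IsTableau T)
    (h0 : [] ∉ T) : ∃ A ∈ symmetricMatrices m n, matTableau A = T := by
  obtain ⟨A, hA, hins, hrec⟩ := exists_matTableau hT h0 hT h0 rfl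
  exact ⟨A, (mem_symmetricMatrices_iff hA).2 (hrec.trans hins.symm), hins⟩

theorem diagOp_eq_some_iff (hA : A ∈ symmetricMatrices m n) :
    diagOp d i A = some B ↔ B ∈ symmetricMatrices m n ∧
      wordOp d i (readCols (matTableau A)) = some (readCols (matTableau B)) := by
  rw [diagOp, matOpStar_bind_matOp_eq_some_iff hA.1, hA.2]
  constructor
  · rintro ⟨hB, hins, hrec⟩
    rw [hins, Option.some_inj, readCols_matTableau_inj] at hrec
    exact ⟨(mem_symmetricMatrices_iff hB).2 hrec.symm, hins⟩
  · rintro ⟨hB, hop⟩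
    exact ⟨hB.1, hop, by rw [hB.2, hop]⟩

theorem diagOp_eq_none_iff (hA : A ∈ symmetricMatrices m n) :
    diagOp d i A = none ↔ wordOp d i (readCols (matTableau A)) = none := by
  simp only [Option.eq_none_iff_forall_ne_some]
  constructor
  · intro h w hw
    obtain ⟨T, hT, h0, -, rfl⟩ := exists_tableau_of_wordOp (isTableau_matTableau A)
      (nil_notMem_matTableau A) hw
    obtain ⟨B, hB, rfl⟩ := exists_symmetric_matTableau hT h0
    exact h B ((diagOp_eq_some_iff hA).2 ⟨hB, hw⟩)
  · exact fun h B hB => h _ ((diagOp_eq_some_iff hA).1 hB).2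

theorem powersNeZero_eq_Iic {B : Type} {x : B → Option B} {N : B → ℕ} {S : Set B}
    (hnone : ∀ a ∈ S, x a = none → N a = 0)
    (hsome : ∀ a ∈ S, ∀ b, x a = some b → b ∈ S ∧ N b + 1 = N a) {a : B} (ha : a ∈ S) :
    powersNeZero x a = Set.Iic (N a) := by
  ext k
  induction k generalizing a with
  | zero => simp [powersNeZero]
  | succ k ih =>
    have hk : k + 1 ∈ powersNeZero x a ↔ (fun y : Option B => y.bind x)^[k] (x a) ≠ none := Iff.rfl
    rw [hk, Set.mem_Iic]
    cases hx : x a with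
    | none =>
      rw [hnone a ha hx, Function.iterate_fixed rfl]
      simp
    | some b =>
      obtain ⟨hb, hN⟩ := hsome a ha b hx
      rw [← hN, Nat.succ_le_succ_iff, ← Set.mem_Iic, ← ih hb, powersNeZero, Set.mem_ofPred_eq]

theorem powersNeZero_diagOp (d : Bool) (i : Index m n) (hA : A ∈ symmetricMatrices m n) :
    powersNeZero (diagOp d i) A = Set.Iic (wordNum d i (readCols (matTableau A))) := by
  refine powersNeZero_eq_Iic (N := fun A => wordNum d i (readCols (matTableau A)))
    (fun A hA h => ?_) (fun A hA B h => ?_) hA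
  · exact wordOp_eq_none.1 ((diagOp_eq_none_iff hA).1 h)
  · obtain ⟨hB, hop⟩ := (diagOp_eq_some_iff hA).1 h
    exact ⟨hB, (wordNum_of_wordOp hop).1.symm⟩

end Operators

/-! ### Shapes and fillings of Young diagrams -/

section Shapes

variable {α : Type*} {T : List (List α)}

theorem lt_length_of_lt_colLen {i j : ℕ} (h : i < colLen T j) : j < T.length := by
  by_contra hj
  rw [colLen, List.getD_eq_default _ _ (not_lt.1 hj)] at h
  exact Nat.not_lt_zero i h

theorem colLen_pos_iff (h0 : [] ∉ T) {j : ℕ} : 0 < colLen T j ↔ j < T.length := by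
  refine ⟨lt_length_of_lt_colLen, fun hj => ?_⟩
  rw [colLen, List.getD_eq_getElem _ _ hj, List.length_pos_iff]
  exact fun hnil => h0 (hnil ▸ List.getElem_mem hj)

theorem youngDiagram_eq_of_colLen {μ ν : YoungDiagram} (h : μ.colLen = ν.colLen) : μ = ν := by
  ext ⟨i, j⟩
  simp only [YoungDiagram.mem_cells, YoungDiagram.mem_iff_lt_colLen, h]

theorem lt_rowLen_zero_iff {μ : YoungDiagram} {j : ℕ} : j < μ.rowLen 0 ↔ 0 < μ.colLen j := by
  rw [← YoungDiagram.mem_iff_lt_rowLen, ← YoungDiagram.mem_iff_lt_colLen]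

theorem readCols_map {ι : Type*} (l : List ι) (f : ι → List α) :
    readCols (l.map f) = l.reverse.flatMap f := by
  induction l with
  | nil => rfl
  | cons a l ih => simp [readCols, ih]

/-- The list of the columns of a filling of a Young diagram. -/
def columns {μ : YoungDiagram} (F : {c // c ∈ μ} → α) : List (List α) :=
  (List.range (μ.rowLen 0)).map fun j =>
    List.ofFn fun k : Fin (μ.colLen j) => F ⟨(k.val, j), μ.mem_iff_lt_colLen.2 k.isLt⟩

theorem getD_columns {μ : YoungDiagram} (F : {c // c ∈ μ} → α) (j : ℕ) :
    (columns F).getD j [] =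
      List.ofFn fun k : Fin (μ.colLen j) => F ⟨(k.val, j), μ.mem_iff_lt_colLen.2 k.isLt⟩ := by
  by_cases hj : j < μ.rowLen 0
  · simp [columns, hj]
  · have hcol : μ.colLen j = 0 := by
      rwa [lt_rowLen_zero_iff, Nat.pos_iff_ne_zero, not_not] at hj
    rw [List.getD_eq_default _ _ (by simpa [columns] using hj)]
    exact (List.length_eq_zero_iff.1 (by rw [List.length_ofFn, hcol])).symm

theorem colLen_columns {μ : YoungDiagram} (F : {c // c ∈ μ} → α) :
    colLen (columns F) = μ.colLen := by
  funext j
  rw [colLen, getD_columns, List.length_ofFn]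

theorem nil_notMem_columns {μ : YoungDiagram} (F : {c // c ∈ μ} → α) : [] ∉ columns F := by
  intro h
  obtain ⟨j, hj, hnil⟩ := List.mem_map.1 h
  have hpos := lt_rowLen_zero_iff.1 (List.mem_range.1 hj)
  rw [← List.length_eq_zero_iff, List.length_ofFn] at hnil
  exact hpos.ne' hnil

/-- The filling of a Young diagram `μ` whose columns are those of `T`, a list of columns of
shape `μ`. -/
def filling (T : List (List α)) {μ : YoungDiagram} (hshape : colLen T = μ.colLen)
    (c : {c // c ∈ μ}) : α :=
  (T.getD c.val.2 [])[c.val.1]'(by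
    change c.val.1 < colLen T c.val.2
    rw [hshape, ← YoungDiagram.mem_iff_lt_colLen]
    exact c.2)

theorem columns_filling {μ : YoungDiagram} (h0 : [] ∉ T) (hshape : colLen T = μ.colLen) :
    columns (filling T hshape) = T := by
  have hlen : μ.rowLen 0 = T.length := eq_of_forall_lt_iff fun j => by
    rw [lt_rowLen_zero_iff, ← hshape, colLen_pos_iff h0]
  refine List.ext_getElem (by simp [columns, hlen]) fun j hj hj' => ?_
  rw [← List.getD_eq_getElem _ [] hj, ← List.getD_eq_getElem _ [] hj', getD_columns]
  refine List.ext_getElem (by rw [List.length_ofFn, ← hshape, colLen]) fun k _ _ => ?_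
  rw [List.getElem_ofFn, filling]

end Shapes

section Tableaux

variable {α : Type*} [LinearOrder α] [Parity α] {T : List (List α)}

/-- The Young diagram of a tableau. -/
def shape (T : List (List α)) (hT : IsTableau T) : YoungDiagram where
  cells := (Finset.range (colLen T 0) ×ˢ Finset.range T.length).filter fun c => c.1 < colLen T c.2
  isLowerSet := by
    rintro ⟨a, b⟩ ⟨c, d⟩ ⟨hca, hdb⟩ h
    dsimp only at hca hdb
    simp only [Finset.coe_filter, Finset.mem_product, Finset.mem_range, Set.mem_ofPred_eq] at h ⊢
    have := hT.colLen_antitone hdb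
    omega

theorem colLen_shape (hT : IsTableau T) : (shape T hT).colLen = colLen T := by
  funext j
  refine eq_of_forall_lt_iff fun i => ?_
  rw [← YoungDiagram.mem_iff_lt_colLen, ← YoungDiagram.mem_cells]
  simp only [shape, Finset.mem_filter, Finset.mem_product, Finset.mem_range, and_iff_right_iff_imp]
  exact fun h => ⟨h.trans_le (hT.colLen_antitone (Nat.zero_le j)), lt_length_of_lt_colLen h⟩

theorem IsTableau.adj_getD_succ : ∀ {T : List (List α)}, IsTableau T → ∀ j,
    Adj (T.getD j []) (T.getD (j + 1) [])
  | [], _, _ => trivial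
  | [_], h, 0 => h.2.1
  | _ :: _ :: _, h, 0 => h.2.1
  | c :: T, h, j + 1 => by simpa using IsTableau.adj_getD_succ h.2.2 j

theorem IsTableau.adj_getD (h : IsTableau T) {j k : ℕ} (hjk : j < k) :
    Adj (T.getD j []) (T.getD k []) := by
  induction k, hjk using Nat.le_induction with
  | base => exact h.adj_getD_succ j
  | succ k _ ih => exact ih.trans (h.adj_getD_succ k)

theorem isTableau_of_getD : ∀ {T : List (List α)}, (∀ j, IsColumn (T.getD j [])) →
    (∀ j, Adj (T.getD j []) (T.getD (j + 1) [])) → IsTableau T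
  | [], _, _ => trivial
  | [_], h, _ => ⟨h 0, adj_nil _, trivial⟩
  | _ :: _ :: _, h, h' => ⟨h 0, h' 0, isTableau_of_getD (fun j => h (j + 1)) fun j => h' (j + 1)⟩

theorem adj_of_getElem : ∀ {c d : List α} (_ : d.length ≤ c.length),
    (∀ r (h : r < d.length), ¬ ColLt (d)[r] (c)[r]) → Adj c d
  | _, [], _, _ => adj_nil _
  | [], _ :: _, hlen, _ => (Nat.not_succ_le_zero _ hlen).elim
  | _ :: _, _ :: _, hlen, h => ⟨h 0 (Nat.succ_pos _), adj_of_getElem (Nat.le_of_succ_le_succ hlen)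
      fun r hr => h (r + 1) (Nat.succ_lt_succ hr)⟩

end Tableaux

section Letters

variable {m n : ℕ} {T : List (Word m n)} {μ : YoungDiagram}

theorem IsColumn.le_getElem {c : Word m n} (hc : IsColumn c) :
    ∀ k (h : k < c.length), min k m ≤ ((c)[k]).val
  | 0, _ => by simp
  | k + 1, h => by
    have hk := IsColumn.le_getElem hc k (by omega)
    have hlt := List.pairwise_iff_getElem.1 hc k (k + 1) (by omega) h (by omega)
    rw [colLt_iff] at hlt
    omega

theorem IsTableau.add_le_getElem (hT : IsTableau T) :
    ∀ j (h : m < (T.getD j []).length), m + j ≤ ((T.getD j [])[m]).val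
  | 0, h => by simpa using (hT.isColumn_getD 0).le_getElem m h
  | j + 1, h => by
    have hadj := hT.adj_getD_succ j
    have hj := IsTableau.add_le_getElem hT j (h.trans_le hadj.length_le)
    have hlt := hadj.not_colLt (List.getElem?_eq_getElem h)
      (List.getElem?_eq_getElem (h.trans_le hadj.length_le))
    rw [colLt_iff] at hlt
    omega

theorem rowLen_shape_le (hT : IsTableau T) : (shape T hT).rowLen m ≤ n := by
  by_contra hlt
  have hmem : (m, n) ∈ shape T hT := YoungDiagram.mem_iff_lt_rowLen.2 (not_le.1 hlt)
  rw [YoungDiagram.mem_iff_lt_colLen, colLen_shape] at hmem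
  have := hT.add_le_getElem n hmem
  have := ((T.getD n [])[m]'hmem).isLt
  omega

theorem readCols_columns (F : {c // c ∈ μ} → Letter m n) :
    readCols (columns F) = columnReading μ F := readCols_map _ _

theorem colLt_iff_degree {a b : Letter m n} :
    ColLt a b ↔ a ≤ b ∧ (degree a = 0 → degree b = 0 → a < b) := by
  simp only [degree_eq_zero_iff]
  grind [ColLt]

theorem not_colLt_iff_degree {a b : Letter m n} :
    ¬ ColLt b a ↔ a ≤ b ∧ (degree a = 1 → degree b = 1 → a < b) := by
  simp only [degree_eq_one_iff]
  grind [ColLt]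

theorem isHookSemistandard_iff {F : {c // c ∈ μ} → Letter m n} :
    IsHookSemistandard μ F ↔
      (∀ c d, c.val.2 = d.val.2 → c.val.1 < d.val.1 → ColLt (F c) (F d)) ∧
      ∀ c d, c.val.1 = d.val.1 → c.val.2 < d.val.2 → ¬ ColLt (F d) (F c) := by
  simp only [not_colLt_iff_degree]
  simp only [colLt_iff_degree]
  exact ⟨fun h => ⟨fun c d hcol hlt => ⟨h.col_weak c d hcol hlt, h.col_strict c d hcol hlt⟩,
      fun c d hrow hlt => ⟨h.row_weak c d hrow hlt, h.row_strict c d hrow hlt⟩⟩,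
    fun ⟨hcol, hrow⟩ => ⟨fun c d h hlt => (hrow c d h hlt).1, fun c d h hlt => (hcol c d h hlt).1,
      fun c d h hlt => (hcol c d h hlt).2, fun c d h hlt => (hrow c d h hlt).2⟩⟩

theorem isTableau_columns {F : {c // c ∈ μ} → Letter m n} (h : IsHookSemistandard μ F) :
    IsTableau (columns F) := by
  obtain ⟨hcol, hrow⟩ := isHookSemistandard_iff.1 h
  refine isTableau_of_getD (fun j => ?_) fun j => ?_
  · rw [getD_columns]
    exact List.pairwise_ofFn.2 fun a b hab => hcol _ _ rfl hab
  · rw [getD_columns, getD_columns]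
    refine adj_of_getElem ?_ fun r hr => ?_
    · rw [List.length_ofFn, List.length_ofFn]
      exact μ.colLen_anti _ _ (Nat.le_succ j)
    · rw [List.getElem_ofFn, List.getElem_ofFn]
      exact hrow _ _ rfl (Nat.lt_succ_self j)

theorem isHookSemistandard_filling (hT : IsTableau T) (hshape : colLen T = μ.colLen) :
    IsHookSemistandard μ (filling T hshape) := by
  refine isHookSemistandard_iff.2 ⟨?_, ?_⟩
  · rintro ⟨⟨i, j⟩, _⟩ ⟨⟨i', j'⟩, _⟩ (rfl : j = j') hlt
    exact List.pairwise_iff_getElem.1 (hT.isColumn_getD j) _ _ _ _ hlt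
  · rintro ⟨⟨i, j⟩, _⟩ ⟨⟨i', j'⟩, _⟩ (rfl : i = i') hlt
    exact (hT.adj_getD hlt).not_colLt (List.getElem?_eq_getElem _) (List.getElem?_eq_getElem _)

theorem mem_tableauWords {w : Word m n} : w ∈ tableauWords m n μ ↔
    ∃ T : List (Word m n), IsTableau T ∧ [] ∉ T ∧ colLen T = μ.colLen ∧ readCols T = w := by
  constructor
  · rintro ⟨F, hF, rfl⟩
    exact ⟨columns F, isTableau_columns hF, nil_notMem_columns F, colLen_columns F,
      readCols_columns F⟩
  · rintro ⟨T, hT, h0, hshape, rfl⟩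
    refine ⟨filling T hshape, isHookSemistandard_filling hT hshape, ?_⟩
    rw [← readCols_columns, columns_filling h0]

theorem mem_tableauWords_of_wordOp {d : Bool} {i : Index m n} {w w' : Word m n}
    (hw : w ∈ tableauWords m n μ) (h : wordOp d i w = some w') : w' ∈ tableauWords m n μ := by
  obtain ⟨T, hT, h0, hshape, rfl⟩ := mem_tableauWords.1 hw
  obtain ⟨T', hT', h0', hlen, rfl⟩ := exists_tableau_of_wordOp hT h0 h
  exact mem_tableauWords.2 ⟨T', hT', h0', (colLen_eq_of_map_length_eq hlen).trans hshape, rfl⟩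

theorem isCrystalOn_tableauWords (μ : YoungDiagram) :
    IsCrystalOn (wordMaps m n) (tableauWords m n μ) :=
  isCrystalOn_wordMaps fun _ _ _ _ hw h => mem_tableauWords_of_wordOp hw h

end Letters

/-! ### The crystal of symmetric matrices -/

section Diagonal

variable {m n : ℕ} {i : Index m n} {A B : Mat m n}

theorem IsCrystalOn.comap {β γ : Type} {C : CrystalMaps m n β} {D : CrystalMaps m n γ} {S : Set β}
    {T : Set γ} {g : β → γ} (hD : IsCrystalOn D T) (hg : Set.MapsTo g S T)
    (hwt : ∀ b ∈ S, C.wt b = D.wt (g b)) (heps : ∀ i, ∀ b ∈ S, C.eps i b = D.eps i (g b))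
    (hphi : ∀ i, ∀ b ∈ S, C.phi i b = D.phi i (g b))
    (he : ∀ i, ∀ b ∈ S, ∀ b', C.e i b = some b' ↔ b' ∈ S ∧ D.e i (g b) = some (g b'))
    (hf : ∀ i, ∀ b ∈ S, ∀ b', C.f i b = some b' ↔ b' ∈ S ∧ D.f i (g b) = some (g b')) :
    IsCrystalOn C S where
  e_mem i b hb b' h := ((he i b hb b').1 h).1
  f_mem i b hb b' h := ((hf i b hb b').1 h).1
  phi_sub_eps i hi b hb := by
    rw [hphi i b hb, heps i b hb, hwt b hb]
    exact hD.phi_sub_eps i hi _ (hg hb)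
  coroot_zero_nonneg i hi b hb := by
    rw [hwt b hb]
    exact hD.coroot_zero_nonneg i hi _ (hg hb)
  phi_add_eps i hi b hb := by
    rw [hphi i b hb, heps i b hb, hwt b hb]
    exact hD.phi_add_eps i hi _ (hg hb)
  of_e i b hb b' h := by
    obtain ⟨hb', h⟩ := (he i b hb b').1 h
    rw [heps i b hb, heps i b' hb', hphi i b hb, hphi i b' hb', hwt b hb, hwt b' hb']
    exact hD.of_e i _ (hg hb) _ h
  of_f i b hb b' h := by
    obtain ⟨hb', h⟩ := (hf i b hb b').1 h
    rw [heps i b hb, heps i b' hb', hphi i b hb, hphi i b' hb', hwt b hb, hwt b' hb']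
    exact hD.of_f i _ (hg hb) _ h
  f_iff_e i b hb b' hb' := by
    rw [hf i b hb, he i b' hb', hD.f_iff_e i _ (hg hb) _ (hg hb')]
    exact ⟨fun h => ⟨hb, h.2⟩, fun h => ⟨hb', h.2⟩⟩

theorem diagonalMaps_wt (A : Mat m n) :
    (diagonalMaps m n).wt A = wordWt (readCols (matTableau A)) :=
  (knuth_readCols_insertionTableau (topWord A)).wordWt_eq

theorem sSup_powersNeZero (d : Bool) (i : Index m n) (hA : A ∈ symmetricMatrices m n) :
    sSup (powersNeZero (diagOp d i) A) = wordNum d i (readCols (matTableau A)) := by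
  rw [powersNeZero_diagOp d i hA, csSup_Iic]

theorem isGreatest_powersNeZero (d : Bool) (i : Index m n) (hA : A ∈ symmetricMatrices m n) :
    IsGreatest (powersNeZero (diagOp d i) A) (sSup (powersNeZero (diagOp d i) A)) := by
  rw [sSup_powersNeZero d i hA, powersNeZero_diagOp d i hA]
  exact isGreatest_Iic

theorem isCrystalOn_diagonalMaps : IsCrystalOn (diagonalMaps m n) (symmetricMatrices m n) :=
  (isCrystalOn_wordMaps (S := Set.univ) fun _ _ _ _ _ _ => Set.mem_univ _).comap
    (g := fun A => readCols (matTableau A)) (Set.mapsTo_univ _ _) (fun A _ => diagonalMaps_wt A)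
    (fun i _ hA => sSup_powersNeZero false i hA) (fun i _ hA => sSup_powersNeZero true i hA)
    (fun _ _ hA _ => diagOp_eq_some_iff (d := false) hA)
    fun _ _ hA _ => diagOp_eq_some_iff (d := true) hA

/-- The tableau of a symmetric matrix, as an element of the direct sum of the crystals of
tableaux. -/
def toTableau (A : symmetricMatrices m n) :
    {x : HookPartition m n × Word m n | x.2 ∈ tableauWords m n x.1.val} :=
  ⟨(⟨shape (matTableau A.val) (isTableau_matTableau _), rowLen_shape_le _⟩,
      readCols (matTableau A.val)),
    mem_tableauWords.2 ⟨matTableau A.val, isTableau_matTableau _, nil_notMem_matTableau _,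
      (colLen_shape (isTableau_matTableau _)).symm, rfl⟩⟩

theorem toTableau_bijective : Function.Bijective (toTableau (m := m) (n := n)) := by
  constructor
  · rintro ⟨A, hA⟩ ⟨B, hB⟩ h
    have hAB : matTableau A = matTableau B :=
      readCols_matTableau_inj.1 (congrArg (fun x => x.val.2) h)
    exact Subtype.ext (eq_of_matTableau_eq hA.1 hB.1 hAB (by rw [hA.2, hB.2, hAB]))
  · rintro ⟨⟨μ, w⟩, hw⟩
    obtain ⟨T, hT, h0, hshape, rfl⟩ := mem_tableauWords.1 hw
    obtain ⟨A, hA, rfl⟩ := exists_symmetric_matTableau hT h0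
    exact ⟨⟨A, hA⟩, Subtype.ext (Prod.ext (Subtype.ext
      (youngDiagram_eq_of_colLen ((colLen_shape hT).trans hshape))) rfl)⟩

theorem shape_eq_of_wordOp {d : Bool} {T U : List (Word m n)} (hT : IsTableau T) (hT0 : [] ∉ T)
    (hU : IsTableau U) (hU0 : [] ∉ U) (h : wordOp d i (readCols T) = some (readCols U)) :
    shape T hT = shape U hU := by
  obtain ⟨V, hV, hV0, hlen, hVU⟩ := exists_tableau_of_wordOp hT hT0 h
  obtain rfl := readCols_injective hV hV0 hU hU0 hVU
  refine youngDiagram_eq_of_colLen ?_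
  rw [colLen_shape, colLen_shape, colLen_eq_of_map_length_eq hlen]

theorem isomorphic_tableaux : Isomorphic (diagonalMaps m n) (symmetricMatrices m n)
    ((wordMaps m n).copies (HookPartition m n)) {x | x.2 ∈ tableauWords m n x.1.val} := by
  refine ⟨Equiv.ofBijective _ toTableau_bijective, fun A => (diagonalMaps_wt A.val).symm,
    fun i A => (sSup_powersNeZero false i A.2).symm, fun i A => (sSup_powersNeZero true i A.2).symm,
    fun i A B => (diagOp_eq_some_iff (d := true) A.2).trans ?_⟩
  change _ ↔ (wordOp true i (readCols (matTableau A.val))).map _ = some (toTableau B).val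
  rw [Option.map_eq_some_iff]
  constructor
  · rintro ⟨-, h⟩
    have hshape := shape_eq_of_wordOp (isTableau_matTableau A.val) (nil_notMem_matTableau _)
      (isTableau_matTableau B.val) (nil_notMem_matTableau _) h
    exact ⟨_, h, Prod.ext (Subtype.ext hshape) rfl⟩
  · rintro ⟨w, h, hw⟩
    obtain rfl : w = readCols (matTableau B.val) := congrArg Prod.snd hw
    exact ⟨B.2, h⟩

end Diagonal

end HookCrystal

theorem proposition3p9 (m n : ℕ) (hmn : 0 < m + n) :
    -- the diagonal operators do not depend on the order of the two factors
    (∀ i : HookCrystal.Index m n, ∀ A ∈ HookCrystal.symmetricMatrices m n,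
      (HookCrystal.matEStar i A).bind (HookCrystal.matE i) =
          (HookCrystal.matE i A).bind (HookCrystal.matEStar i) ∧
        (HookCrystal.matFStar i A).bind (HookCrystal.matF i) =
          (HookCrystal.matF i A).bind (HookCrystal.matFStar i)) ∧
    -- the maxima that define `ε_i` and `φ_i` exist
    (∀ i : HookCrystal.Index m n, ∀ A ∈ HookCrystal.symmetricMatrices m n,
      IsGreatest (HookCrystal.powersNeZero (HookCrystal.diagE i) A)
          ((HookCrystal.diagonalMaps m n).eps i A) ∧
        IsGreatest (HookCrystal.powersNeZero (HookCrystal.diagF i) A)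
          ((HookCrystal.diagonalMaps m n).phi i A)) ∧
    -- the symmetric matrices form a crystal
    HookCrystal.IsCrystalOn (HookCrystal.diagonalMaps m n) (HookCrystal.symmetricMatrices m n) ∧
    -- which decomposes as the direct sum of the crystals of tableaux
    (∀ μ : HookCrystal.HookPartition m n,
      HookCrystal.IsCrystalOn (HookCrystal.wordMaps m n) (HookCrystal.tableauWords m n μ.val)) ∧
    HookCrystal.Isomorphic (HookCrystal.diagonalMaps m n) (HookCrystal.symmetricMatrices m n)
      ((HookCrystal.wordMaps m n).copies (HookCrystal.HookPartition m n))
      {x | x.2 ∈ HookCrystal.tableauWords m n x.1.val} := by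
  refine ⟨fun i A hA => ⟨?_, ?_⟩, fun i A hA => ⟨?_, ?_⟩, HookCrystal.isCrystalOn_diagonalMaps,
    fun μ => HookCrystal.isCrystalOn_tableauWords μ.val, HookCrystal.isomorphic_tableaux⟩
  · exact HookCrystal.matOpStar_bind_matOp_comm false i hA.1
  · exact HookCrystal.matOpStar_bind_matOp_comm true i hA.1
  · exact HookCrystal.isGreatest_powersNeZero false i hA
  · exact HookCrystal.isGreatest_powersNeZero true i hA
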